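/- Let $\mathbb T=\mathbb R/\mathbb Z$, let $f:\mathbb R\to\mathbb R$ be bounded and Lipschitz, and let $s>1/2$, $p\in[1,2)$, $\varepsilon>0$, $m\in\mathbb R$. For a distribution $g$ on $\mathbb T$ with Fourier coefficients $\hat g(k)$ put $\|g\|_{\dot H_s}^2=\sum_{k\in\mathbb Z}(2\pi|k|)^{2s}|\hat g(k)|^2$, and let $(-\partial_{xx})^s$ be the operator with Fourier multiplier $(2\pi|k|)^{2s}$. For $T>0$ let $\mathcal H_T=L_2([0,T];\dot H_s(\mathbb T))$ with dual $\mathcal H_T^*=L_2([0,T];\dot H_{-s}(\mathbb T))$. For a distribution $g$ on $(0,T)\times\mathbb T$, $\|g\|_{\mathcal H_T^*}^2=\int_0^T\|h(t)\|_{\dot H_s}^2\,dt$ if $g=(-\partial_{xx})^s h$ with $h\in\mathcal H_T$, and $\|g\|_{\mathcal H_T^*}=+\infty$ if there is no such $h$. Let $\mathcal X_T=C([0,T];H^{-1}(\mathbb T))\cap L_p([0,T]\times\mathbb T)$. For $u\in\mathcal X_T$ define $$I_{\varepsilon,T}(u)=\frac{1}{2\varepsilon}\Big\|\partial_t u+\partial_x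 f(u)+\frac{\varepsilon}{2}(-\partial_{xx})^s u\Big\|_{\mathcal H_T^*}^2$$ if $u\in\mathcal H_T\cap C([0,T];L_2(\mathbb T))$ and $u(0)\equiv m$, the derivatives being taken in the sense of distributions on $(0,T)\times\mathbb T$, and $I_{\varepsilon,T}(u)=+\infty$ otherwise. For $w\in L_2(\mathbb T)$ define the quasipotential $$V_\varepsilon(m;w)=\inf_{T>0}\ \inf\big\{I_{\varepsilon,T}(u)\,:\,u\in\mathcal X_T,\ u(0)\equiv m,\ u(T)=w\big\}\in[0,+\infty].$$ Then for every $w\in L_2(\mathbb T)$ $$V_\varepsilon(m;w)=\begin{cases}\tfrac12\|w-m\|_{L_2(\mathbb T)}^2&\text{if }\int_{\mathbb T}w(x)\,dx=m,\\ +\infty&\text{otherwise.}\end{cases}$$ In particular $V_\varepsilon(m;w)$ does not depend on $\varepsilon$. -/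

import Mathlib

open MeasureTheory Set
open scoped ENNReal

noncomputable section

namespace FracCost

/-- Fourier coefficients `∫ g(x) exp(-2πikx) dx` of a real function on the torus `ℝ/ℤ`. -/
def coeff (g : UnitAddCircle → ℝ) (k : ℤ) : ℂ :=
  fourierCoeff (fun x => (g x : ℂ)) k

/-- The real Hilbert space `L₂(𝕋)`; the torus carries its Lebesgue measure, of total mass one. -/
abbrev L2T : Type := Lp ℝ 2 (volume : Measure UnitAddCircle)

/-- The space `H^{-1}(𝕋)` of real distributions, given through their Fourier coefficients. -/
structure HMinusOne where
  hat : ℤ → ℂ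
  hat_neg : ∀ k, hat (-k) = starRingEnd ℂ (hat k)
  summable : Summable fun k : ℤ => ‖hat k‖ ^ 2 / (1 + (2 * Real.pi * k) ^ 2)

namespace HMinusOne

theorem weight_pos (k : ℤ) : 0 < 1 + (2 * Real.pi * (k : ℝ)) ^ 2 := by positivity

/-- The isometry `a ↦ (1 + 4π²k²)^{-1/2} â(k)` of `H^{-1}(𝕋)` into `ℓ²(ℤ)`. -/
def toEll2 (a : HMinusOne) : lp (fun _ : ℤ => ℂ) 2 :=
  ⟨fun k => ((√(1 + (2 * Real.pi * (k : ℝ)) ^ 2))⁻¹ : ℝ) • a.hat k, by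
    refine memℓp_gen ?_
    refine a.summable.congr fun k => ?_
    have h := (weight_pos k).le
    simp only [ENNReal.toReal_ofNat, Real.rpow_two, norm_smul, norm_inv, Real.norm_eq_abs,
      abs_of_nonneg (Real.sqrt_nonneg _)]
    rw [div_eq_inv_mul, mul_pow _⁻¹, inv_pow, Real.sq_sqrt h]⟩

theorem toEll2_injective : Function.Injective toEll2 := by
  rintro ⟨a, ha, ha'⟩ ⟨b, hb, hb'⟩ h
  have : a = b := by
    funext k
    have hk := congrArg (fun z : lp (fun _ : ℤ => ℂ) 2 => z k) h
    have h0 : ((√(1 + (2 * Real.pi * (k : ℝ)) ^ 2))⁻¹ : ℝ) ≠ 0 :=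
      inv_ne_zero (Real.sqrt_pos.2 (weight_pos k)).ne'
    exact smul_right_injective ℂ h0 hk
  subst this
  rfl

/-- The distance is `(∑ₖ |â(k) - b̂(k)|² / (1 + 4π²k²))^{1/2}`, that is the supremum of
`⟨a - b, φ⟩` over `‖φ‖² + ‖∂ₓφ‖² ≤ 1` (norms in `L₂(𝕋)`). -/
instance : MetricSpace HMinusOne :=
  MetricSpace.induced toEll2 toEll2_injective inferInstance

/-- The distribution `a` is the integrable function `g`. -/
def IsFun (a : HMinusOne) (g : UnitAddCircle → ℝ) : Prop :=
  Integrable g ∧ ∀ k, a.hat k = coeff g k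

end HMinusOne

/-- Lebesgue measure on `[0,T] × 𝕋`. -/
def spaceTime (T : ℝ) : Measure (ℝ × UnitAddCircle) :=
  (volume.restrict (Icc 0 T)).prod volume

/-- An element of `C([0,T]; H^{-1}(𝕋)) ∩ L_p([0,T] × 𝕋)`: a continuous curve in `H^{-1}(𝕋)`
together with an `L_p` function of `(t,x)` that is the same distribution. -/
structure PathX (p : ℝ≥0∞) (T : ℝ) where
  curve : C(Icc (0 : ℝ) T, HMinusOne)
  density : Lp ℝ p (spaceTime T)
  compat : ∀ᵐ t : ℝ, ∀ ht : t ∈ Icc (0 : ℝ) T,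
    (curve ⟨t, ht⟩).IsFun fun x => density (t, x)

/-- The squared homogeneous Sobolev norm `∑ₖ (2π|k|)^{2s} |ĝ(k)|²` (`s > 0`) of exponent `s`,
with value `∞` outside of the space. It vanishes on constants. -/
def hDotSq (s : ℝ) (g : UnitAddCircle → ℝ) : ℝ≥0∞ :=
  ∑' k : ℤ, ENNReal.ofReal ((2 * Real.pi * |(k : ℝ)|) ^ (2 * s)) * ‖coeff g k‖ₑ ^ 2

/-- The squared norm of `L₂([0,T]; Ḣ_s(𝕋))`, with value `∞` outside of the space. -/
def spaceHSq (s T : ℝ) (g : ℝ × UnitAddCircle → ℝ) : ℝ≥0∞ :=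
  ∫⁻ t in Icc 0 T, hDotSq s fun x => g (t, x)

/-- The fractional Laplacian `(-∂ₓₓ)^s` (`s > 0`) of a smooth function on the torus. -/
def fracLap (s : ℝ) (g : UnitAddCircle → ℝ) (x : UnitAddCircle) : ℝ :=
  (∑' k : ℤ, (((2 * Real.pi * |(k : ℝ)|) ^ (2 * s) : ℝ) : ℂ) * coeff g k * fourier k x).re

/-- Derivative of a function on the torus. -/
def dX (g : UnitAddCircle → ℝ) (x : UnitAddCircle) : ℝ :=
  deriv (fun y : ℝ => g (x + (y : UnitAddCircle))) 0

/-- Test functions in `C_c^∞(]0,T[ × 𝕋)`. -/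
structure IsTest (T : ℝ) (φ : ℝ → UnitAddCircle → ℝ) : Prop where
  smooth : ContDiff ℝ ((⊤ : ℕ∞) : WithTop ℕ∞) fun q : ℝ × ℝ => φ q.1 (q.2 : UnitAddCircle)
  compact : ∃ a b : ℝ, 0 < a ∧ b < T ∧ ∀ t x, φ t x ≠ 0 → t ∈ Icc a b

/-- The distribution `∂_t u + ∂ₓ f(u) + (ε/2) (-∂ₓₓ)^s u` on `]0,T[ × 𝕋`, applied to the test
function `φ`. -/
def eqnDefect (ε s : ℝ) (f : ℝ → ℝ) (T : ℝ) (u : ℝ × UnitAddCircle → ℝ)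
    (φ : ℝ → UnitAddCircle → ℝ) : ℝ :=
  - (∫ q, u q * deriv (fun t => φ t q.2) q.1 ∂spaceTime T)
    - (∫ q, f (u q) * dX (φ q.1) q.2 ∂spaceTime T)
    + ε / 2 * ∫ q, u q * fracLap s (φ q.1) q.2 ∂spaceTime T

/-- The squared norm of the distribution `G` in `L₂([0,T]; Ḣ_{-s}(𝕋))`, the dual of
`L₂([0,T]; Ḣ_s(𝕋))`: it is the squared norm of `h` in the latter space if
`G = (-∂ₓₓ)^s h`, and `∞` if there is no such `h`. The infimum is over the representatives of
`h` modulo functions of `t`, which all have the same norm. -/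
def dualSq (s T : ℝ) (G : (ℝ → UnitAddCircle → ℝ) → ℝ) : ℝ≥0∞ :=
  ⨅ (h : Lp ℝ 2 (spaceTime T)) (_ : spaceHSq s T h < ⊤)
    (_ : ∀ φ, IsTest T φ → G φ = ∫ q, h q * fracLap s (φ q.1) q.2 ∂spaceTime T),
    spaceHSq s T h

namespace PathX

variable {p : ℝ≥0∞} {T : ℝ}

/-- The path belongs to `C([0,T]; L₂(𝕋))`. -/
def IsContL2 (u : PathX p T) : Prop :=
  ∃ v : C(Icc (0 : ℝ) T, L2T), ∀ t, (u.curve t).IsFun (v t)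

/-- `u(t) = g`, for a time `t ∈ [0,T]`. -/
def AtTime (u : PathX p T) (t : ℝ) (g : UnitAddCircle → ℝ) : Prop :=
  ∃ ht : t ∈ Icc (0 : ℝ) T, (u.curve ⟨t, ht⟩).IsFun g

end PathX

open Classical in
/-- The cost functional `I_{ε,T}` with initial datum `u₀`. -/
def cost (ε s : ℝ) (f : ℝ → ℝ) (u₀ : L2T) {p : ℝ≥0∞} {T : ℝ} (u : PathX p T) : ℝ≥0∞ :=
  if spaceHSq s T u.density < ⊤ ∧ u.IsContL2 ∧ u.AtTime 0 u₀ then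
    ENNReal.ofReal (ε⁻¹ / 2) * dualSq s T (eqnDefect ε s f T u.density)
  else ⊤

/-- The constant profile `m`. -/
def constProfile (m : ℝ) : L2T := Lp.const 2 volume m

/-- The quasipotential `V_ε(m; w)`. -/
def quasipotential (p : ℝ≥0∞) (ε s : ℝ) (f : ℝ → ℝ) (m : ℝ) (w : L2T) : ℝ≥0∞ :=
  ⨅ (T : ℝ) (_ : 0 < T) (u : PathX p T) (_ : u.AtTime 0 (constProfile m)) (_ : u.AtTime T w),
    cost ε s f (constProfile m) u

end FracCost

end

/-!
Put `λₖ = (2π|k|)^{2s}`. A path of finite cost solves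
`∂_t u + ∂ₓ f(u) + (ε/2)(-∂ₓₓ)^s u = (-∂ₓₓ)^s h`, that is
`û' + 2πik f(u)^ + (ε/2) λ û = λ ĥ` for every Fourier mode, and its cost is
`(2ε)⁻¹ ∫ ‖h‖²_{Ḣ_s}`. The nonlinearity does no work, `⟨u, ∂ₓ f(u)⟩ = 0`, because `f(u) ∂ₓu` is the
derivative of a primitive of `f` along `u`. Hence
`d/dt ‖u‖² = 2⟨u, h⟩_{Ḣ_s} - ε ‖u‖²_{Ḣ_s} ≤ ε⁻¹ ‖h‖²_{Ḣ_s}`, with equality for `h = ε u`. Integrating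
this inequality gives the lower bound; moreover the mode `k = 0` does not move, so that a path
of finite cost conserves the mean.

The path with `h = ε u` solves `∂_t u + ∂ₓ f(u) = (ε/2)(-∂ₓₓ)^s u`, which is well posed backwards
in time: with `r = T - t` it is a conservation law with fractional dissipation, started
from `w`, whose solution relaxes to its mean as `r → ∞`. The upper bound is the cost of an
approximation of this path.

* *Lower bound* (`le_of_path`). Fourier modes are continuous functions of time with integrable
  weak derivative (`weak_mode_equation`, `energy_of_weak_deriv`). The identity `⟨u, ∂ₓ f(u)⟩ = 0`
  is proved for `u(t)` and `f(u(t))` in `H_{1/2}`, with difference quotients in place of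
  derivatives (`hasSum_comp_mul_deriv_eq_zero`); it applies because `s > 1/2` and because
  composition with a Lipschitz function is bounded in `Ḣ_σ` for `0 < σ < 1`, as the Gagliardo
  form of the norm shows (`hDotSq_comp_le`).

* *Upper bound* (`quasipotential_le_half_sq`). No solution theory for the dissipative equation is
  needed: it is enough to solve the Galerkin system on the frequencies `|k| ≤ N`, while the
  higher frequencies follow the linear equation (`exists_isGalerkin`). These curves satisfy the
  energy estimate `∫ ‖c‖²_{Ḣ_s} ≤ ε⁻¹ ‖w - m‖²` on every interval, uniformly in `N`
  (`lintegral_sobolevSq_le`). The error in the equation has `Ḣ_{-s}` norm squared at most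
  `2 K² (2πN)^{2 - 4σ} ‖c‖²_{Ḣ_s}` with `σ = min s (3/4) > 1/2` (`controlSq_le`), which tends to `0`
  relative to the energy. To end exactly at the mean, the nonconstant part is multiplied by a
  cutoff `θ` that goes from `1` to `0` over a unit interval `[j, j + 1]`; this costs a constant times
  the energy spent there (`controlSq_le_of_abs_le`), and by the energy estimate some `j < n` has
  energy at most `ε⁻¹ ‖w - m‖² / n` (`exists_lintegral_Icc_le`). With `N = n → ∞` the cost tends to
  `½ ‖w - m‖²`.
-/

noncomputable section

namespace FracCost

open ComplexConjugate Filter Topology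

/-! ### Fourier coefficients of functions on the circle -/

theorem volume_circle : (volume : Measure UnitAddCircle) = AddCircle.haarAddCircle := by
  have := AddCircle.volume_eq_smul_haarAddCircle (T := (1 : ℝ))
  simpa using this

instance : IsProbabilityMeasure (volume : Measure UnitAddCircle) := by
  rw [volume_circle]; infer_instance

theorem norm_fourier_apply (k : ℤ) (x : UnitAddCircle) : ‖fourier k x‖ = 1 :=
  Circle.norm_coe _

theorem coeff_eq (g : UnitAddCircle → ℝ) (k : ℤ) :
    coeff g k = ∫ x, fourier (-k) x * (g x : ℂ) := by
  rw [coeff, fourierCoeff, volume_circle]; rfl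

theorem integrable_fourier_mul {α : Type*} [MeasurableSpace α] {μ : Measure α}
    {G : α → ℂ} (hG : Integrable G μ) {y : α → UnitAddCircle} (hy : Measurable y) (k : ℤ) :
    Integrable (fun x => fourier k (y x) * G x) μ := by
  refine hG.bdd_mul (c := 1) ?_ ?_
  · exact ((map_continuous (fourier k)).measurable.comp hy).aestronglyMeasurable
  · exact ae_of_all _ fun x => (norm_fourier_apply k _).le

theorem coeff_congr_ae {g h : UnitAddCircle → ℝ} (H : g =ᵐ[volume] h) : coeff g = coeff h := by
  funext k
  rw [coeff_eq, coeff_eq]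
  exact integral_congr_ae (by filter_upwards [H] with x hx; rw [hx])

theorem coeff_neg (g : UnitAddCircle → ℝ) (k : ℤ) : coeff g (-k) = conj (coeff g k) := by
  rw [coeff_eq, coeff_eq, ← integral_conj]
  refine integral_congr_ae (ae_of_all _ fun x => ?_)
  simp only [map_mul, Complex.conj_ofReal, fourier_neg, Complex.conj_conj]

theorem coeff_add {g h : UnitAddCircle → ℝ} (hg : Integrable g) (hh : Integrable h) (k : ℤ) :
    coeff (fun x => g x + h x) k = coeff g k + coeff h k := by
  rw [coeff_eq, coeff_eq, coeff_eq, ← integral_add]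
  · refine integral_congr_ae (ae_of_all _ fun x => ?_)
    simp only [Complex.ofReal_add]; ring
  · exact integrable_fourier_mul hg.ofReal measurable_id _
  · exact integrable_fourier_mul hh.ofReal measurable_id _

theorem coeff_const_mul (c : ℝ) (g : UnitAddCircle → ℝ) (k : ℤ) :
    coeff (fun x => c * g x) k = c * coeff g k := by
  rw [coeff_eq, coeff_eq, ← integral_const_mul]
  refine integral_congr_ae (ae_of_all _ fun x => ?_)
  simp only [Complex.ofReal_mul]; ring

theorem coeff_sub {g h : UnitAddCircle → ℝ} (hg : Integrable g) (hh : Integrable h) (k : ℤ) :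
    coeff (fun x => g x - h x) k = coeff g k - coeff h k := by
  have h1 := coeff_add hg (hh.const_mul (-1)) k
  rw [coeff_const_mul] at h1
  simpa [sub_eq_add_neg] using h1

theorem norm_coeff_le (g : UnitAddCircle → ℝ) (k : ℤ) : ‖coeff g k‖ ≤ ∫ x, ‖g x‖ := by
  rw [coeff_eq]
  refine (norm_integral_le_integral_norm _).trans_eq ?_
  refine integral_congr_ae (ae_of_all _ fun x => ?_)
  simp only [norm_mul, norm_fourier_apply, one_mul, Complex.norm_real]

theorem coeff_zero (g : UnitAddCircle → ℝ) : coeff g 0 = ((∫ x, g x : ℝ) : ℂ) := by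
  rw [coeff_eq, ← integral_complex_ofReal]
  refine integral_congr_ae (ae_of_all _ fun x => ?_)
  simp

theorem fourierCoeff_fourier_apply (j k : ℤ) :
    fourierCoeff (fun x : UnitAddCircle => fourier j x) k = if k = j then 1 else 0 := by
  have := fourierCoeff_fourier (T := (1 : ℝ)) j
  have h2 := congrFun this k
  rw [Pi.single_apply] at h2
  exact h2

/-- Fourier coefficients of the real part of a complex function. -/
theorem coeff_re {G : UnitAddCircle → ℂ} (hG : Integrable G) (k : ℤ) :
    coeff (fun x => (G x).re) k = (fourierCoeff G k + conj (fourierCoeff G (-k))) / 2 := by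
  rw [coeff_eq, fourierCoeff, fourierCoeff, ← integral_conj, ← volume_circle, ← integral_add,
    ← integral_div]
  · refine integral_congr_ae (ae_of_all _ fun x => ?_)
    simp only [smul_eq_mul, map_mul, neg_neg, fourier_neg]
    rw [Complex.re_eq_add_conj]
    ring
  · exact integrable_fourier_mul hG measurable_id _
  · have := (integrable_fourier_mul hG measurable_id (- -k))
    exact Complex.conjCLE.toContinuousLinearMap.integrable_comp this

theorem coeff_translate (g : UnitAddCircle → ℝ) (y : UnitAddCircle) (k : ℤ) :
    coeff (fun x => g (x + y)) k = fourier k y * coeff g k := by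
  rw [coeff_eq, coeff_eq, ← integral_const_mul,
    ← integral_add_right_eq_self (fun x => fourier k y * (fourier (-k) x * (g x : ℂ))) y]
  refine integral_congr_ae (ae_of_all _ fun x => ?_)
  have h1 : fourier (-k) (x + y) = fourier (-k) x * fourier (-k) y := by
    simp [AddCircle.toCircle_add]
  have h2 : fourier k y * fourier (-k) y = 1 := by
    rw [← fourier_add, add_neg_cancel, fourier_zero]
  simp only [h1]
  linear_combination (-(fourier (-k) x * (g (x + y) : ℂ))) * h2

theorem coeff_const_ne {c : ℝ} {k : ℤ} (hk : k ≠ 0) : coeff (fun _ => c) k = 0 := by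
  have h := coeff_const_mul c (fun _ => 1) k
  simp only [mul_one] at h
  rw [h]
  have h2 := fourierCoeff_fourier_apply 0 k
  rw [if_neg hk] at h2
  simp only [fourier_zero] at h2
  rw [coeff]
  simp only [Complex.ofReal_one, h2, mul_zero]

/-- Parseval's identity. -/
theorem parseval {g : UnitAddCircle → ℝ} (hg : MemLp g 2) :
    HasSum (fun k : ℤ => ‖coeff g k‖ ^ 2) (∫ x, g x ^ 2) := by
  have hG : MemLp (fun x => (g x : ℂ)) 2 (AddCircle.haarAddCircle (T := 1)) := by
    rw [← volume_circle]; exact hg.ofReal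
  have := hasSum_sq_fourierCoeff hG.toLp
  have h2 : ∫ x, ‖(hG.toLp : UnitAddCircle → ℂ) x‖ ^ 2 ∂AddCircle.haarAddCircle
      = ∫ x, g x ^ 2 := by
    rw [volume_circle]
    refine integral_congr_ae ?_
    filter_upwards [hG.coeFn_toLp] with x hx
    rw [hx]; simp
  have h3 : fourierCoeff (hG.toLp : UnitAddCircle → ℂ) = coeff g := by
    rw [fourierCoeff_congr_ae hG.coeFn_toLp]; rfl
  rw [h2, h3] at this
  exact this

theorem tsum_enorm_coeff {g : UnitAddCircle → ℝ} (hg : MemLp g 2) :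
    ∑' k : ℤ, ‖coeff g k‖ₑ ^ 2 = ∫⁻ x, ‖g x‖ₑ ^ 2 := by
  have h := parseval hg
  have h1 : ∀ k, ‖coeff g k‖ₑ ^ 2 = ENNReal.ofReal (‖coeff g k‖ ^ 2) := fun k => by
    rw [ENNReal.ofReal_pow (norm_nonneg _), ofReal_norm]
  simp_rw [h1]
  rw [← ENNReal.ofReal_tsum_of_nonneg (fun k => by positivity) h.summable, h.tsum_eq,
    ofReal_integral_eq_lintegral_ofReal hg.integrable_sq (ae_of_all _ fun x => by positivity)]
  refine lintegral_congr fun x => ?_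
  rw [← sq_abs, ENNReal.ofReal_pow (abs_nonneg _), Real.enorm_eq_ofReal_abs]

theorem L2T_memLp (g : L2T) : MemLp g 2 := Lp.memLp g

theorem L2T_integrable (g : L2T) : Integrable g :=
  (Lp.memLp g).integrable (by norm_num)

theorem L2T_norm_sq (g : L2T) : ‖g‖ ^ 2 = ∫ x, g x ^ 2 := by
  have := real_inner_self_eq_norm_sq g
  rw [← this, L2.inner_def]
  refine integral_congr_ae (ae_of_all _ fun x => ?_)
  simp [sq]

theorem L2T_parseval (g : L2T) : HasSum (fun k : ℤ => ‖coeff g k‖ ^ 2) (‖g‖ ^ 2) := by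
  rw [L2T_norm_sq]; exact parseval (L2T_memLp g)

theorem L2T_coeff_sub (g h : L2T) (k : ℤ) : coeff (g - h : L2T) k = coeff g k - coeff h k := by
  rw [coeff_congr_ae (Lp.coeFn_sub g h)]
  exact coeff_sub (L2T_integrable g) (L2T_integrable h) k

/-- The Riesz–Fischer theorem for real functions on the circle. -/
theorem exists_L2T_coeff {a : ℤ → ℂ} (ha : ∀ k, a (-k) = conj (a k))
    (hs : Summable fun k => ‖a k‖ ^ 2) : ∃ g : L2T, ∀ k, coeff g k = a k := by
  have hmem : Memℓp a 2 := by
    refine memℓp_gen ?_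
    simpa using hs
  let G := (fourierBasis (T := (1 : ℝ))).repr.symm ⟨a, hmem⟩
  have hGk : ∀ k, fourierCoeff (G : UnitAddCircle → ℂ) k = a k := fun k => by
    rw [← fourierBasis_repr]
    simp [G]
  have hG : MemLp (G : UnitAddCircle → ℂ) 2 := by
    rw [volume_circle]; exact Lp.memLp G
  have hre : MemLp (fun x => ((G : UnitAddCircle → ℂ) x).re) 2 := hG.re
  refine ⟨hre.toLp, fun k => ?_⟩
  rw [coeff_congr_ae hre.coeFn_toLp, coeff_re (hG.integrable (by norm_num)), hGk, hGk, ha]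
  simp

/-- The polarised form of Parseval's identity. -/
theorem parseval_mul {g h : UnitAddCircle → ℝ} (hg : MemLp g 2) (hh : MemLp h 2) :
    HasSum (fun k : ℤ => (conj (coeff g k) * coeff h k).re) (∫ x, g x * h x) := by
  have h1 := parseval (hg.add hh)
  have h2 := parseval (hg.sub hh)
  have h3 := (h1.sub h2).mul_left (1 / 4)
  have hgi := hg.integrable (by norm_num)
  have hhi := hh.integrable (by norm_num)
  convert! h3 using 1
  · funext k
    have e1 : coeff (g + h) k = coeff g k + coeff h k := coeff_add hgi hhi k
    have e2 : coeff (g - h) k = coeff g k - coeff h k := coeff_sub hgi hhi k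
    rw [e1, e2, ← Complex.normSq_eq_norm_sq, ← Complex.normSq_eq_norm_sq, Complex.normSq_apply,
      Complex.normSq_apply]
    simp
    ring
  · rw [← integral_sub (hg.add hh).integrable_sq (hg.sub hh).integrable_sq, ← integral_const_mul]
    refine integral_congr_ae (ae_of_all _ fun x => ?_)
    simp
    ring

/-- By hypothesis this holds for the trigonometric polynomials `φ`, which are dense. -/
theorem integral_continuous_mul_eq_zero {g : UnitAddCircle → ℝ} (hg : Integrable g)
    (H : ∀ k, coeff g k = 0) (φ : C(UnitAddCircle, ℂ)) : ∫ x, φ x * (g x : ℂ) = 0 := by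
  have hint : ∀ φ : C(UnitAddCircle, ℂ), Integrable fun x => φ x * (g x : ℂ) := fun φ =>
    hg.ofReal.bdd_mul (c := ‖φ‖) φ.continuous.aestronglyMeasurable
      (ae_of_all _ fun x => φ.norm_coe_le_norm x)
  let Λ : C(UnitAddCircle, ℂ) →L[ℂ] ℂ := LinearMap.mkContinuous
    { toFun := fun φ => ∫ x, φ x * (g x : ℂ)
      map_add' := fun φ ψ => by
        rw [← integral_add (hint φ) (hint ψ)]
        refine integral_congr_ae (ae_of_all _ fun x => ?_)
        simp [add_mul]
      map_smul' := fun c φ => by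
        rw [RingHom.id_apply, smul_eq_mul, ← integral_const_mul]
        refine integral_congr_ae (ae_of_all _ fun x => ?_)
        simp [mul_assoc] } (∫ x, ‖g x‖) (fun φ => by
      rw [← integral_mul_const]
      refine (norm_integral_le_integral_norm _).trans
        (integral_mono (hint φ).norm (hg.norm.mul_const _) fun x => ?_)
      simp only [norm_mul, Complex.norm_real]
      rw [mul_comm]
      gcongr
      exact φ.norm_coe_le_norm x)
  have h1 : Submodule.span ℂ (range <| fourier (T := (1 : ℝ))) ≤ Λ.ker := by
    rw [Submodule.span_le]
    rintro _ ⟨k, rfl⟩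
    have := H (-k)
    rw [coeff_eq, neg_neg] at this
    exact this
  have h2 := Submodule.topologicalClosure_minimal _ h1 Λ.isClosed_ker
  rw [span_fourier_closure_eq_top] at h2
  exact h2 (Submodule.mem_top (x := φ))

/-- An integrable function on the circle is determined by its Fourier coefficients. -/
theorem ae_eq_zero_of_coeff_eq_zero {g : UnitAddCircle → ℝ} (hg : Integrable g)
    (H : ∀ k, coeff g k = 0) : g =ᵐ[volume] 0 := by
  refine ae_eq_zero_of_forall_setIntegral_isClosed_eq_zero hg fun F hF => ?_
  have h1 : ∀ n, ∫ x, ((hF.apprSeq n x : NNReal) : ℝ) * g x = 0 := fun n => by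
    let φ : C(UnitAddCircle, ℂ) := ⟨fun x => (((hF.apprSeq n x : NNReal) : ℝ) : ℂ), by
      exact Complex.continuous_ofReal.comp (NNReal.continuous_coe.comp
        (hF.apprSeq n).continuous)⟩
    have := integral_continuous_mul_eq_zero hg H φ
    simp only [φ, ContinuousMap.coe_mk, ← Complex.ofReal_mul] at this
    rw [integral_complex_ofReal] at this
    exact_mod_cast this
  have h2 : Tendsto (fun n => ∫ x, ((hF.apprSeq n x : NNReal) : ℝ) * g x) atTop
      (𝓝 (∫ x, F.indicator g x)) := by
    refine tendsto_integral_of_dominated_convergence (fun x => ‖g x‖) (fun n => ?_) hg.norm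
      (fun n => ae_of_all _ fun x => ?_) (ae_of_all _ fun x => ?_)
    · exact (NNReal.continuous_coe.comp (hF.apprSeq n).continuous).aestronglyMeasurable.mul
        hg.aestronglyMeasurable
    · rw [norm_mul]
      have : ‖((hF.apprSeq n x : NNReal) : ℝ)‖ ≤ 1 := by
        rw [Real.norm_of_nonneg NNReal.zero_le_coe]
        exact_mod_cast HasOuterApproxClosed.apprSeq_apply_le_one hF n x
      nlinarith [norm_nonneg (g x)]
    · have h3 := tendsto_pi_nhds.1 (HasOuterApproxClosed.tendsto_apprSeq hF) x
      have h4 := ((NNReal.continuous_coe.tendsto _).comp h3).mul_const (g x)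
      convert! h4 using 2
      by_cases hx : x ∈ F <;> simp [hx]
  simp_rw [h1] at h2
  rw [← integral_indicator hF.measurableSet]
  exact (tendsto_nhds_unique h2 tendsto_const_nhds)

theorem memLp_comp {f : ℝ → ℝ} {K : NNReal} (hf : LipschitzWith K f) {α : Type*}
    [MeasurableSpace α] {μ : Measure α} [IsFiniteMeasure μ] {g : α → ℝ} {p : ℝ≥0∞}
    (hg : MemLp g p μ) : MemLp (fun x => f (g x)) p μ := by
  have h1 : LipschitzWith K fun v => f v - f 0 := LipschitzWith.of_dist_le_mul fun a b => by
    have := hf.dist_le_mul a b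
    simpa [Real.dist_eq] using this
  have h2 : MemLp ((fun v => f v - f 0) ∘ g) p μ := h1.comp_memLp (by simp) hg
  have h3 := h2.add (memLp_const (f 0))
  convert! h3 using 1
  funext x; simp

theorem memLp_translate {g : UnitAddCircle → ℝ} (hg : MemLp g 2) (y : UnitAddCircle) :
    MemLp (fun x => g (x + y)) 2 :=
  hg.comp_measurePreserving (measurePreserving_add_right volume y)

theorem coeff_translate_sub {g : UnitAddCircle → ℝ} (hg : MemLp g 2) (y : UnitAddCircle)
    (k : ℤ) : coeff (fun x => g (x + y) - g x) k = (fourier k y - 1) * coeff g k := by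
  rw [coeff_sub ((memLp_translate hg y).integrable (by norm_num)) (hg.integrable (by norm_num)),
    coeff_translate, sub_mul, one_mul]

theorem lintegral_translate_sub {g : UnitAddCircle → ℝ} (hg : MemLp g 2) (y : UnitAddCircle) :
    ∫⁻ x, ‖g (x + y) - g x‖ₑ ^ 2 = ∑' k : ℤ, ‖fourier k y - 1‖ₑ ^ 2 * ‖coeff g k‖ₑ ^ 2 := by
  refine (tsum_enorm_coeff ((memLp_translate hg y).sub hg)).symm.trans ?_
  refine tsum_congr fun k => ?_
  rw [← mul_pow, ← enorm_mul, ← coeff_translate_sub hg]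
  rfl

/-! ### The Gagliardo form of the fractional Sobolev norm -/

/-- The kernel `y ↦ y^{-1-2σ}` on the half line. -/
def gagKernel (σ : ℝ) (y : ℝ) : ℝ≥0∞ :=
  (Ioi (0 : ℝ)).indicator (fun y => ENNReal.ofReal (y ^ (-1 - 2 * σ))) y

/-- The Gagliardo constant `∫ |e^{iy} - 1|² y^{-1-2σ} dy` over the half line. -/
def gagConst (σ : ℝ) : ℝ≥0∞ :=
  ∫⁻ y : ℝ, gagKernel σ y * ‖Complex.exp (y * Complex.I) - 1‖ₑ ^ 2

theorem measurable_gagKernel (σ : ℝ) : Measurable (gagKernel σ) :=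
  Measurable.indicator (by fun_prop) measurableSet_Ioi

/-- Homogeneity, from which the power of `k` in `lintegral_gagKernel` comes. -/
theorem gagKernel_scale (σ : ℝ) {a : ℝ} (ha : 0 < a) (y : ℝ) :
    gagKernel σ y = ENNReal.ofReal (a ^ (1 + 2 * σ)) * gagKernel σ (a * y) := by
  unfold gagKernel
  by_cases hy : 0 < y
  · have hay : 0 < a * y := mul_pos ha hy
    rw [indicator_of_mem (show y ∈ Ioi (0 : ℝ) from hy),
      indicator_of_mem (show a * y ∈ Ioi (0 : ℝ) from hay), ← ENNReal.ofReal_mul (by positivity),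
      Real.mul_rpow ha.le hy.le, ← mul_assoc, ← Real.rpow_add ha]
    simp
  · have hay : ¬ 0 < a * y := fun h => hy (pos_of_mul_pos_right h ha.le)
    rw [indicator_of_notMem (by simpa using hy), indicator_of_notMem (by simpa using hay), mul_zero]

theorem enorm_exp_neg_sub_one (θ : ℝ) :
    ‖Complex.exp (((-θ : ℝ) : ℂ) * Complex.I) - 1‖ₑ
      = ‖Complex.exp ((θ : ℂ) * Complex.I) - 1‖ₑ := by
  rw [← RCLike.enorm_conj (Complex.exp ((θ : ℂ) * Complex.I) - 1), map_sub, ← Complex.exp_conj,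
    map_mul, Complex.conj_ofReal, Complex.conj_I, map_one]
  congr 3; push_cast; ring

theorem lintegral_gagKernel (σ : ℝ) (hσ : 0 < σ) (k : ℤ) :
    ∫⁻ y : ℝ, gagKernel σ y * ‖fourier k (y : UnitAddCircle) - 1‖ₑ ^ 2
      = gagConst σ * ENNReal.ofReal ((2 * Real.pi * |(k : ℝ)|) ^ (2 * σ)) := by
  rcases eq_or_ne k 0 with rfl | hk
  · have : (2 * σ) ≠ 0 := by positivity
    simp [Real.zero_rpow this]
  have hk' : 0 < |(k : ℝ)| := abs_pos.2 (by exact_mod_cast hk)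
  set a := 2 * Real.pi * |(k : ℝ)| with ha
  have hapos : 0 < a := by positivity
  have h1 : ∀ y : ℝ, ‖fourier k (y : UnitAddCircle) - 1‖ₑ
      = ‖Complex.exp (((a * y : ℝ) : ℂ) * Complex.I) - 1‖ₑ := fun y => by
    rw [fourier_coe_apply]
    rcases abs_cases (k : ℝ) with ⟨h, _⟩ | ⟨h, _⟩
    · rw [ha, h]; congr 3; push_cast; ring
    · rw [ha, h, ← enorm_exp_neg_sub_one]; congr 3; push_cast; ring
  have h3 : ∀ y : ℝ, gagKernel σ y * ‖fourier k (y : UnitAddCircle) - 1‖ₑ ^ 2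
      = ENNReal.ofReal (a ^ (1 + 2 * σ)) * (gagKernel σ (a * y) *
        ‖Complex.exp (((a * y : ℝ) : ℂ) * Complex.I) - 1‖ₑ ^ 2) := fun y => by
    rw [h1, gagKernel_scale σ hapos y, mul_assoc]
  rw [lintegral_congr h3, lintegral_const_mul' _ _ ENNReal.ofReal_ne_top]
  have h2 : ∫⁻ y : ℝ, gagKernel σ (a * y) * ‖Complex.exp (((a * y : ℝ) : ℂ) * Complex.I) - 1‖ₑ ^ 2
      = ENNReal.ofReal a⁻¹ * gagConst σ := by
    rw [gagConst, ← smul_eq_mul, ← lintegral_smul_measure, ← abs_of_pos (inv_pos.2 hapos),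
      ← Real.map_volume_mul_left hapos.ne', lintegral_map]
    · exact (measurable_gagKernel σ).mul
        ((Continuous.measurable (by fun_prop)).enorm.pow_const 2)
    · fun_prop
  rw [h2, ← mul_assoc, ← ENNReal.ofReal_mul (by positivity), mul_comm]
  congr 2
  rw [Real.rpow_add hapos, Real.rpow_one]
  field_simp

theorem gagConst_ne_zero (σ : ℝ) : gagConst σ ≠ 0 := by
  unfold gagConst
  intro h
  replace h := (lintegral_eq_zero_iff ((measurable_gagKernel σ).mul
    ((Continuous.measurable (by fun_prop)).enorm.pow_const 2))).1 h
  have h1 : ∀ᵐ y : ℝ, y ∉ Ioo (0 : ℝ) 1 := by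
    filter_upwards [h] with y hy hy'
    simp only [Pi.zero_apply, Pi.mul_apply, mul_eq_zero, gagKernel] at hy
    rcases hy with hy | hy
    · rw [indicator_of_mem (show y ∈ Ioi (0 : ℝ) from hy'.1), ENNReal.ofReal_eq_zero] at hy
      exact absurd (Real.rpow_pos_of_pos hy'.1 _) (not_lt.2 hy)
    · have h2 : Complex.exp (y * Complex.I) = 1 := by
        simpa [sub_eq_zero] using hy
      have h3 := congrArg Complex.im h2
      rw [Complex.exp_ofReal_mul_I_im, Complex.one_im] at h3
      have := Real.sin_pos_of_pos_of_lt_pi hy'.1 (by linarith [hy'.2, Real.pi_gt_three])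
      linarith
  have h2 : volume (Ioo (0 : ℝ) 1) = 0 := by
    have := ae_iff.1 h1
    simp only [not_not] at this
    exact this
  simp at h2

theorem norm_exp_sub_one_le (θ : ℝ) : ‖Complex.exp (θ * Complex.I) - 1‖ ≤ |θ| := by
  have := Real.norm_exp_I_mul_ofReal_sub_one_le (x := θ)
  rwa [mul_comm, Real.norm_eq_abs] at this

theorem norm_exp_sub_one_le_two (θ : ℝ) : ‖Complex.exp (θ * Complex.I) - 1‖ ≤ 2 := by
  refine (norm_sub_le _ _).trans ?_
  rw [Complex.norm_exp_ofReal_mul_I, norm_one]; norm_num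

theorem gagConst_ne_top {σ : ℝ} (h0 : 0 < σ) (h1 : σ < 1) : gagConst σ ≠ ⊤ := by
  have hint : IntegrableOn (fun y : ℝ => y ^ (1 - 2 * σ)) (Ioc 0 1) := by
    have := intervalIntegral.intervalIntegrable_rpow' (a := 0) (b := 1) (r := 1 - 2 * σ)
      (by linarith)
    rwa [intervalIntegrable_iff_integrableOn_Ioc_of_le zero_le_one] at this
  have hint2 : IntegrableOn (fun y : ℝ => 4 * y ^ (-1 - 2 * σ)) (Ioi 1) :=
    (integrableOn_Ioi_rpow_of_lt (by linarith) one_pos).const_mul 4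
  have hA := hint.integrable_indicator measurableSet_Ioc
  have hB := hint2.integrable_indicator measurableSet_Ioi
  refine ne_top_of_le_ne_top (hA.add hB).2.ne (lintegral_mono fun y => ?_)
  unfold gagKernel
  rcases le_or_gt y 0 with hy | hy
  · rw [indicator_of_notMem (by simpa using hy)]; simp
  rw [indicator_of_mem (show y ∈ Ioi (0 : ℝ) from hy), ← ofReal_norm, ← ofReal_norm,
    ← ENNReal.ofReal_pow (norm_nonneg _), ← ENNReal.ofReal_mul (by positivity)]
  refine ENNReal.ofReal_le_ofReal ?_
  rw [Pi.add_apply]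
  rcases le_or_gt y 1 with hy1 | hy1
  · rw [indicator_of_mem (show y ∈ Ioc (0 : ℝ) 1 from ⟨hy, hy1⟩),
      indicator_of_notMem (by simpa using hy1), add_zero, Real.norm_of_nonneg (by positivity)]
    have e : y ^ (1 - 2 * σ) = y ^ (-1 - 2 * σ) * y ^ 2 := by
      rw [← Real.rpow_natCast y 2, ← Real.rpow_add hy]; congr 1; push_cast; ring
    rw [e]
    have := norm_exp_sub_one_le y
    rw [abs_of_pos hy] at this
    gcongr
  · rw [indicator_of_notMem (by simp [hy1]), zero_add,
      indicator_of_mem (show y ∈ Ioi (1 : ℝ) from hy1), Real.norm_of_nonneg (by positivity),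
      mul_comm]
    have := norm_exp_sub_one_le_two y
    gcongr
    nlinarith [norm_nonneg (Complex.exp (y * Complex.I) - 1)]

/-- The fractional Sobolev norm is, up to a constant, an integral over translations. -/
theorem gagConst_mul_hDotSq {σ : ℝ} (hσ : 0 < σ) {g : UnitAddCircle → ℝ} (hg : MemLp g 2) :
    gagConst σ * hDotSq σ g
      = ∫⁻ y : ℝ, gagKernel σ y * ∫⁻ x, ‖g (x + (y : UnitAddCircle)) - g x‖ₑ ^ 2 := by
  have h1 : ∀ y : ℝ, gagKernel σ y * ∫⁻ x, ‖g (x + (y : UnitAddCircle)) - g x‖ₑ ^ 2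
      = ∑' k : ℤ, gagKernel σ y * ‖fourier k (y : UnitAddCircle) - 1‖ₑ ^ 2 * ‖coeff g k‖ₑ ^ 2 :=
    fun y => by
      rw [lintegral_translate_sub hg, ← ENNReal.tsum_mul_left]
      simp_rw [mul_assoc]
  have hm : ∀ k : ℤ, Measurable fun y : ℝ =>
      gagKernel σ y * ‖fourier k (y : UnitAddCircle) - 1‖ₑ ^ 2 := fun k =>
    (measurable_gagKernel σ).mul ((((map_continuous (fourier k)).comp
      (AddCircle.continuous_mk' 1)).sub continuous_const).measurable.enorm.pow_const 2)
  rw [lintegral_congr h1, lintegral_tsum fun k => ((hm k).mul_const _).aemeasurable, hDotSq,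
    ← ENNReal.tsum_mul_left]
  refine tsum_congr fun k => ?_
  rw [lintegral_mul_const _ (hm k), lintegral_gagKernel σ hσ, mul_assoc (gagConst σ)]

/-- Composition with a Lipschitz function is bounded in `Ḣ_σ`, for `0 < σ < 1`. -/
theorem hDotSq_comp_le {σ : ℝ} (h0 : 0 < σ) (h1 : σ < 1) {f : ℝ → ℝ} {K : NNReal}
    (hf : LipschitzWith K f) {g : UnitAddCircle → ℝ} (hg : MemLp g 2) :
    hDotSq σ (fun x => f (g x)) ≤ (K : ℝ≥0∞) ^ 2 * hDotSq σ g := by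
  have key : gagConst σ * hDotSq σ (fun x => f (g x))
      ≤ gagConst σ * ((K : ℝ≥0∞) ^ 2 * hDotSq σ g) := by
    rw [mul_left_comm, gagConst_mul_hDotSq h0 hg, gagConst_mul_hDotSq h0 (memLp_comp hf hg),
      ← lintegral_const_mul' _ _ (by simp)]
    refine lintegral_mono fun y => ?_
    dsimp only
    rw [mul_left_comm]
    gcongr
    rw [← lintegral_const_mul' _ _ (by simp)]
    refine lintegral_mono fun x => ?_
    dsimp only
    rw [← mul_pow]
    gcongr
    have := hf.edist_le_mul (g (x + (y : UnitAddCircle))) (g x)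
    rwa [edist_eq_enorm_sub, edist_eq_enorm_sub] at this
  exact (ENNReal.mul_le_mul_iff_right (gagConst_ne_zero σ) (gagConst_ne_top h0 h1)).1 key

/-! ### The nonlinearity does no work -/

theorem norm_fourier_sub_one_le (k : ℤ) (y : ℝ) :
    ‖fourier k (y : UnitAddCircle) - 1‖ ≤ 2 * Real.pi * |(k : ℝ)| * |y| := by
  have h := norm_exp_sub_one_le (2 * Real.pi * k * y)
  rw [abs_mul, abs_mul, abs_of_pos (show 0 < 2 * Real.pi by positivity)] at h
  rw [fourier_coe_apply]
  convert! h using 4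
  push_cast; ring

theorem norm_fourier_sub_one_le_two (k : ℤ) (y : UnitAddCircle) : ‖fourier k y - 1‖ ≤ 2 := by
  refine (norm_sub_le _ _).trans ?_
  rw [norm_fourier_apply, norm_one]; norm_num

theorem abs_primitive_sub_le {f : ℝ → ℝ} {K : NNReal} (hf : LipschitzWith K f) (a b : ℝ) :
    |(∫ z in a..b, f z) - f a * (b - a)| ≤ K * (b - a) ^ 2 := by
  have h1 : (∫ z in a..b, f z) - f a * (b - a) = ∫ z in a..b, (f z - f a) := by
    rw [intervalIntegral.integral_sub (hf.continuous.intervalIntegrable _ _)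
      (by simp), intervalIntegral.integral_const, smul_eq_mul, mul_comm]
  rw [h1, ← Real.norm_eq_abs]
  refine (intervalIntegral.norm_integral_le_of_norm_le_const (C := K * |b - a|)
    fun z hz => ?_).trans_eq ?_
  · have h2 := hf.dist_le_mul z a
    rw [Real.dist_eq, Real.dist_eq] at h2
    refine h2.trans ?_
    refine mul_le_mul_of_nonneg_left ?_ K.2
    have h3 := abs_sub_left_of_mem_uIcc (uIoc_subset_uIcc hz)
    rwa [abs_sub_comm b a] at h3 ⊢
  · rw [mul_assoc, ← sq, sq_abs]

/-- For bounded Lipschitz `f` and `g` in `L₂`, the pairing of `f(g)` with an increment of `g` is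
quadratic in the increment: the primitive of `f` makes the linear term a total difference. -/
theorem abs_integral_comp_mul_translate_sub_le {f : ℝ → ℝ} {K : NNReal} (hf : LipschitzWith K f)
    {B : ℝ} (hB : ∀ v, |f v| ≤ B) {g : UnitAddCircle → ℝ} (hg : MemLp g 2) (y : UnitAddCircle) :
    |∫ x, f (g x) * (g (x + y) - g x)| ≤ K * ∫ x, (g (x + y) - g x) ^ 2 := by
  -- the increments of `F(g)` integrate to zero by translation invariance; `F` is Lipschitz as `f`
  -- is bounded, so that `F(g)` is integrable
  set F : ℝ → ℝ := fun v => ∫ z in (0 : ℝ)..v, f z with hF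
  have hFsub : ∀ a b, F b - F a = ∫ z in a..b, f z := fun a b =>
    intervalIntegral.integral_interval_sub_left (hf.continuous.intervalIntegrable _ _)
      (hf.continuous.intervalIntegrable _ _)
  have hB0 : 0 ≤ B := (abs_nonneg _).trans (hB 0)
  have hFL : LipschitzWith B.toNNReal F := LipschitzWith.of_dist_le_mul fun a b => by
    have h := intervalIntegral.norm_integral_le_of_norm_le_const (a := b) (b := a) (f := f) (C := B)
      fun z _ => hB z
    rw [Real.dist_eq, Real.dist_eq, hFsub, Real.coe_toNNReal _ hB0]
    exact h
  have hFg : Integrable fun x => F (g x) := (memLp_comp hFL hg).integrable (by norm_num)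
  have hd : MemLp (fun x => g (x + y) - g x) 2 := (memLp_translate hg y).sub hg
  have h0 : ∫ x, (F (g (x + y)) - F (g x)) = 0 := by
    rw [integral_sub (hFg.comp_add_right y) hFg,
      integral_add_right_eq_self (fun x => F (g x)) y, sub_self]
  have hint : Integrable fun x => f (g x) * (g (x + y) - g x) :=
    (memLp_comp hf hg).integrable_mul hd
  have h1 : ∫ x, f (g x) * (g (x + y) - g x)
      = - ∫ x, ((F (g (x + y)) - F (g x)) - f (g x) * (g (x + y) - g x)) := by
    have hs : Integrable fun x => F (g (x + y)) - F (g x) := (hFg.comp_add_right y).sub hFg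
    rw [integral_sub hs hint, h0]; ring
  rw [h1, abs_neg, ← Real.norm_eq_abs, ← integral_const_mul]
  refine (norm_integral_le_integral_norm _).trans (integral_mono ?_ ?_ fun x => ?_)
  · exact (((hFg.comp_add_right y).sub hFg).sub hint).norm
  · exact hd.integrable_sq.const_mul _
  · dsimp only
    rw [hFsub]
    exact abs_primitive_sub_le hf _ _

theorem tendsto_div_norm_fourier_sub_one_sq (k : ℤ) :
    Tendsto (fun n : ℕ => ((n : ℝ) + 1) * ‖fourier k ((1 / ((n : ℝ) + 1) : ℝ) : UnitAddCircle) - 1‖ ^ 2)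
      atTop (𝓝 0) := by
  have h1 := (tendsto_one_div_add_atTop_nhds_zero_nat (𝕜 := ℝ)).const_mul
    ((2 * Real.pi * |(k : ℝ)|) ^ 2)
  rw [mul_zero] at h1
  refine squeeze_zero (fun n => by positivity) (fun n => ?_) h1
  have h2 := norm_fourier_sub_one_le k (1 / ((n : ℝ) + 1))
  have hn : 0 < (n : ℝ) + 1 := by positivity
  rw [abs_of_pos (show 0 < 1 / ((n : ℝ) + 1) by positivity)] at h2
  calc ((n : ℝ) + 1) * ‖fourier k ((1 / ((n : ℝ) + 1) : ℝ) : UnitAddCircle) - 1‖ ^ 2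
      ≤ ((n : ℝ) + 1) * (2 * Real.pi * |(k : ℝ)| * (1 / ((n : ℝ) + 1))) ^ 2 := by gcongr
    _ = _ := by field_simp

theorem tendsto_mul_fourier_sub_one (k : ℤ) :
    Tendsto (fun n : ℕ => (((n : ℝ) + 1 : ℝ) : ℂ) *
      (fourier k ((1 / ((n : ℝ) + 1) : ℝ) : UnitAddCircle) - 1))
      atTop (𝓝 (2 * Real.pi * Complex.I * k)) := by
  have h1 : HasDerivAt (fun y : ℝ => fourier k (y : UnitAddCircle))
      (2 * Real.pi * Complex.I * k / (1 : ℝ) * fourier k ((0 : ℝ) : UnitAddCircle)) 0 :=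
    hasDerivAt_fourier 1 k 0
  have h2 := h1.tendsto_slope_zero
  have h3 : Tendsto (fun n : ℕ => (1 / ((n : ℝ) + 1) : ℝ)) atTop (𝓝[≠] 0) :=
    tendsto_nhdsWithin_iff.2 ⟨tendsto_one_div_add_atTop_nhds_zero_nat,
      Eventually.of_forall fun n => by
        have : (0 : ℝ) < 1 / ((n : ℝ) + 1) := by positivity
        exact this.ne'⟩
  have h4 := h2.comp h3
  convert! h4 using 2
  · simp
  · simp

/-- The pairing `⟨∂ₓ f(g), g⟩` vanishes, in terms of Fourier coefficients, as soon as it converges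
absolutely and `g` is in `H_{1/2}`. -/
theorem hasSum_comp_mul_deriv_eq_zero {f : ℝ → ℝ} {K : NNReal} (hf : LipschitzWith K f)
    {B : ℝ} (hB : ∀ v, |f v| ≤ B) {g : UnitAddCircle → ℝ} (hg : MemLp g 2)
    (hhalf : Summable fun k : ℤ => (2 * Real.pi * |(k : ℝ)|) * ‖coeff g k‖ ^ 2)
    (hsum : Summable fun k : ℤ =>
      (2 * Real.pi * |(k : ℝ)|) * (‖coeff (fun x => f (g x)) k‖ * ‖coeff g k‖)) :
    HasSum (fun k : ℤ => (conj (coeff (fun x => f (g x)) k) *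
      (2 * Real.pi * Complex.I * k * coeff g k)).re) 0 := by
  set q := coeff fun x => f (g x) with hq
  -- the derivative of `g` is replaced by the difference quotient with step `1 / (n + 1)`
  set yy : ℕ → UnitAddCircle := fun n => ((1 / ((n : ℝ) + 1) : ℝ) : UnitAddCircle) with hyy
  have hn : ∀ n : ℕ, 0 < (n : ℝ) + 1 := fun n => by positivity
  have hdiff : ∀ n, MemLp (fun x => g (x + yy n) - g x) 2 := fun n =>
    (memLp_translate hg _).sub hg
  have e1 : ∀ n : ℕ, ((n : ℝ) + 1) * ∫ x, f (g x) * (g (x + yy n) - g x)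
      = ∑' k : ℤ, (conj (q k) * ((((n : ℝ) + 1 : ℝ) : ℂ) * (fourier k (yy n) - 1) * coeff g k)).re :=
    fun n => by
      rw [← (parseval_mul (memLp_comp hf hg) (hdiff n)).tsum_eq, ← tsum_mul_left]
      refine tsum_congr fun k => ?_
      rw [coeff_translate_sub hg, ← Complex.re_ofReal_mul]
      congr 1; ring
  have e2 : ∀ n : ℕ, ((n : ℝ) + 1) * ∫ x, (g (x + yy n) - g x) ^ 2
      = ∑' k : ℤ, ((n : ℝ) + 1) * ‖fourier k (yy n) - 1‖ ^ 2 * ‖coeff g k‖ ^ 2 := fun n => by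
    rw [← (parseval (hdiff n)).tsum_eq, ← tsum_mul_left]
    refine tsum_congr fun k => ?_
    rw [coeff_translate_sub hg, norm_mul]; ring
  have b1 : ∀ (n : ℕ) (k : ℤ), ((n : ℝ) + 1) * ‖fourier k (yy n) - 1‖ ≤ 2 * Real.pi * |(k : ℝ)| :=
    fun n k => by
      have h := norm_fourier_sub_one_le k (1 / ((n : ℝ) + 1))
      rw [abs_of_pos (show 0 < 1 / ((n : ℝ) + 1) by positivity), mul_one_div,
        le_div_iff₀ (hn n)] at h
      rwa [mul_comm]
  have t1 : Tendsto (fun n : ℕ => ((n : ℝ) + 1) * ∫ x, f (g x) * (g (x + yy n) - g x)) atTop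
      (𝓝 (∑' k : ℤ, (conj (q k) * (2 * Real.pi * Complex.I * k * coeff g k)).re)) := by
    simp_rw [e1]
    refine tendsto_tsum_of_dominated_convergence hsum (fun k => ?_)
      (Eventually.of_forall fun n k => ?_)
    · exact (Complex.continuous_re.tendsto _).comp
        (((tendsto_mul_fourier_sub_one k).mul_const _).const_mul _)
    · refine (Complex.abs_re_le_norm _).trans ?_
      rw [norm_mul, norm_mul, norm_mul, RCLike.norm_conj, Complex.norm_real,
        Real.norm_of_nonneg (hn n).le, mul_left_comm]
      exact mul_le_mul_of_nonneg_right (b1 n k) (by positivity)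
  have t2 : Tendsto (fun n : ℕ => ((n : ℝ) + 1) * ∫ x, (g (x + yy n) - g x) ^ 2) atTop (𝓝 0) := by
    simp_rw [e2]
    rw [show (0 : ℝ) = ∑' k : ℤ, 0 * ‖coeff g k‖ ^ 2 by simp]
    refine tendsto_tsum_of_dominated_convergence (hhalf.mul_left 2) (fun k => ?_)
      (Eventually.of_forall fun n k => ?_)
    · exact (tendsto_div_norm_fourier_sub_one_sq k).mul_const _
    · rw [Real.norm_of_nonneg (by have := hn n; positivity), ← mul_assoc]
      refine mul_le_mul_of_nonneg_right ?_ (by positivity)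
      have h1 := b1 n k
      have h2 := norm_fourier_sub_one_le_two k (yy n)
      rw [sq, ← mul_assoc]
      calc _ ≤ 2 * Real.pi * |(k : ℝ)| * 2 := by gcongr
        _ = _ := by ring
  have t3 : Tendsto (fun n : ℕ => ((n : ℝ) + 1) * ∫ x, f (g x) * (g (x + yy n) - g x)) atTop
      (𝓝 0) := by
    rw [tendsto_zero_iff_abs_tendsto_zero]
    have t4 := t2.const_mul (K : ℝ)
    rw [mul_zero] at t4
    refine squeeze_zero (fun n => abs_nonneg _) (fun n => ?_) t4
    simp only [Function.comp]
    rw [abs_mul, abs_of_pos (hn n), mul_left_comm]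
    exact mul_le_mul_of_nonneg_left
      (abs_integral_comp_mul_translate_sub_le hf hB hg _) (hn n).le
  have hs : Summable fun k : ℤ =>
      (conj (q k) * (2 * Real.pi * Complex.I * k * coeff g k)).re := by
    refine hsum.of_norm_bounded fun k => ?_
    refine (Complex.abs_re_le_norm _).trans (le_of_eq ?_)
    simp only [norm_mul, RCLike.norm_conj, Complex.norm_I, Complex.norm_real, Complex.norm_intCast,
      RCLike.norm_ofNat, Real.norm_of_nonneg Real.pi_pos.le]
    ring
  have := tendsto_nhds_unique t1 t3
  rw [← this]
  exact hs.hasSum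

/-! ### Fourier coefficients of functions on space-time -/

/-- Lebesgue measure on `[0,T]`. -/
abbrev timeMeasure (T : ℝ) : Measure ℝ := volume.restrict (Icc 0 T)

instance (T : ℝ) : IsFiniteMeasure (spaceTime T) := by
  unfold spaceTime; infer_instance

section slices

variable {T : ℝ} {g : ℝ × UnitAddCircle → ℝ}

theorem integrable_coeff_slice (hg : Integrable g (spaceTime T)) (k : ℤ) :
    Integrable (fun t => coeff (fun x => g (t, x)) k) (timeMeasure T) := by
  have h := (integrable_fourier_mul hg.ofReal measurable_snd (-k)).integral_prod_left
  refine h.congr (ae_of_all _ fun t => ?_)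
  simp only [coeff_eq]
  rfl

theorem integral_mul_re_mode (hg : Integrable g (spaceTime T)) {a : ℝ → ℂ}
    (ha : AEStronglyMeasurable a (timeMeasure T)) {C : ℝ} (hC : ∀ t, ‖a t‖ ≤ C) (k : ℤ) :
    ∫ q, g q * (a q.1 * fourier k q.2).re ∂spaceTime T
      = (∫ t in Icc 0 T, a t * conj (coeff (fun x => g (t, x)) k)).re := by
  have h1 : Integrable (fun q : ℝ × UnitAddCircle => a q.1 * (fourier k q.2 * (g q : ℂ)))
      (spaceTime T) :=
    (integrable_fourier_mul hg.ofReal measurable_snd k).bdd_mul (c := C) ha.comp_fst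
      (ae_of_all _ fun q => hC q.1)
  have h2 : ∫ q, g q * (a q.1 * fourier k q.2).re ∂spaceTime T
      = (∫ q, a q.1 * (fourier k q.2 * (g q : ℂ)) ∂spaceTime T).re := by
    rw [← RCLike.re_eq_complex_re, ← integral_re h1]
    refine integral_congr_ae (ae_of_all _ fun q => ?_)
    simp only [RCLike.re_eq_complex_re]
    rw [← Complex.re_ofReal_mul]
    congr 1; ring
  rw [h2]
  congr 1
  unfold spaceTime at h1 ⊢
  rw [integral_prod _ h1]
  refine integral_congr_ae (ae_of_all _ fun t => ?_)
  simp only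
  rw [integral_const_mul, ← coeff_neg, coeff_eq, neg_neg]

/-- Pairing an integrable function with a function given by its Fourier series in space. -/
theorem hasSum_integral_mul_re (hg : Integrable g (spaceTime T)) {a : ℤ → ℝ → ℂ}
    (ha : ∀ k, AEStronglyMeasurable (a k) (timeMeasure T)) {b : ℤ → ℝ} (hb : Summable b)
    (hab : ∀ k t, ‖a k t‖ ≤ b k) {Ψ : ℝ × UnitAddCircle → ℝ}
    (hΨ : ∀ q : ℝ × UnitAddCircle, HasSum (fun k => (a k q.1 * fourier k q.2).re) (Ψ q)) :
    HasSum (fun k => (∫ t in Icc 0 T, a k t * conj (coeff (fun x => g (t, x)) k)).re)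
      (∫ q, g q * Ψ q ∂spaceTime T) := by
  have h1 := hasSum_integral_of_dominated_convergence (μ := spaceTime T)
    (F := fun k q => g q * (a k q.1 * fourier k q.2).re) (f := fun q => g q * Ψ q)
    (fun k q => b k * ‖g q‖) (fun k => ?_) (fun k => ae_of_all _ fun q => ?_)
    (ae_of_all _ fun q => hb.mul_right _) ?_ (ae_of_all _ fun q => (hΨ q).mul_left _)
  · simpa only [integral_mul_re_mode hg (ha _) (hab _)] using h1
  · refine hg.aestronglyMeasurable.mul ?_
    exact Complex.continuous_re.comp_aestronglyMeasurable ((ha k).comp_fst.mul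
      ((map_continuous (fourier k)).comp continuous_snd).aestronglyMeasurable)
  · rw [norm_mul, mul_comm]
    refine mul_le_mul_of_nonneg_right ?_ (norm_nonneg _)
    refine (Complex.abs_re_le_norm _).trans ?_
    rw [norm_mul, norm_fourier_apply, mul_one]
    exact hab k q.1
  · simp_rw [tsum_mul_right]
    exact hg.norm.const_mul _

end slices

/-! ### Test functions with a single frequency -/

/-- The multiplier `(2π|k|)^{2s}` of `(-∂ₓₓ)^s`. -/
def lam (s : ℝ) (k : ℤ) : ℝ := (2 * Real.pi * |(k : ℝ)|) ^ (2 * s)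

theorem lam_nonneg (s : ℝ) (k : ℤ) : 0 ≤ lam s k := by unfold lam; positivity

theorem lam_neg (s : ℝ) (k : ℤ) : lam s (-k) = lam s k := by simp [lam]

/-- The test function `χ(t) Re(z e_k(x))`. -/
def modeTest (χ : ℝ → ℝ) (z : ℂ) (k : ℤ) (t : ℝ) (x : UnitAddCircle) : ℝ :=
  (((χ t : ℂ) * z) * fourier k x).re

theorem isTest_modeTest {T : ℝ} {χ : ℝ → ℝ} (hχ : ContDiff ℝ ((⊤ : ℕ∞) : WithTop ℕ∞) χ)
    {a b : ℝ} (ha : 0 < a) (hb : b < T) (hsupp : ∀ t, χ t ≠ 0 → t ∈ Icc a b) (z : ℂ) (k : ℤ) :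
    IsTest T (modeTest χ z k) := by
  refine ⟨?_, a, b, ha, hb, fun t x h => hsupp t fun h0 => h (by simp [modeTest, h0])⟩
  unfold modeTest
  simp_rw [fourier_coe_apply]
  have h1 : ContDiff ℝ ((⊤ : ℕ∞) : WithTop ℕ∞) fun q : ℝ × ℝ => ((χ q.1 : ℝ) : ℂ) :=
    Complex.ofRealCLM.contDiff.comp (hχ.comp contDiff_fst)
  have h2 : ContDiff ℝ ((⊤ : ℕ∞) : WithTop ℕ∞) fun q : ℝ × ℝ => ((q.2 : ℝ) : ℂ) :=
    Complex.ofRealCLM.contDiff.comp contDiff_snd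
  exact Complex.reCLM.contDiff.comp
    ((h1.mul contDiff_const).mul ((contDiff_const.mul h2).div_const _).cexp)

theorem deriv_modeTest {χ : ℝ → ℝ} (hχ : Differentiable ℝ χ) (z : ℂ) (k : ℤ) (t : ℝ)
    (x : UnitAddCircle) : deriv (fun t => modeTest χ z k t x) t = modeTest (deriv χ) z k t x := by
  have h : HasDerivAt (fun t => (((χ t : ℂ) * z) * fourier k x))
      ((((deriv χ t : ℝ) : ℂ) * z) * fourier k x) t :=
    (((hχ t).hasDerivAt.ofReal_comp).mul_const z).mul_const _
  exact (Complex.reCLM.hasFDerivAt.comp_hasDerivAt t h).deriv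

theorem dX_modeTest (χ : ℝ → ℝ) (z : ℂ) (k : ℤ) (t : ℝ) (x : UnitAddCircle) :
    dX (modeTest χ z k t) x = modeTest χ (z * (2 * Real.pi * Complex.I * k)) k t x := by
  have h0 : HasDerivAt (fun y : ℝ => fourier k (y : UnitAddCircle))
      (2 * Real.pi * Complex.I * k / (1 : ℝ) * fourier k ((0 : ℝ) : UnitAddCircle)) 0 :=
    hasDerivAt_fourier 1 k 0
  have h : HasDerivAt (fun y : ℝ => ((χ t : ℂ) * z) * fourier k x * fourier k (y : UnitAddCircle))
      _ 0 := h0.const_mul _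
  have h1 := (Complex.reCLM.hasFDerivAt.comp_hasDerivAt 0 h).deriv
  have h2 : (fun y : ℝ => modeTest χ z k t (x + (y : UnitAddCircle)))
      = Complex.reCLM ∘ fun y : ℝ => ((χ t : ℂ) * z) * fourier k x * fourier k (y : UnitAddCircle) := by
    funext y
    have : fourier k (x + (y : UnitAddCircle)) = fourier k x * fourier k (y : UnitAddCircle) := by
      simp [AddCircle.toCircle_add]
    simp only [modeTest, Function.comp, this, Complex.reCLM_apply]
    congr 1; ring
  rw [dX, h2, h1]
  simp only [modeTest, Complex.reCLM_apply, AddCircle.coe_zero, fourier_eval_zero]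
  congr 1
  push_cast; ring

theorem fracLap_re_mode (s : ℝ) (z : ℂ) (k : ℤ) (x : UnitAddCircle) :
    fracLap s (fun x => (z * fourier k x).re) x = lam s k * (z * fourier k x).re := by
  have hc : ∀ j : ℤ, coeff (fun x => (z * fourier k x).re) j
      = ((if j = k then z else 0) + (if j = -k then conj z else 0)) / 2 := fun j => by
    rw [coeff_re ((by fun_prop : Continuous fun x : UnitAddCircle => z * fourier k x)
      |>.integrable_of_hasCompactSupport (HasCompactSupport.of_compactSpace _)),
      fourierCoeff.const_mul, fourierCoeff.const_mul, fourierCoeff_fourier_apply,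
      fourierCoeff_fourier_apply]
    have : -j = k ↔ j = -k := neg_eq_iff_eq_neg
    simp only [this]
    split_ifs <;> simp
  have h1 : HasSum (fun j : ℤ => ((lam s j : ℝ) : ℂ) * coeff (fun x => (z * fourier k x).re) j
      * fourier j x) (lam s k * (z * fourier k x) / 2 + lam s k * conj (z * fourier k x) / 2) := by
    have e : ∀ j : ℤ, ((lam s j : ℝ) : ℂ) * coeff (fun x => (z * fourier k x).re) j * fourier j x
        = (if j = k then (lam s k * (z * fourier k x) / 2 : ℂ) else 0)
          + (if j = -k then (lam s k * conj (z * fourier k x) / 2 : ℂ) else 0) := fun j => by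
      rw [hc]
      have h3 : fourier (-k) x = conj (fourier k x) := fourier_neg
      by_cases h1 : j = k <;> by_cases h2 : j = -k
      · subst h1
        rw [if_pos rfl, if_pos h2, if_pos rfl, if_pos h2]
        rw [← h2] at h3
        rw [map_mul, ← h3]; ring
      · subst h1; rw [if_pos rfl, if_neg h2, if_pos rfl, if_neg h2]; ring
      · subst h2; rw [if_neg h1, if_pos rfl, if_neg h1, if_pos rfl, lam_neg, h3, map_mul]; ring
      · simp [h1, h2]
    simp_rw [e]
    exact (hasSum_ite_eq _ _).add (hasSum_ite_eq _ _)
  unfold fracLap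
  have h2 := h1.tsum_eq
  unfold lam at h2 ⊢
  rw [h2, ← add_div, ← mul_add, Complex.add_conj, ← Complex.ofReal_mul, Complex.div_ofNat_re,
    Complex.ofReal_re]
  ring

theorem fracLap_modeTest (s : ℝ) (χ : ℝ → ℝ) (z : ℂ) (k : ℤ) (t : ℝ) (x : UnitAddCircle) :
    fracLap s (modeTest χ z k t) x = lam s k * modeTest χ z k t x :=
  fracLap_re_mode s _ k x

/-- Testing the equation against a single frequency gives an ordinary differential equation in
the sense of distributions for the Fourier coefficient. -/
theorem weak_mode_equation {T ε s : ℝ} {f : ℝ → ℝ} {u h : ℝ × UnitAddCircle → ℝ}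
    (hu : Integrable u (spaceTime T)) (hfu : Integrable (fun q => f (u q)) (spaceTime T))
    (hh : Integrable h (spaceTime T))
    (H : ∀ φ, IsTest T φ → eqnDefect ε s f T u φ = ∫ q, h q * fracLap s (φ q.1) q.2 ∂spaceTime T)
    (k : ℤ) {χ : ℝ → ℝ} (hχ : ContDiff ℝ ((⊤ : ℕ∞) : WithTop ℕ∞) χ) {a b : ℝ} (ha : 0 < a)
    (hb : b < T) (hsupp : ∀ t, χ t ≠ 0 → t ∈ Icc a b) :
    - ∫ t in Icc 0 T, ((deriv χ t : ℝ) : ℂ) * coeff (fun x => u (t, x)) k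
      = ∫ t in Icc 0 T, ((χ t : ℝ) : ℂ) * (lam s k * coeff (fun x => h (t, x)) k
        - 2 * Real.pi * Complex.I * k * coeff (fun x => f (u (t, x))) k
        - ε / 2 * lam s k * coeff (fun x => u (t, x)) k) := by
  have hcs : HasCompactSupport χ := HasCompactSupport.intro isCompact_Icc
    fun t ht => not_not.1 fun h => ht (hsupp t h)
  obtain ⟨C, hC⟩ := hχ.continuous.bounded_above_of_compact_support hcs
  obtain ⟨C', hC'⟩ := (hχ.continuous_deriv (by simp)).bounded_above_of_compact_support hcs.deriv
  have hb' : ∀ {ψ : ℝ → ℝ} {D : ℝ}, (∀ t, ‖ψ t‖ ≤ D) → ∀ (z : ℂ) (t : ℝ),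
      ‖(ψ t : ℂ) * z‖ ≤ D * ‖z‖ := fun hD z t => by
    rw [norm_mul, Complex.norm_real]; gcongr; exact hD t
  have hm : ∀ {ψ : ℝ → ℝ}, Continuous ψ → ∀ z : ℂ,
      AEStronglyMeasurable (fun t => (ψ t : ℂ) * z) (timeMeasure T) := fun hψ z =>
    ((Complex.continuous_ofReal.comp hψ).mul continuous_const).aestronglyMeasurable
  have pair : ∀ {g : ℝ × UnitAddCircle → ℝ}, Integrable g (spaceTime T) → ∀ {ψ : ℝ → ℝ} {D : ℝ},
      Continuous ψ → (∀ t, ‖ψ t‖ ≤ D) → ∀ z : ℂ,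
      ∫ q, g q * modeTest ψ z k q.1 q.2 ∂spaceTime T
        = (z * conj (∫ t in Icc 0 T, (ψ t : ℂ) * coeff (fun x => g (t, x)) k)).re := by
    intro g hg ψ D hψ hD z
    unfold modeTest
    rw [integral_mul_re_mode hg (hm hψ z) (hb' hD z), ← integral_conj, ← integral_const_mul]
    congr 2
    funext t
    rw [map_mul, Complex.conj_ofReal]; ring
  set A := ∫ t in Icc 0 T, ((deriv χ t : ℝ) : ℂ) * coeff (fun x => u (t, x)) k
  set U := ∫ t in Icc 0 T, ((χ t : ℝ) : ℂ) * coeff (fun x => u (t, x)) k with hU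
  set Q := ∫ t in Icc 0 T, ((χ t : ℝ) : ℂ) * coeff (fun x => f (u (t, x))) k with hQ
  set E := ∫ t in Icc 0 T, ((χ t : ℝ) : ℂ) * coeff (fun x => h (t, x)) k with hE
  have hint : ∀ {g : ℝ × UnitAddCircle → ℝ}, Integrable g (spaceTime T) →
      Integrable (fun t => ((χ t : ℝ) : ℂ) * coeff (fun x => g (t, x)) k) (timeMeasure T) :=
    fun hg => (integrable_coeff_slice hg k).bdd_mul (c := C)
      (Complex.continuous_ofReal.comp hχ.continuous).aestronglyMeasurable
      (ae_of_all _ fun t => by simpa using hC t)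
  have hR : ∫ t in Icc 0 T, ((χ t : ℝ) : ℂ) * (lam s k * coeff (fun x => h (t, x)) k
        - 2 * Real.pi * Complex.I * k * coeff (fun x => f (u (t, x))) k
        - ε / 2 * lam s k * coeff (fun x => u (t, x)) k)
      = lam s k * E - 2 * Real.pi * Complex.I * k * Q - ε / 2 * lam s k * U := by
    have i1 : Integrable (fun t => lam s k * (((χ t : ℝ) : ℂ) * coeff (fun x => h (t, x)) k)
        - 2 * Real.pi * Complex.I * k * (((χ t : ℝ) : ℂ) * coeff (fun x => f (u (t, x))) k))
        (timeMeasure T) := ((hint hh).const_mul _).sub ((hint hfu).const_mul _)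
    rw [hU, hQ, hE, ← integral_const_mul, ← integral_const_mul, ← integral_const_mul,
      ← integral_sub ((hint hh).const_mul _) ((hint hfu).const_mul _),
      ← integral_sub i1 ((hint hu).const_mul _)]
    congr 1
    funext t
    ring
  rw [hR]
  -- test functions are real, so the complex identity is recovered by varying `z`
  have main : ∀ z : ℂ, (z * conj (-A + 2 * Real.pi * Complex.I * k * Q + ε / 2 * lam s k * U
      - lam s k * E)).re = 0 := fun z => by
    have h1 := H _ (isTest_modeTest hχ ha hb hsupp z k)
    unfold eqnDefect at h1
    have hd : ∀ t x, deriv (fun t => modeTest χ z k t x) t = modeTest (deriv χ) z k t x :=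
      deriv_modeTest (hχ.differentiable (by simp)) z k
    simp only [hd, dX_modeTest, fracLap_modeTest, mul_left_comm _ (lam s k)] at h1
    rw [integral_const_mul, integral_const_mul, pair hu (hχ.continuous_deriv (by simp)) hC',
      pair hfu hχ.continuous hC, pair hu hχ.continuous hC, pair hh hχ.continuous hC] at h1
    rw [← sub_eq_zero] at h1
    rw [← h1, ← Complex.re_ofReal_mul, ← Complex.re_ofReal_mul, ← Complex.re_ofReal_mul,
      ← Complex.neg_re, ← Complex.sub_re, ← Complex.add_re, ← Complex.sub_re]
    congr 1
    simp only [map_add, map_sub, map_mul, map_neg, Complex.conj_ofReal, Complex.conj_I,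
      map_ofNat, map_intCast, map_div₀]
    push_cast
    ring
  have hz := main (-A + 2 * Real.pi * Complex.I * k * Q + ε / 2 * lam s k * U - lam s k * E)
  rw [Complex.mul_conj, Complex.ofReal_re, Complex.normSq_eq_zero] at hz
  linear_combination hz

/-! ### Weak derivatives of functions of time -/

theorem integral_mul_eq_neg_integral_deriv_mul_primitive {T : ℝ} {γ χ : ℝ → ℝ}
    (hγ : IntervalIntegrable γ volume 0 T) (hχ : ContDiff ℝ ((⊤ : ℕ∞) : WithTop ℕ∞) χ)
    (h0 : χ 0 = 0) (hT : χ T = 0) :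
    ∫ t in (0 : ℝ)..T, χ t * γ t = - ∫ t in (0 : ℝ)..T, deriv χ t * ∫ r in (0 : ℝ)..t, γ r := by
  have h1 : AbsolutelyContinuousOnInterval χ 0 T :=
    (hχ.of_le (by simp)).contDiffOn.absolutelyContinuousOnInterval
  have h2 : AbsolutelyContinuousOnInterval (fun t => ∫ r in (0 : ℝ)..t, γ r) 0 T :=
    hγ.absolutelyContinuousOnInterval_intervalIntegral (by simp)
  have h3 := h1.integral_deriv_mul_eq_sub h2
  rw [h0, hT, zero_mul, zero_mul, sub_zero] at h3
  have h4 : ∫ t in (0 : ℝ)..T, (deriv χ t * (∫ r in (0 : ℝ)..t, γ r)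
        + χ t * deriv (fun t => ∫ r in (0 : ℝ)..t, γ r) t)
      = ∫ t in (0 : ℝ)..T, (deriv χ t * (∫ r in (0 : ℝ)..t, γ r) + χ t * γ t) := by
    refine intervalIntegral.integral_congr_ae ?_
    filter_upwards [hγ.ae_hasDerivAt_integral] with t ht hm
    rw [(ht (uIoc_subset_uIcc hm) 0 (by simp)).deriv]
  rw [h4, intervalIntegral.integral_add] at h3
  · linarith
  · exact (h2.continuousOn.intervalIntegrable).continuousOn_mul
      (hχ.continuous_deriv (by simp)).continuousOn
  · exact hγ.continuousOn_mul hχ.continuous.continuousOn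

/-- The du Bois-Reymond lemma: a continuous function with vanishing distributional derivative on
`]0,T[` is constant. -/
theorem eq_const_of_integral_deriv_mul_eq_zero {T : ℝ} (hT : 0 < T) {g : ℝ → ℝ}
    (hg : ContinuousOn g (Icc 0 T))
    (H : ∀ (χ : ℝ → ℝ) (a b : ℝ), ContDiff ℝ ((⊤ : ℕ∞) : WithTop ℕ∞) χ → 0 < a → b < T →
      (∀ t, χ t ≠ 0 → t ∈ Icc a b) → ∫ t in (0 : ℝ)..T, deriv χ t * g t = 0) :
    ∀ t ∈ Icc 0 T, g t = g 0 := by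
  have huIcc : uIcc 0 T = Icc 0 T := uIcc_of_le hT.le
  let bump : ContDiffBump (T / 2) := ⟨T / 8, T / 4, by positivity, by linarith⟩
  set ρ : ℝ → ℝ := bump.normed volume with hρ
  have hρs : ContDiff ℝ ((⊤ : ℕ∞) : WithTop ℕ∞) ρ := bump.contDiff_normed
  have hρsupp : ∀ t, ρ t ≠ 0 → t ∈ Icc (T / 4) (3 * T / 4) := fun t ht => by
    have : t ∈ Function.support ρ := ht
    rw [hρ, bump.support_normed_eq, Real.ball_eq_Ioo] at this
    simp only [bump] at this
    exact ⟨by linarith [this.1], by linarith [this.2]⟩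
  have hint_eq : ∀ {ψ : ℝ → ℝ} {a b : ℝ}, 0 < a → b < T → (∀ t, ψ t ≠ 0 → t ∈ Icc a b) →
      ∫ t in (0 : ℝ)..T, ψ t = ∫ t, ψ t := fun {ψ a b} ha hb hs =>
    intervalIntegral.integral_eq_integral_of_support_subset fun t ht =>
      ⟨ha.trans_le (hs t ht).1, (hs t ht).2.trans hb.le⟩
  have hρint : ∫ t in (0 : ℝ)..T, ρ t = 1 := by
    rw [hint_eq (a := T / 4) (b := 3 * T / 4) (by linarith) (by linarith) hρsupp]
    exact bump.integral_normed
  set κ := ∫ t in (0 : ℝ)..T, ρ t * g t with hκ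
  have hgi : IntervalIntegrable g volume 0 T := (huIcc ▸ hg).intervalIntegrable
  -- every test function is, up to a multiple of `ρ`, the derivative of a test function
  have key : ∀ (ψ : ℝ → ℝ) (a b : ℝ), ContDiff ℝ ((⊤ : ℕ∞) : WithTop ℕ∞) ψ → 0 < a → b < T →
      (∀ t, ψ t ≠ 0 → t ∈ Icc a b) → ∫ t in (0 : ℝ)..T, ψ t * (g t - κ) = 0 := by
    intro ψ a b hψ ha hb hs
    set c := ∫ t in (0 : ℝ)..T, ψ t with hc
    set η : ℝ → ℝ := fun t => ψ t - c * ρ t with hη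
    have hηs : ContDiff ℝ ((⊤ : ℕ∞) : WithTop ℕ∞) η := hψ.sub (contDiff_const.mul hρs)
    have hηi : ∀ x y : ℝ, IntervalIntegrable η volume x y := fun x y =>
      hηs.continuous.intervalIntegrable x y
    have hηsupp : ∀ t, η t ≠ 0 → t ∈ Icc (min a (T / 4)) (max b (3 * T / 4)) := fun t ht => by
      by_contra hn
      apply ht
      have h1 : ψ t = 0 := by
        by_contra h
        exact hn ⟨(min_le_left _ _).trans (hs t h).1, (hs t h).2.trans (le_max_left _ _)⟩
      have h2 : ρ t = 0 := by
        by_contra h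
        exact hn ⟨(min_le_right _ _).trans (hρsupp t h).1,
          (hρsupp t h).2.trans (le_max_right _ _)⟩
      simp [hη, h1, h2]
    set χ : ℝ → ℝ := fun t => ∫ r in (0 : ℝ)..t, η r with hχ
    have hderiv : ∀ t, HasDerivAt χ (η t) t := fun t =>
      intervalIntegral.integral_hasDerivAt_right (hηi _ _)
        (hηs.continuous.stronglyMeasurableAtFilter _ _) hηs.continuous.continuousAt
    have hd : deriv χ = η := funext fun t => (hderiv t).deriv
    have hχs : ContDiff ℝ ((⊤ : ℕ∞) : WithTop ℕ∞) χ :=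
      contDiff_infty_iff_deriv.2 ⟨fun t => (hderiv t).differentiableAt, hd ▸ hηs⟩
    have hm0 : 0 < min a (T / 4) := lt_min ha (by linarith)
    have hM : max b (3 * T / 4) < T := max_lt hb (by linarith)
    have htot : ∫ t in (0 : ℝ)..T, η t = 0 := by
      rw [hη, intervalIntegral.integral_sub (hψ.continuous.intervalIntegrable _ _)
        ((hρs.continuous.intervalIntegrable _ _).const_mul _),
        intervalIntegral.integral_const_mul, hρint, ← hc]
      ring
    have hχsupp : ∀ t, χ t ≠ 0 → t ∈ Icc (min a (T / 4)) (max b (3 * T / 4)) := fun t ht => by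
      by_contra hn
      apply ht
      rw [mem_Icc, not_and_or, not_le, not_le] at hn
      rcases hn with hn | hn
      · refine intervalIntegral.integral_zero_ae (ae_of_all _ fun r hr => ?_)
        by_contra h
        have h1 := (hηsupp r h).1
        have h2 : r ≤ max 0 t := hr.2
        rcases le_max_iff.1 h2 with h3 | h3 <;> linarith
      · have h1 : χ t = (∫ r in (0 : ℝ)..T, η r) + ∫ r in T..t, η r :=
          (intervalIntegral.integral_add_adjacent_intervals (hηi _ _) (hηi _ _)).symm
        rw [h1, htot, zero_add]
        refine intervalIntegral.integral_zero_ae (ae_of_all _ fun r hr => ?_)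
        by_contra h
        have h1 := (hηsupp r h).2
        have h2 : min T t < r := hr.1
        rcases min_lt_iff.1 h2 with h3 | h3 <;> linarith
    have h1 := H χ _ _ hχs hm0 hM hχsupp
    rw [hd] at h1
    have i1 : IntervalIntegrable (fun t => ψ t * g t) volume 0 T :=
      hgi.continuousOn_mul hψ.continuous.continuousOn
    have i2 : IntervalIntegrable (fun t => ρ t * g t) volume 0 T :=
      hgi.continuousOn_mul hρs.continuous.continuousOn
    have h2 : ∫ t in (0 : ℝ)..T, η t * g t = (∫ t in (0 : ℝ)..T, ψ t * g t) - c * κ := by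
      rw [hκ, ← intervalIntegral.integral_const_mul, ← intervalIntegral.integral_sub i1
        (i2.const_mul c)]
      refine intervalIntegral.integral_congr fun t _ => ?_
      simp only [hη]; ring
    have h3 : ∫ t in (0 : ℝ)..T, ψ t * (g t - κ) = (∫ t in (0 : ℝ)..T, ψ t * g t) - c * κ := by
      rw [hc, ← intervalIntegral.integral_mul_const, ← intervalIntegral.integral_sub i1
        ((hψ.continuous.intervalIntegrable _ _).mul_const κ)]
      refine intervalIntegral.integral_congr fun t _ => ?_
      ring
    rw [h3, ← h2, h1]
  have hae : ∀ᵐ t : ℝ, t ∈ Ioo 0 T → g t - κ = 0 := by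
    refine isOpen_Ioo.ae_eq_zero_of_integral_contDiff_smul_eq_zero ?_ fun ψ hψ hcs hts => ?_
    · exact ((hg.mono Ioo_subset_Icc_self).sub continuousOn_const).locallyIntegrableOn
        measurableSet_Ioo
    · obtain ⟨a, b, ha, hb, hab⟩ : ∃ a b : ℝ, 0 < a ∧ b < T ∧ tsupport ψ ⊆ Icc a b := by
        rcases (tsupport ψ).eq_empty_or_nonempty with he | hne
        · exact ⟨T / 2, T / 2, by linarith, by linarith, by simp [he]⟩
        · obtain ⟨a, ha⟩ := hcs.isCompact.exists_isLeast hne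
          obtain ⟨b, hb⟩ := hcs.isCompact.exists_isGreatest hne
          exact ⟨a, b, (hts ha.1).1, (hts hb.1).2, fun t ht => ⟨ha.2 ht, hb.2 ht⟩⟩
      have hs : ∀ t, ψ t ≠ 0 → t ∈ Icc a b := fun t ht => hab (subset_tsupport _ ht)
      have h1 := key ψ a b hψ ha hb hs
      rw [hint_eq (a := a) (b := b) ha hb fun t ht => hs t (left_ne_zero_of_mul ht)] at h1
      simpa using h1
  have hae2 : g =ᵐ[volume.restrict (Icc 0 T)] fun _ => κ := by
    rw [← restrict_Ioo_eq_restrict_Icc]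
    rw [EventuallyEq, ae_restrict_iff' measurableSet_Ioo]
    filter_upwards [hae] with t ht hm
    exact sub_eq_zero.1 (ht hm)
  have heq := Measure.eqOn_Icc_of_ae_eq volume hT.ne hae2 hg continuousOn_const
  intro t ht
  rw [heq ht, heq (left_mem_Icc.2 hT.le)]

/-- A continuous function with an integrable weak derivative is the primitive of the latter. -/
theorem eq_add_integral_of_weak_deriv_real {T : ℝ} (hT : 0 < T) {α γ : ℝ → ℝ}
    (hα : ContinuousOn α (Icc 0 T)) (hγ : IntervalIntegrable γ volume 0 T)
    (H : ∀ (χ : ℝ → ℝ) (a b : ℝ), ContDiff ℝ ((⊤ : ℕ∞) : WithTop ℕ∞) χ → 0 < a → b < T →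
      (∀ t, χ t ≠ 0 → t ∈ Icc a b) →
      - ∫ t in (0 : ℝ)..T, deriv χ t * α t = ∫ t in (0 : ℝ)..T, χ t * γ t) :
    ∀ t ∈ Icc 0 T, α t = α 0 + ∫ r in (0 : ℝ)..t, γ r := by
  have huIcc : uIcc 0 T = Icc 0 T := uIcc_of_le hT.le
  have hΓ : ContinuousOn (fun t => ∫ r in (0 : ℝ)..t, γ r) (Icc 0 T) := by
    have := (hγ.absolutelyContinuousOnInterval_intervalIntegral (c := 0) (by simp)).continuousOn
    rwa [huIcc] at this
  have h1 := eq_const_of_integral_deriv_mul_eq_zero hT (hα.sub hΓ) fun χ a b hχ ha hb hs => by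
    have hz : ∀ t, t ∉ Icc a b → χ t = 0 := fun t ht => not_not.1 fun h => ht (hs t h)
    have h2 := integral_mul_eq_neg_integral_deriv_mul_primitive hγ hχ
      (hz 0 fun h => by linarith [h.1]) (hz T fun h => by linarith [h.2])
    have h3 := H χ a b hχ ha hb hs
    have hc : ContinuousOn (deriv χ) (uIcc 0 T) := (hχ.continuous_deriv (by simp)).continuousOn
    have h4 : ∫ t in (0 : ℝ)..T, deriv χ t * (α t - ∫ r in (0 : ℝ)..t, γ r)
        = (∫ t in (0 : ℝ)..T, deriv χ t * α t)
          - ∫ t in (0 : ℝ)..T, deriv χ t * ∫ r in (0 : ℝ)..t, γ r := by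
      have i1 : IntervalIntegrable (fun t => deriv χ t * α t) volume 0 T :=
        (hc.mul (huIcc ▸ hα)).intervalIntegrable
      have i2 : IntervalIntegrable (fun t => deriv χ t * ∫ r in (0 : ℝ)..t, γ r) volume 0 T :=
        (hc.mul (huIcc ▸ hΓ)).intervalIntegrable
      rw [← intervalIntegral.integral_sub i1 i2]
      refine intervalIntegral.integral_congr fun t _ => ?_
      ring
    refine h4.trans ?_
    linarith
  intro t ht
  have h2 := h1 t ht
  have h3 : ∫ r in (0 : ℝ)..0, γ r = 0 := intervalIntegral.integral_same
  simp only [Pi.sub_apply, h3, sub_zero] at h2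
  linarith

theorem sq_sub_sq_of_eq_add_integral {T : ℝ} (hT : 0 < T) {α γ : ℝ → ℝ}
    (hγ : IntervalIntegrable γ volume 0 T)
    (H : ∀ t ∈ Icc 0 T, α t = α 0 + ∫ r in (0 : ℝ)..t, γ r) :
    α T ^ 2 - α 0 ^ 2 = ∫ t in (0 : ℝ)..T, 2 * (α t * γ t) := by
  set P : ℝ → ℝ := fun t => α 0 + ∫ r in (0 : ℝ)..t, γ r with hP
  have hAC : AbsolutelyContinuousOnInterval P 0 T := by
    have h1 : AbsolutelyContinuousOnInterval (fun _ : ℝ => α 0) 0 T :=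
      (contDiff_const (n := 1)).contDiffOn.absolutelyContinuousOnInterval
    exact h1.add (hγ.absolutelyContinuousOnInterval_intervalIntegral (by simp))
  have h1 := hAC.integral_deriv_mul_eq_sub hAC
  have h2 : P T = α T := (H T ⟨hT.le, le_rfl⟩).symm
  have h3 : P 0 = α 0 := by simp [hP]
  rw [h2, h3] at h1
  rw [sq, sq, ← h1]
  refine intervalIntegral.integral_congr_ae ?_
  filter_upwards [hγ.ae_hasDerivAt_integral] with t ht hm
  have hm' : t ∈ Icc 0 T := by
    rw [← uIcc_of_le hT.le]; exact uIoc_subset_uIcc hm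
  have hd : deriv P t = γ t :=
    ((ht (uIoc_subset_uIcc hm) 0 (by simp)).const_add (α 0)).deriv
  rw [hd, H t hm']
  simp only [hP]
  ring

/-- A continuous curve with an integrable weak derivative satisfies the energy identity, and is
constant if the derivative vanishes. -/
theorem energy_of_weak_deriv {T : ℝ} (hT : 0 < T) {α γ : ℝ → ℂ}
    (hα : ContinuousOn α (Icc 0 T)) (hγ : IntegrableOn γ (Icc 0 T))
    (H : ∀ (χ : ℝ → ℝ) (a b : ℝ), ContDiff ℝ ((⊤ : ℕ∞) : WithTop ℕ∞) χ → 0 < a → b < T →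
      (∀ t, χ t ≠ 0 → t ∈ Icc a b) →
      - ∫ t in Icc 0 T, ((deriv χ t : ℝ) : ℂ) * α t = ∫ t in Icc 0 T, ((χ t : ℝ) : ℂ) * γ t) :
    ‖α T‖ ^ 2 - ‖α 0‖ ^ 2 = ∫ t in Icc 0 T, 2 * (conj (α t) * γ t).re ∧
      ((∀ t ∈ Icc 0 T, γ t = 0) → α T = α 0) := by
  have hI : ∀ F : ℝ → ℂ, IntegrableOn F (Icc 0 T) → IntervalIntegrable F volume 0 T := fun F hF =>
    (intervalIntegrable_iff_integrableOn_Icc_of_le hT.le).2 hF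
  have hIr : ∀ F : ℝ → ℝ, IntegrableOn F (Icc 0 T) → IntervalIntegrable F volume 0 T := fun F hF =>
    (intervalIntegrable_iff_integrableOn_Icc_of_le hT.le).2 hF
  have hint : ∀ F : ℝ → ℝ, ∫ t in Icc 0 T, F t = ∫ t in (0 : ℝ)..T, F t := fun F => by
    rw [integral_Icc_eq_integral_Ioc, intervalIntegral.integral_of_le hT.le]
  have hαi : IntegrableOn α (Icc 0 T) := hα.integrableOn_Icc
  have hre : ∀ {F : ℝ → ℂ}, IntegrableOn F (Icc 0 T) → ∀ {χ : ℝ → ℝ}, Continuous χ →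
      (∫ t in Icc 0 T, ((χ t : ℝ) : ℂ) * F t).re = ∫ t in (0 : ℝ)..T, χ t * (F t).re ∧
      (∫ t in Icc 0 T, ((χ t : ℝ) : ℂ) * F t).im = ∫ t in (0 : ℝ)..T, χ t * (F t).im := by
    intro F hF χ hχ
    have h1 : IntegrableOn (fun t => ((χ t : ℝ) : ℂ) * F t) (Icc 0 T) :=
      hF.continuousOn_mul (Complex.continuous_ofReal.comp hχ).continuousOn isCompact_Icc
    constructor
    · rw [← hint, ← RCLike.re_eq_complex_re, ← integral_re h1]
      refine integral_congr_ae (ae_of_all _ fun t => ?_)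
      simp
    · rw [← hint, ← RCLike.im_eq_complex_im, ← integral_im h1]
      refine integral_congr_ae (ae_of_all _ fun t => ?_)
      simp
  have iγr : IntervalIntegrable (fun t => (γ t).re) volume 0 T := hIr _ hγ.re
  have iγi : IntervalIntegrable (fun t => (γ t).im) volume 0 T := hIr _ hγ.im
  have Er := eq_add_integral_of_weak_deriv_real hT (Complex.continuous_re.comp_continuousOn hα)
    iγr fun χ a b hχ ha hb hs => by
      have h := congrArg Complex.re (H χ a b hχ ha hb hs)
      rw [Complex.neg_re, (hre hαi (hχ.continuous_deriv (by simp))).1,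
        (hre hγ hχ.continuous).1] at h
      exact h
  have Ei := eq_add_integral_of_weak_deriv_real hT (Complex.continuous_im.comp_continuousOn hα)
    iγi fun χ a b hχ ha hb hs => by
      have h := congrArg Complex.im (H χ a b hχ ha hb hs)
      rw [Complex.neg_im, (hre hαi (hχ.continuous_deriv (by simp))).2,
        (hre hγ hχ.continuous).2] at h
      exact h
  have Sr := sq_sub_sq_of_eq_add_integral hT iγr Er
  have Si := sq_sub_sq_of_eq_add_integral hT iγi Ei
  simp only [Function.comp] at Er Ei Sr Si
  constructor
  · rw [hint]
    have i1 : IntervalIntegrable (fun t => 2 * ((α t).re * (γ t).re)) volume 0 T :=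
      (iγr.continuousOn_mul (by
        rw [uIcc_of_le hT.le]; exact Complex.continuous_re.comp_continuousOn hα)).const_mul 2
    have i2 : IntervalIntegrable (fun t => 2 * ((α t).im * (γ t).im)) volume 0 T :=
      (iγi.continuousOn_mul (by
        rw [uIcc_of_le hT.le]; exact Complex.continuous_im.comp_continuousOn hα)).const_mul 2
    have h1 : ∫ t in (0 : ℝ)..T, 2 * (conj (α t) * γ t).re
        = (∫ t in (0 : ℝ)..T, 2 * ((α t).re * (γ t).re))
          + ∫ t in (0 : ℝ)..T, 2 * ((α t).im * (γ t).im) := by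
      rw [← intervalIntegral.integral_add i1 i2]
      refine intervalIntegral.integral_congr fun t _ => ?_
      simp [Complex.mul_re]; ring
    rw [h1, ← Sr, ← Si, ← Complex.normSq_eq_norm_sq, ← Complex.normSq_eq_norm_sq,
      Complex.normSq_apply, Complex.normSq_apply]
    ring
  · intro hz
    have hT' : T ∈ Icc 0 T := ⟨hT.le, le_rfl⟩
    have z : ∀ {F : ℝ → ℝ}, (∀ t ∈ Icc 0 T, F t = 0) → ∫ t in (0 : ℝ)..T, F t = 0 := fun hF => by
      rw [intervalIntegral.integral_congr (g := fun _ => (0 : ℝ)), intervalIntegral.integral_zero]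
      intro t ht
      rw [uIcc_of_le hT.le] at ht
      exact hF t ht
    have h1 := Er T hT'
    have h2 := Ei T hT'
    rw [z fun t ht => by rw [hz t ht, Complex.zero_re], add_zero] at h1
    rw [z fun t ht => by rw [hz t ht, Complex.zero_im], add_zero] at h2
    exact Complex.ext h1 h2

/-! ### Sobolev norms -/

theorem one_le_two_pi_mul_abs {k : ℤ} (hk : k ≠ 0) : 1 ≤ 2 * Real.pi * |(k : ℝ)| := by
  have h1 : (1 : ℝ) ≤ |(k : ℝ)| := by exact_mod_cast Int.one_le_abs hk
  nlinarith [Real.pi_gt_three]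

theorem lam_zero {s : ℝ} (hs : 0 < s) : lam s 0 = 0 := by
  have : 2 * s ≠ 0 := by positivity
  simp [lam, Real.zero_rpow this]

theorem lam_mono {r s : ℝ} (hr : 0 < r) (h : r ≤ s) (k : ℤ) : lam r k ≤ lam s k := by
  rcases eq_or_ne k 0 with rfl | hk
  · rw [lam_zero hr, lam_zero (hr.trans_le h)]
  · exact Real.rpow_le_rpow_of_exponent_le (one_le_two_pi_mul_abs hk) (by linarith)

theorem one_le_lam {s : ℝ} (hs : 0 < s) {k : ℤ} (hk : k ≠ 0) : 1 ≤ lam s k :=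
  Real.one_le_rpow (one_le_two_pi_mul_abs hk) (by linarith)

theorem two_pi_abs_le_lam {s : ℝ} (hs : 1 / 2 ≤ s) (k : ℤ) : 2 * Real.pi * |(k : ℝ)| ≤ lam s k := by
  have := lam_mono (r := 1 / 2) (by norm_num) hs k
  simpa [lam] using this

theorem ofReal_mul_enorm_sq {c : ℝ} (hc : 0 ≤ c) (z : ℂ) :
    ENNReal.ofReal c * ‖z‖ₑ ^ 2 = ENNReal.ofReal (c * ‖z‖ ^ 2) := by
  rw [ENNReal.ofReal_mul hc, ENNReal.ofReal_pow (norm_nonneg _), ofReal_norm]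

theorem hDotSq_eq (s : ℝ) (g : UnitAddCircle → ℝ) :
    hDotSq s g = ∑' k : ℤ, ENNReal.ofReal (lam s k * ‖coeff g k‖ ^ 2) := by
  unfold hDotSq
  exact tsum_congr fun k => ofReal_mul_enorm_sq (lam_nonneg s k) _

theorem hDotSq_mono {r s : ℝ} (hr : 0 < r) (h : r ≤ s) (g : UnitAddCircle → ℝ) :
    hDotSq r g ≤ hDotSq s g := by
  rw [hDotSq_eq, hDotSq_eq]
  refine ENNReal.tsum_le_tsum fun k => ENNReal.ofReal_le_ofReal ?_
  gcongr
  exact lam_mono hr h k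

theorem hasSum_toReal_of_tsum_ne_top {ι : Type*} {a : ι → ℝ} (ha : ∀ i, 0 ≤ a i)
    (h : ∑' i, ENNReal.ofReal (a i) ≠ ⊤) :
    HasSum a (∑' i, ENNReal.ofReal (a i)).toReal := by
  have h1 := ENNReal.hasSum_toReal h
  rw [← ENNReal.tsum_toReal_eq fun i => ENNReal.ofReal_ne_top] at h1
  simpa only [ENNReal.toReal_ofReal (ha _)] using h1

theorem hasSum_of_hDotSq_lt_top {s : ℝ} {g : UnitAddCircle → ℝ} (h : hDotSq s g < ⊤) :
    HasSum (fun k => lam s k * ‖coeff g k‖ ^ 2) (hDotSq s g).toReal := by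
  rw [hDotSq_eq] at h ⊢
  exact hasSum_toReal_of_tsum_ne_top (fun k => mul_nonneg (lam_nonneg s k) (by positivity)) h.ne

theorem spaceHSq_mono {r s : ℝ} (hr : 0 < r) (h : r ≤ s) (T : ℝ) (g : ℝ × UnitAddCircle → ℝ) :
    spaceHSq r T g ≤ spaceHSq s T g :=
  lintegral_mono fun _ => hDotSq_mono hr h _

theorem spaceHSq_eq_tsum {s T : ℝ} {g : ℝ × UnitAddCircle → ℝ} (hg : Integrable g (spaceTime T)) :
    spaceHSq s T g = ∑' k : ℤ, ∫⁻ t in Icc 0 T,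
      ENNReal.ofReal (lam s k * ‖coeff (fun x => g (t, x)) k‖ ^ 2) := by
  unfold spaceHSq
  simp_rw [hDotSq_eq]
  refine lintegral_tsum fun k => ?_
  exact (((integrable_coeff_slice hg k).aestronglyMeasurable.norm.aemeasurable.pow_const
    2).const_mul _).ennreal_ofReal

theorem ae_hDotSq_lt_top {s T : ℝ} {g : ℝ × UnitAddCircle → ℝ}
    (hg : Integrable g (spaceTime T)) (h : spaceHSq s T g < ⊤) :
    ∀ᵐ t ∂timeMeasure T, hDotSq s (fun x => g (t, x)) < ⊤ := by
  refine ae_lt_top' ?_ h.ne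
  simp_rw [hDotSq_eq]
  refine AEMeasurable.tsum fun k => ?_
  exact (((integrable_coeff_slice hg k).aestronglyMeasurable.norm.aemeasurable.pow_const
    2).const_mul _).ennreal_ofReal

theorem integrable_mode_of_spaceHSq_lt_top {s T : ℝ} {g : ℝ × UnitAddCircle → ℝ}
    (hg : Integrable g (spaceTime T)) (h : spaceHSq s T g < ⊤) (k : ℤ) :
    Integrable (fun t => lam s k * ‖coeff (fun x => g (t, x)) k‖ ^ 2) (timeMeasure T) := by
  have hm : AEStronglyMeasurable (fun t => lam s k * ‖coeff (fun x => g (t, x)) k‖ ^ 2)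
      (timeMeasure T) :=
    (((integrable_coeff_slice hg k).aestronglyMeasurable.norm.aemeasurable.pow_const
      2).const_mul _).aestronglyMeasurable
  refine ⟨hm, ?_⟩
  rw [hasFiniteIntegral_iff_ofReal (ae_of_all _ fun t => mul_nonneg (lam_nonneg s k)
    (by positivity))]
  rw [spaceHSq_eq_tsum hg] at h
  exact (ENNReal.le_tsum k).trans_lt h

theorem hasSum_integral_mode {s T : ℝ} {g : ℝ × UnitAddCircle → ℝ}
    (hg : Integrable g (spaceTime T)) (h : spaceHSq s T g < ⊤) :
    HasSum (fun k => ∫ t in Icc 0 T, lam s k * ‖coeff (fun x => g (t, x)) k‖ ^ 2)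
      (spaceHSq s T g).toReal := by
  have h0 : ∀ k, 0 ≤ ∫ t in Icc 0 T, lam s k * ‖coeff (fun x => g (t, x)) k‖ ^ 2 := fun k =>
    integral_nonneg fun t => mul_nonneg (lam_nonneg s k) (by positivity)
  have e : spaceHSq s T g = ∑' k : ℤ, ENNReal.ofReal
      (∫ t in Icc 0 T, lam s k * ‖coeff (fun x => g (t, x)) k‖ ^ 2) := by
    rw [spaceHSq_eq_tsum hg]
    refine tsum_congr fun k => ?_
    rw [ofReal_integral_eq_lintegral_ofReal (integrable_mode_of_spaceHSq_lt_top hg h k)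
      (ae_of_all _ fun t => mul_nonneg (lam_nonneg s k) (by positivity))]
  rw [e] at h ⊢
  exact hasSum_toReal_of_tsum_ne_top h0 h.ne

/-! ### Energy of a path of finite cost -/

theorem HMinusOne.continuous_hat (k : ℤ) : Continuous fun a : HMinusOne => a.hat k := by
  have h1 : Continuous HMinusOne.toEll2 :=
    (Isometry.of_dist_eq fun a b => rfl : Isometry HMinusOne.toEll2).continuous
  have h2 : Continuous fun a : HMinusOne => HMinusOne.toEll2 a k :=
    (continuous_apply k).comp (lp.uniformContinuous_coe.continuous.comp h1)
  have h0 : (√(1 + (2 * Real.pi * (k : ℝ)) ^ 2)) ≠ 0 :=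
    (Real.sqrt_pos.2 (HMinusOne.weight_pos k)).ne'
  refine (h2.const_smul (√(1 + (2 * Real.pi * (k : ℝ)) ^ 2))).congr fun a => ?_
  exact smul_inv_smul₀ h0 (a.hat k)

theorem HMinusOne.IsFun.ae_eq {a : HMinusOne} {g h : UnitAddCircle → ℝ} (hg : a.IsFun g)
    (hh : a.IsFun h) : g =ᵐ[volume] h := by
  have h1 := ae_eq_zero_of_coeff_eq_zero (hg.1.sub hh.1) fun k => by
    refine (coeff_sub hg.1 hh.1 k).trans ?_
    rw [← hg.2, ← hh.2, sub_self]
  filter_upwards [h1] with x hx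
  exact sub_eq_zero.1 hx

theorem constProfile_coe (m : ℝ) : (constProfile m : UnitAddCircle → ℝ) =ᵐ[volume] fun _ => m :=
  Lp.coeFn_const 2 volume m

theorem coeff_constProfile_zero (m : ℝ) : coeff (constProfile m) 0 = m := by
  rw [coeff_congr_ae (constProfile_coe m), FracCost.coeff_zero]
  simp

theorem coeff_constProfile_ne (m : ℝ) {k : ℤ} (hk : k ≠ 0) : coeff (constProfile m) k = 0 := by
  rw [coeff_congr_ae (constProfile_coe m), coeff_const_ne hk]

/-- The Cauchy–Schwarz inequality behind the lower bound, for one mode; it is an equality if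
`h = ε a`. -/
theorem two_mul_re_conj_mul_le {ε l : ℝ} (hε : 0 < ε) (hl : 0 ≤ l) (a h : ℂ) :
    2 * (l * (conj a * h).re) - ε * (l * ‖a‖ ^ 2) ≤ ε⁻¹ * (l * ‖h‖ ^ 2) := by
  have h1 : (conj a * h).re ≤ ‖a‖ * ‖h‖ := by
    refine (Complex.re_le_norm _).trans_eq ?_
    rw [norm_mul, RCLike.norm_conj]
  have h2 : 2 * (‖a‖ * ‖h‖) ≤ ε * ‖a‖ ^ 2 + ε⁻¹ * ‖h‖ ^ 2 := by
    have h3 : 0 ≤ ε⁻¹ * (ε * ‖a‖ - ‖h‖) ^ 2 := by positivity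
    have h4 : ε⁻¹ * (ε * ‖a‖ - ‖h‖) ^ 2 = ε * ‖a‖ ^ 2 + ε⁻¹ * ‖h‖ ^ 2 - 2 * (‖a‖ * ‖h‖) := by
      field_simp; ring
    linarith
  nlinarith [mul_le_mul_of_nonneg_left (h1.trans (by linarith : ‖a‖ * ‖h‖ ≤
    (ε * ‖a‖ ^ 2 + ε⁻¹ * ‖h‖ ^ 2) / 2)) hl]

/-- Every path of finite cost conserves the mean, and its cost bounds the square of the distance
travelled in `L₂`. -/
theorem le_of_path {p : ℝ≥0∞} (hp : 1 ≤ p) {s : ℝ} (hs : 1 / 2 < s) {f : ℝ → ℝ} {K : NNReal}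
    (hf : LipschitzWith K f) {B : ℝ} (hB : ∀ v, |f v| ≤ B) {ε : ℝ} (hε : 0 < ε) {m : ℝ} {w : L2T}
    {T : ℝ} (hT : 0 < T) (u : PathX p T) (h0 : u.AtTime 0 (constProfile m)) (hw : u.AtTime T w)
    (hu : spaceHSq s T u.density < ⊤) (huc : u.IsContL2) (h : Lp ℝ 2 (spaceTime T))
    (hh : spaceHSq s T h < ⊤)
    (H : ∀ φ, IsTest T φ → eqnDefect ε s f T u.density φ
      = ∫ q, h q * fracLap s (φ q.1) q.2 ∂spaceTime T) :
    coeff w 0 = m ∧ ‖w - constProfile m‖ ^ 2 ≤ ε⁻¹ * (spaceHSq s T h).toReal := by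
  have hs0 : 0 < s := by linarith
  set D : ℝ × UnitAddCircle → ℝ := ⇑u.density with hD
  have hDi : Integrable D (spaceTime T) := (Lp.memLp u.density).integrable hp
  have hfD : Integrable (fun q => f (D q)) (spaceTime T) :=
    memLp_one_iff_integrable.1 (memLp_comp hf (memLp_one_iff_integrable.2 hDi))
  have hhi : Integrable h (spaceTime T) := (Lp.memLp h).integrable (by norm_num)
  have h0m : (0 : ℝ) ∈ Icc 0 T := ⟨le_rfl, hT.le⟩
  have hTm : T ∈ Icc 0 T := ⟨hT.le, le_rfl⟩
  set α : ℤ → ℝ → ℂ := fun k t => (u.curve (projIcc 0 T hT.le t)).hat k with hα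
  set β : ℤ → ℝ → ℂ := fun k t => coeff (fun x => D (t, x)) k with hβ
  set q : ℤ → ℝ → ℂ := fun k t => coeff (fun x => f (D (t, x))) k with hq
  set η : ℤ → ℝ → ℂ := fun k t => coeff (fun x => h (t, x)) k with hη
  have hαc : ∀ k, Continuous (α k) := fun k =>
    (HMinusOne.continuous_hat k).comp (u.curve.continuous.comp continuous_projIcc)
  have hcompat : ∀ᵐ t ∂timeMeasure T, ∃ ht : t ∈ Icc 0 T,
      (u.curve ⟨t, ht⟩).IsFun fun x => D (t, x) := by
    rw [ae_restrict_iff' measurableSet_Icc]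
    filter_upwards [u.compat] with t ht hm
    exact ⟨hm, ht hm⟩
  have hαβ : ∀ᵐ t ∂timeMeasure T, ∀ k, α k t = β k t := by
    filter_upwards [hcompat] with t ⟨ht, hfun⟩ k
    simp only [hα, hβ, projIcc_of_mem hT.le ht]
    exact hfun.2 k
  have hslice : ∀ᵐ t ∂timeMeasure T, MemLp (fun x => D (t, x)) 2 := by
    obtain ⟨v, hv⟩ := huc
    filter_upwards [hcompat] with t ⟨ht, hfun⟩
    exact (memLp_congr_ae (hfun.ae_eq (hv ⟨t, ht⟩))).2 (L2T_memLp _)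
  have hα0 : ∀ k, α k 0 = coeff (constProfile m) k := fun k => by
    obtain ⟨ht, hfun⟩ := h0
    simp only [hα, projIcc_of_mem hT.le ht]
    exact hfun.2 k
  have hαT : ∀ k, α k T = coeff w k := fun k => by
    obtain ⟨ht, hfun⟩ := hw
    simp only [hα, projIcc_of_mem hT.le ht]
    exact hfun.2 k
  set γ : ℤ → ℝ → ℂ := fun k t => lam s k * η k t - 2 * Real.pi * Complex.I * k * q k t
    - ε / 2 * lam s k * β k t with hγ
  have hγi : ∀ k, IntegrableOn (γ k) (Icc 0 T) := fun k =>
    (((integrable_coeff_slice hhi k).const_mul _).sub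
      ((integrable_coeff_slice hfD k).const_mul _)).sub ((integrable_coeff_slice hDi k).const_mul _)
  have hen := fun k => energy_of_weak_deriv hT (hαc k).continuousOn (hγi k)
    fun χ a b hχ ha hb hsupp => by
      rw [← weak_mode_equation hDi hfD hhi H k hχ ha hb hsupp]
      congr 1
      refine integral_congr_ae ?_
      filter_upwards [hαβ] with t ht
      rw [ht k]
  -- the mode `k = 0` has derivative zero
  have hmean : coeff w 0 = m := by
    rw [← hαT, (hen 0).2, hα0, coeff_constProfile_zero]
    intro t _
    simp [hγ, lam_zero hs0]
  refine ⟨hmean, ?_⟩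
  -- an exponent in `]1/2, 1[` to which the Gagliardo form applies
  set σ := min s (3 / 4) with hσ
  have hσ2 : 1 / 2 < σ := lt_min hs (by norm_num)
  have hσ0 : 0 < σ := by linarith
  have hσ1 : σ < 1 := (min_le_right _ _).trans_lt (by norm_num)
  have hDσ : spaceHSq σ T D < ⊤ := (spaceHSq_mono hσ0 (min_le_left _ _) T D).trans_lt hu
  have hfDσ : spaceHSq σ T (fun q => f (D q)) < ⊤ := by
    have h1 : spaceHSq σ T (fun q => f (D q)) ≤ (K : ℝ≥0∞) ^ 2 * spaceHSq σ T D := by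
      unfold spaceHSq
      rw [← lintegral_const_mul' _ _ (by simp)]
      refine lintegral_mono_ae ?_
      filter_upwards [hslice] with t ht
      exact hDotSq_comp_le hσ0 hσ1 hf ht
    exact h1.trans_lt (ENNReal.mul_lt_top (by simp) hDσ)
  -- twice the work of the nonlinearity on the mode `k`: its sum over `k` is zero for almost
  -- every time, and converges absolutely in `L₁` of time, by the bound in `Ḣ_σ` with `σ ≥ 1/2`
  set N : ℤ → ℝ → ℝ := fun k t => 2 * (conj (β k t) * (2 * Real.pi * Complex.I * k * q k t)).re
    with hN
  have hNb : ∀ k t, ‖N k t‖ ≤ lam σ k * ‖β k t‖ ^ 2 + lam σ k * ‖q k t‖ ^ 2 := fun k t => by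
    have h1 : ‖N k t‖ ≤ 2 * (2 * Real.pi * |(k : ℝ)| * (‖β k t‖ * ‖q k t‖)) := by
      simp only [hN]
      rw [norm_mul, Real.norm_of_nonneg (show (0 : ℝ) ≤ 2 by norm_num)]
      refine mul_le_mul_of_nonneg_left ((Complex.abs_re_le_norm _).trans (le_of_eq ?_)) (by norm_num)
      simp only [norm_mul, RCLike.norm_conj, Complex.norm_I, Complex.norm_real,
        Complex.norm_intCast, RCLike.norm_ofNat, Real.norm_of_nonneg Real.pi_pos.le]
      ring
    refine h1.trans ?_
    have h2 := two_pi_abs_le_lam hσ2.le k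
    have h3 : 2 * (2 * Real.pi * |(k : ℝ)| * (‖β k t‖ * ‖q k t‖))
        ≤ 2 * (lam σ k * (‖β k t‖ * ‖q k t‖)) := by gcongr
    nlinarith [mul_nonneg (lam_nonneg σ k) (sq_nonneg (‖β k t‖ - ‖q k t‖))]
  have iβ := fun k => integrable_mode_of_spaceHSq_lt_top hDi hDσ k
  have iq := fun k => integrable_mode_of_spaceHSq_lt_top hfD hfDσ k
  have iN : ∀ k, Integrable (N k) (timeMeasure T) := fun k => by
    refine ((iβ k).add (iq k)).mono' ?_ (ae_of_all _ fun t => hNb k t)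
    refine (Complex.continuous_re.comp_aestronglyMeasurable ?_).const_mul 2
    exact (Complex.continuous_conj.comp_aestronglyMeasurable
      (integrable_coeff_slice hDi k).aestronglyMeasurable).mul
      ((integrable_coeff_slice hfD k).aestronglyMeasurable.const_mul _)
  have sN : Summable fun k => ∫ t in Icc 0 T, ‖N k t‖ := by
    refine Summable.of_nonneg_of_le (fun k => integral_nonneg fun t => norm_nonneg _) (fun k => ?_)
      ((hasSum_integral_mode hDi hDσ).summable.add (hasSum_integral_mode hfD hfDσ).summable)
    rw [← integral_add (iβ k) (iq k)]
    exact integral_mono (iN k).norm ((iβ k).add (iq k)) (hNb k)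
  have hN0 : HasSum (fun k => ∫ t in Icc 0 T, N k t) 0 := by
    have h1 := hasSum_integral_of_summable_integral_norm iN sN
    rwa [integral_eq_zero_of_ae] at h1
    filter_upwards [hslice, ae_hDotSq_lt_top hDi hDσ,
      ae_hDotSq_lt_top hfD hfDσ] with t h2 h3 h4
    have s3 := (hasSum_of_hDotSq_lt_top h3).summable
    have s4 := (hasSum_of_hDotSq_lt_top h4).summable
    have h5 := hasSum_comp_mul_deriv_eq_zero hf hB h2 ?_ ?_
    · have h6 := (h5.mul_left (-2)).tsum_eq
      rw [mul_zero] at h6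
      rw [Pi.zero_apply, ← h6]
      refine tsum_congr fun k => ?_
      simp only [hN, hβ, hq]
      rw [← Complex.conj_re (conj (coeff (fun x => f (D (t, x))) k) * _), neg_mul, ← mul_neg,
        ← Complex.neg_re]
      congr 2
      simp only [map_mul, Complex.conj_conj, Complex.conj_I, Complex.conj_ofReal, map_ofNat,
        map_intCast]
      ring
    · refine Summable.of_nonneg_of_le (fun k => by positivity) (fun k => ?_) s3
      gcongr
      exact two_pi_abs_le_lam hσ2.le k
    · refine Summable.of_nonneg_of_le (fun k => by positivity) (fun k => ?_) (s3.add s4)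
      have h7 := two_pi_abs_le_lam hσ2.le k
      have h8 : (2 * Real.pi * |(k : ℝ)|) *
          (‖coeff (fun x => f (D (t, x))) k‖ * ‖coeff (fun x => D (t, x)) k‖)
          ≤ lam σ k * (‖coeff (fun x => f (D (t, x))) k‖ * ‖coeff (fun x => D (t, x)) k‖) := by
        gcongr
      nlinarith [mul_nonneg (lam_nonneg σ k) (sq_nonneg (‖coeff (fun x => f (D (t, x))) k‖
        - ‖coeff (fun x => D (t, x)) k‖)), mul_nonneg (lam_nonneg σ k) (mul_nonneg
          (norm_nonneg (coeff (fun x => f (D (t, x))) k)) (norm_nonneg (coeff (fun x => D (t, x)) k)))]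
  have iη := fun k => integrable_mode_of_spaceHSq_lt_top hhi hh k
  have iβs := fun k => integrable_mode_of_spaceHSq_lt_top hDi hu k
  have hmode : ∀ k, ‖coeff (w - constProfile m : L2T) k‖ ^ 2
      ≤ ε⁻¹ * (∫ t in Icc 0 T, lam s k * ‖η k t‖ ^ 2) - ∫ t in Icc 0 T, N k t := by
    intro k
    have e1 : ‖coeff (w - constProfile m : L2T) k‖ ^ 2 = ‖α k T‖ ^ 2 - ‖α k 0‖ ^ 2 := by
      rw [L2T_coeff_sub, hαT, hα0]
      rcases eq_or_ne k 0 with rfl | hk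
      · rw [hmean, coeff_constProfile_zero]; simp
      · rw [coeff_constProfile_ne m hk]; simp
    rw [e1, (hen k).1, ← integral_const_mul, ← integral_sub ((iη k).const_mul _) (iN k)]
    refine integral_mono_ae ?_ (((iη k).const_mul _).sub (iN k)) ?_
    · have h1 : IntegrableOn (fun t => conj (α k t) * γ k t) (Icc 0 T) :=
        (hγi k).continuousOn_mul (Complex.continuous_conj.comp (hαc k)).continuousOn isCompact_Icc
      exact h1.re.const_mul 2
    · filter_upwards [hαβ] with t ht
      rw [ht k]
      have h1 := two_mul_re_conj_mul_le hε (lam_nonneg s k) (β k t) (η k t)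
      have h2 : 2 * (conj (β k t) * γ k t).re = 2 * (lam s k * (conj (β k t) * η k t).re)
          - ε * (lam s k * ‖β k t‖ ^ 2) - N k t := by
        have h3 : conj (β k t) * γ k t = ((lam s k : ℝ) : ℂ) * (conj (β k t) * η k t)
            - conj (β k t) * (2 * Real.pi * Complex.I * k * q k t)
            - ((ε / 2 * lam s k * ‖β k t‖ ^ 2 : ℝ) : ℂ) := by
          have h4 : ((‖β k t‖ ^ 2 : ℝ) : ℂ) = conj (β k t) * β k t := by
            rw [Complex.conj_mul']; push_cast; rfl
          simp only [hγ]
          rw [Complex.ofReal_mul, h4]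
          push_cast
          ring
        rw [h3, Complex.sub_re, Complex.sub_re, Complex.re_ofReal_mul, Complex.ofReal_re]
        simp only [hN]
        ring
      linarith
  have hfin := ((hasSum_integral_mode hhi hh).mul_left ε⁻¹).sub hN0
  rw [sub_zero] at hfin
  exact hasSum_le hmode (L2T_parseval _) hfin

/-! ### Fourier series of test functions -/

theorem isOpenQuotientMap_prod_circle :
    IsOpenQuotientMap (Prod.map id (fun y : ℝ => (y : UnitAddCircle)) : ℝ × ℝ → ℝ × UnitAddCircle) :=
  IsOpenQuotientMap.prodMap .id QuotientAddGroup.isOpenQuotientMap_mk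

namespace IsTest

variable {T : ℝ} {φ : ℝ → UnitAddCircle → ℝ}

theorem continuous (hφ : IsTest T φ) : Continuous fun q : ℝ × UnitAddCircle => φ q.1 q.2 :=
  isOpenQuotientMap_prod_circle.isQuotientMap.continuous_iff.2 hφ.smooth.continuous

theorem bounded (hφ : IsTest T φ) : ∃ C, 0 ≤ C ∧ ∀ t x, ‖φ t x‖ ≤ C := by
  obtain ⟨a, b, _, _, hab⟩ := hφ.compact
  obtain ⟨C, hC⟩ := (isCompact_Icc (a := a) (b := b)).prod (isCompact_univ (X := UnitAddCircle))
    |>.exists_bound_of_continuousOn hφ.continuous.continuousOn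
  refine ⟨max C 0, le_max_right _ _, fun t x => ?_⟩
  by_cases h : φ t x = 0
  · rw [h, norm_zero]; exact le_max_right _ _
  · exact (hC (t, x) ⟨hab t x h, mem_univ _⟩).trans (le_max_left _ _)

theorem continuous_slice (hφ : IsTest T φ) (t : ℝ) : Continuous (φ t) :=
  hφ.continuous.comp (Continuous.prodMk_right t)

theorem hasDerivAt_space (hφ : IsTest T φ) (t y : ℝ) :
    HasDerivAt (fun y : ℝ => φ t (y : UnitAddCircle))
      (fderiv ℝ (fun q : ℝ × ℝ => φ q.1 (q.2 : UnitAddCircle)) (t, y) (0, 1)) y := by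
  have h1 := (hφ.smooth.differentiable (by simp) (t, y)).hasFDerivAt
  exact h1.comp_hasDerivAt y ((hasDerivAt_const y t).prodMk (hasDerivAt_id y))

theorem hasDerivAt_time' (hφ : IsTest T φ) (t y : ℝ) :
    HasDerivAt (fun t : ℝ => φ t (y : UnitAddCircle))
      (fderiv ℝ (fun q : ℝ × ℝ => φ q.1 (q.2 : UnitAddCircle)) (t, y) (1, 0)) t := by
  have h1 := (hφ.smooth.differentiable (by simp) (t, y)).hasFDerivAt
  exact h1.comp_hasDerivAt t ((hasDerivAt_id t).prodMk (hasDerivAt_const t y))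

theorem dX_coe (hφ : IsTest T φ) (t y : ℝ) :
    dX (φ t) (y : UnitAddCircle)
      = fderiv ℝ (fun q : ℝ × ℝ => φ q.1 (q.2 : UnitAddCircle)) (t, y) (0, 1) := by
  have h1 := hφ.hasDerivAt_space t y
  have h2 : HasDerivAt (fun z : ℝ => φ t ((y + z : ℝ) : UnitAddCircle))
      (fderiv ℝ (fun q : ℝ × ℝ => φ q.1 (q.2 : UnitAddCircle)) (t, y) (0, 1)) 0 := by
    have h3 := HasDerivAt.comp_const_add y 0 (by rwa [add_zero])
    exact h3
  exact h2.deriv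

theorem dX (hφ : IsTest T φ) : IsTest T fun t => FracCost.dX (φ t) := by
  refine ⟨?_, ?_⟩
  · simp_rw [hφ.dX_coe]
    exact (hφ.smooth.fderiv_right (m := ((⊤ : ℕ∞) : WithTop ℕ∞)) (by simp)).clm_apply contDiff_const
  · obtain ⟨a, b, ha, hb, hab⟩ := hφ.compact
    refine ⟨a, b, ha, hb, fun t x h => ?_⟩
    by_contra ht
    have h0 : ∀ x, φ t x = 0 := fun x => not_not.1 fun hx => ht (hab t x hx)
    exact h (by simp [FracCost.dX, h0])

theorem hasDerivAt_time (hφ : IsTest T φ) (t : ℝ) (x : UnitAddCircle) :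
    HasDerivAt (fun t => φ t x) (deriv (fun t => φ t x) t) t := by
  induction x using QuotientAddGroup.induction_on with
  | H y => exact (hφ.hasDerivAt_time' t y).differentiableAt.hasDerivAt

theorem dT (hφ : IsTest T φ) : IsTest T fun t x => deriv (fun t => φ t x) t := by
  refine ⟨?_, ?_⟩
  · simp_rw [fun q : ℝ × ℝ => (hφ.hasDerivAt_time' q.1 q.2).deriv]
    exact (hφ.smooth.fderiv_right (m := ((⊤ : ℕ∞) : WithTop ℕ∞)) (by simp)).clm_apply contDiff_const
  · obtain ⟨a, b, ha, hb, hab⟩ := hφ.compact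
    refine ⟨a, b, ha, hb, fun t x h => ?_⟩
    by_contra ht
    refine h ?_
    have h0 : (fun t => φ t x) =ᶠ[𝓝 t] fun _ => 0 := by
      filter_upwards [isClosed_Icc.isOpen_compl.mem_nhds ht] with r hr
      exact not_not.1 fun hx => hr (hab r x hx)
    rw [h0.deriv_eq, deriv_const]

theorem coeff_dX (hφ : IsTest T φ) (t : ℝ) (k : ℤ) :
    coeff (FracCost.dX (φ t)) k = 2 * Real.pi * Complex.I * k * coeff (φ t) k := by
  have hc1 : Continuous fun y : ℝ => FracCost.dX (φ t) (y : UnitAddCircle) :=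
    (hφ.dX.continuous_slice t).comp (AddCircle.continuous_mk' 1)
  have hd1 : ∀ y : ℝ, HasDerivAt (fun y : ℝ => ((φ t (y : UnitAddCircle) : ℝ) : ℂ))
      ((FracCost.dX (φ t) (y : UnitAddCircle) : ℝ) : ℂ) y := fun y => by
    rw [hφ.dX_coe]; exact (hφ.hasDerivAt_space t y).ofReal_comp
  have hd2 : ∀ y : ℝ, HasDerivAt (fun y : ℝ => fourier (-k) (y : UnitAddCircle))
      (-2 * Real.pi * Complex.I * k / (1 : ℝ) * fourier (-k) (y : UnitAddCircle)) y := fun y =>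
    hasDerivAt_fourier_neg 1 k y
  have hp : ((0 + 1 : ℝ) : UnitAddCircle) = ((0 : ℝ) : UnitAddCircle) := by
    rw [zero_add]
    exact (AddCircle.coe_period (1 : ℝ)).trans (AddCircle.coe_zero 1).symm
  have hcf : Continuous fun y : ℝ => fourier (-k) (y : UnitAddCircle) :=
    (map_continuous (fourier (-k))).comp (AddCircle.continuous_mk' 1)
  have h := intervalIntegral.integral_mul_deriv_eq_deriv_mul (a := 0) (b := 0 + 1)
    (fun y _ => hd2 y) (fun y _ => hd1 y)
    ((continuous_const.mul hcf).intervalIntegrable _ _)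
    ((Complex.continuous_ofReal.comp hc1).intervalIntegrable _ _)
  rw [hp, sub_self, zero_sub] at h
  rw [coeff, coeff, fourierCoeff_eq_intervalIntegral _ _ 0, fourierCoeff_eq_intervalIntegral _ _ 0]
  simp only [smul_eq_mul]
  rw [h, ← intervalIntegral.integral_neg]
  simp only [one_div, inv_one, one_smul]
  rw [← intervalIntegral.integral_const_mul]
  refine intervalIntegral.integral_congr fun y _ => ?_
  simp only [Complex.ofReal_one, div_one]
  ring

theorem coeff_bound (hφ : IsTest T φ) : ∃ C, 0 ≤ C ∧ ∀ t k, ‖coeff (φ t) k‖ ≤ C := by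
  obtain ⟨C, hC0, hC⟩ := hφ.bounded
  refine ⟨C, hC0, fun t k => (norm_coeff_le _ _).trans ?_⟩
  refine (integral_mono_of_nonneg (ae_of_all _ fun _ => norm_nonneg _) (integrable_const C)
    (ae_of_all _ fun x => hC t x)).trans_eq ?_
  simp

theorem coeff_decay (n : ℕ) : ∀ {φ : ℝ → UnitAddCircle → ℝ}, IsTest T φ →
    ∃ C, 0 ≤ C ∧ ∀ (t : ℝ) (k : ℤ), (2 * Real.pi * |(k : ℝ)|) ^ n * ‖coeff (φ t) k‖ ≤ C := by
  induction n with
  | zero =>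
    intro φ hφ
    simpa using hφ.coeff_bound
  | succ n ih =>
    intro φ hφ
    obtain ⟨C, hC0, hC⟩ := ih hφ.dX
    refine ⟨C, hC0, fun t k => (le_of_eq ?_).trans (hC t k)⟩
    rw [hφ.coeff_dX]
    simp only [norm_mul, Complex.norm_I, Complex.norm_real,
        Complex.norm_intCast, RCLike.norm_ofNat, Real.norm_of_nonneg Real.pi_pos.le]
    ring

theorem summable_bound (hφ : IsTest T φ) (s : ℝ) :
    ∃ b : ℤ → ℝ, Summable b ∧ ∀ t k, (1 + lam s k) * ‖coeff (φ t) k‖ ≤ b k := by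
  obtain ⟨n, hn⟩ := exists_nat_ge (max (2 * s + 2) 2)
  obtain ⟨C, hC0, hC⟩ := coeff_decay n hφ
  obtain ⟨C', hC0', hC'⟩ := hφ.coeff_bound
  refine ⟨fun k => (if k = 0 then (1 + lam s 0) * C' else 0) + 2 * C * (1 / (k : ℝ) ^ 2), ?_, ?_⟩
  · exact (hasSum_ite_eq 0 _).summable.add
      ((Real.summable_one_div_int_pow.2 one_lt_two).mul_left _)
  · intro t k
    rcases eq_or_ne k 0 with rfl | hk
    · have := mul_le_mul_of_nonneg_left (hC' t 0) (show 0 ≤ 1 + lam s 0 by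
        linarith [lam_nonneg s 0])
      simpa using this
    · simp only [if_neg hk, zero_add]
      have h1 := one_le_two_pi_mul_abs hk
      set x := 2 * Real.pi * |(k : ℝ)| with hx
      have hx0 : 0 < x := by linarith
      have h2 : x ^ 2 ≤ x ^ n := by
        refine pow_le_pow_right₀ h1 ?_
        exact_mod_cast (le_max_right _ _).trans hn
      have h3 : lam s k * x ^ 2 ≤ x ^ n := by
        rw [lam, ← hx, ← Real.rpow_natCast x 2, ← Real.rpow_add hx0, ← Real.rpow_natCast x n]
        exact Real.rpow_le_rpow_of_exponent_le h1 (by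
          push_cast; exact (le_max_left _ _).trans hn)
      have hk2 : (0 : ℝ) < (k : ℝ) ^ 2 := by
        have : (k : ℝ) ≠ 0 := by exact_mod_cast hk
        positivity
      have h4 : (k : ℝ) ^ 2 ≤ x ^ 2 := by
        rw [hx, mul_pow, sq_abs]
        have : (1 : ℝ) ≤ (2 * Real.pi) ^ 2 := by nlinarith [Real.pi_gt_three]
        nlinarith
      rw [mul_one_div, le_div_iff₀ hk2]
      have hl := lam_nonneg s k
      calc (1 + lam s k) * ‖coeff (φ t) k‖ * (k : ℝ) ^ 2
          ≤ (1 + lam s k) * ‖coeff (φ t) k‖ * x ^ 2 := by gcongr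
        _ = (x ^ 2 + lam s k * x ^ 2) * ‖coeff (φ t) k‖ := by ring
        _ ≤ (x ^ n + x ^ n) * ‖coeff (φ t) k‖ := by gcongr
        _ = 2 * (x ^ n * ‖coeff (φ t) k‖) := by ring
        _ ≤ 2 * C := by gcongr; exact hC t k

theorem hasDerivAt_coeff (hφ : IsTest T φ) (k : ℤ) (t : ℝ) :
    HasDerivAt (fun t => coeff (φ t) k) (coeff (fun x => deriv (fun t => φ t x) t) k) t := by
  obtain ⟨C, hC0, hC⟩ := hφ.dT.bounded
  have hcf := map_continuous (fourier (T := (1 : ℝ)) (-k))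
  have hcont : ∀ {ψ : ℝ → UnitAddCircle → ℝ}, IsTest T ψ → ∀ r, Continuous fun x : UnitAddCircle =>
      fourier (-k) x * ((ψ r x : ℝ) : ℂ) := fun hψ r =>
    hcf.mul (Complex.continuous_ofReal.comp (hψ.continuous_slice r))
  simp only [coeff_eq]
  refine (hasDerivAt_integral_of_dominated_loc_of_deriv_le (μ := volume)
    (F := fun r x => fourier (-k) x * ((φ r x : ℝ) : ℂ))
    (F' := fun r x => fourier (-k) x * ((deriv (fun t => φ t x) r : ℝ) : ℂ))
    (bound := fun _ => C) (s := univ) univ_mem ?_ ?_ ?_ ?_ (integrable_const C) ?_).2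
  · exact Eventually.of_forall fun r => (hcont hφ r).aestronglyMeasurable
  · exact (hcont hφ t).integrable_of_hasCompactSupport (HasCompactSupport.of_compactSpace _)
  · exact (hcont hφ.dT t).aestronglyMeasurable
  · refine ae_of_all _ fun x r _ => ?_
    rw [norm_mul, norm_fourier_apply, one_mul, Complex.norm_real]
    exact hC r x
  · exact ae_of_all _ fun x r _ => ((hφ.hasDerivAt_time r x).ofReal_comp).const_mul _

theorem continuous_coeff (hφ : IsTest T φ) (k : ℤ) : Continuous fun t => coeff (φ t) k :=
  continuous_iff_continuousAt.2 fun t => (hφ.hasDerivAt_coeff k t).continuousAt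

theorem hasSum_fourier (hφ : IsTest T φ) (t : ℝ) (x : UnitAddCircle) :
    HasSum (fun k => (coeff (φ t) k * fourier k x).re) (φ t x) := by
  obtain ⟨b, hb, hbound⟩ := hφ.summable_bound 1
  let F : C(UnitAddCircle, ℂ) := ⟨fun x => ((φ t x : ℝ) : ℂ),
    Complex.continuous_ofReal.comp (hφ.continuous_slice t)⟩
  have hs : Summable (fourierCoeff F) := by
    refine hb.of_norm_bounded fun k => le_trans ?_ (hbound t k)
    have : ‖fourierCoeff F k‖ = ‖coeff (φ t) k‖ := rfl
    rw [this]
    nlinarith [mul_nonneg (lam_nonneg 1 k) (norm_nonneg (coeff (φ t) k))]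
  have h := has_pointwise_sum_fourier_series_of_summable hs x
  have h2 := Complex.hasSum_re h
  exact h2

/-- Pairing an integrable function with a test function, frequency by frequency. -/
theorem hasSum_integral_mul (hφ : IsTest T φ) {g : ℝ × UnitAddCircle → ℝ}
    (hg : Integrable g (spaceTime T)) :
    HasSum (fun k => (∫ t in Icc 0 T, coeff (φ t) k * conj (coeff (fun x => g (t, x)) k)).re)
      (∫ q, g q * φ q.1 q.2 ∂spaceTime T) := by
  obtain ⟨b, hb, hbound⟩ := hφ.summable_bound 1
  refine hasSum_integral_mul_re hg (fun k => (hφ.continuous_coeff k).aestronglyMeasurable) hb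
    (fun k t => le_trans ?_ (hbound t k)) fun q => hφ.hasSum_fourier q.1 q.2
  nlinarith [mul_nonneg (lam_nonneg 1 k) (norm_nonneg (coeff (φ t) k))]

theorem hasSum_integral_mul_fracLap (hφ : IsTest T φ) (s : ℝ) {g : ℝ × UnitAddCircle → ℝ}
    (hg : Integrable g (spaceTime T)) :
    HasSum (fun k => (∫ t in Icc 0 T, (lam s k * coeff (φ t) k)
        * conj (coeff (fun x => g (t, x)) k)).re)
      (∫ q, g q * fracLap s (φ q.1) q.2 ∂spaceTime T) := by
  obtain ⟨b, hb, hbound⟩ := hφ.summable_bound s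
  have hle : ∀ k t, ‖(lam s k : ℂ) * coeff (φ t) k‖ ≤ b k := fun k t => by
    refine le_trans ?_ (hbound t k)
    rw [norm_mul, Complex.norm_real, Real.norm_of_nonneg (lam_nonneg s k)]
    nlinarith [norm_nonneg (coeff (φ t) k)]
  refine hasSum_integral_mul_re hg
    (fun k => (continuous_const.mul (hφ.continuous_coeff k)).aestronglyMeasurable) hb hle fun q => ?_
  have hs : Summable fun k : ℤ => (lam s k : ℂ) * coeff (φ q.1) k * fourier k q.2 := by
    refine hb.of_norm_bounded fun k => ?_
    rw [norm_mul, norm_fourier_apply, mul_one]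
    exact hle k q.1
  exact Complex.hasSum_re hs.hasSum

end IsTest

/-- If the equation `α' + 2πik f(u)^ + (ε/2) λ α = λ ĥ` holds for every Fourier mode `α` of `u`,
then `∂_t u + ∂ₓ f(u) + (ε/2)(-∂ₓₓ)^s u = (-∂ₓₓ)^s h` in the sense of distributions. -/
theorem eqnDefect_eq_of_modes {T ε s : ℝ} (hT : 0 < T) {f : ℝ → ℝ} {u h : ℝ × UnitAddCircle → ℝ}
    (hu : Integrable u (spaceTime T)) (hfu : Integrable (fun q => f (u q)) (spaceTime T))
    (hh : Integrable h (spaceTime T)) {α α' : ℤ → ℝ → ℂ}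
    (hα : ∀ k, ∀ t ∈ Icc 0 T, HasDerivAt (α k) (α' k t) t)
    (hα' : ∀ k, IntegrableOn (α' k) (Icc 0 T))
    (hαu : ∀ᵐ t ∂timeMeasure T, ∀ k, coeff (fun x => u (t, x)) k = α k t)
    (hmode : ∀ᵐ t ∂timeMeasure T, ∀ k, α' k t
      + 2 * Real.pi * Complex.I * k * coeff (fun x => f (u (t, x))) k + ε / 2 * lam s k * α k t
      = lam s k * coeff (fun x => h (t, x)) k)
    {φ : ℝ → UnitAddCircle → ℝ} (hφ : IsTest T φ) :
    eqnDefect ε s f T u φ = ∫ q, h q * fracLap s (φ q.1) q.2 ∂spaceTime T := by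
  have h1 := hφ.dT.hasSum_integral_mul hu
  have h2 := hφ.dX.hasSum_integral_mul hfu
  have h3 := hφ.hasSum_integral_mul_fracLap s hu
  have h4 := hφ.hasSum_integral_mul_fracLap s hh
  have h5 := (h1.neg.sub h2).add (h3.mul_left (ε / 2))
  refine (h5.unique ?_ : _)
  convert! h4 using 1
  funext k
  set c : ℝ → ℂ := fun t => coeff (φ t) k with hc
  have hcc : Continuous c := hφ.continuous_coeff k
  obtain ⟨C, _, hC⟩ := hφ.coeff_bound
  have hint : ∀ {g : ℝ × UnitAddCircle → ℝ}, Integrable g (spaceTime T) →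
      Integrable (fun t => c t * conj (coeff (fun x => g (t, x)) k)) (timeMeasure T) := fun hg =>
    (Complex.conjCLE.toContinuousLinearMap.integrable_comp (integrable_coeff_slice hg k)).bdd_mul
      (c := C) hcc.aestronglyMeasurable (ae_of_all _ fun t => hC t k)
  have hαc : ContinuousOn (α k) (Icc 0 T) := fun t ht => (hα k t ht).continuousAt.continuousWithinAt
  have hconjα : ∀ t ∈ uIcc 0 T, HasDerivAt (fun t => conj (α k t)) (conj (α' k t)) t := fun t ht => by
    rw [uIcc_of_le hT.le] at ht
    exact Complex.conjCLE.toContinuousLinearMap.hasFDerivAt.comp_hasDerivAt t (hα k t ht)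
  have hconji : IntegrableOn (fun t => conj (α' k t)) (Icc 0 T) :=
    Complex.conjCLE.toContinuousLinearMap.integrable_comp (hα' k)
  -- integration by parts in time
  have hibp : ∫ t in Icc 0 T, coeff (fun x => deriv (fun t => φ t x) t) k
        * conj (coeff (fun x => u (t, x)) k)
      = - ∫ t in Icc 0 T, c t * conj (α' k t) := by
    have e1 : ∫ t in Icc 0 T, coeff (fun x => deriv (fun t => φ t x) t) k
        * conj (coeff (fun x => u (t, x)) k)
        = ∫ t in Icc 0 T, coeff (fun x => deriv (fun t => φ t x) t) k * conj (α k t) := by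
      refine integral_congr_ae ?_
      filter_upwards [hαu] with t ht
      rw [ht k]
    have e2 := intervalIntegral.integral_mul_deriv_eq_deriv_mul (a := 0) (b := T)
      (fun t _ => hφ.hasDerivAt_coeff k t) hconjα
      ((hφ.dT.continuous_coeff k).intervalIntegrable _ _)
      ((intervalIntegrable_iff_integrableOn_Icc_of_le hT.le).2 hconji)
    obtain ⟨a, b, ha, hb, hab⟩ := hφ.compact
    have hz : ∀ t, t ∉ Icc a b → coeff (φ t) k = 0 := fun t ht => by
      have : φ t = fun _ => 0 := funext fun x => not_not.1 fun hx => ht (hab t x hx)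
      rw [this, coeff_eq]; simp
    rw [hz T fun h => by linarith [h.2], hz 0 fun h => by linarith [h.1], zero_mul, zero_mul,
      sub_zero, zero_sub, intervalIntegral.integral_of_le hT.le,
      intervalIntegral.integral_of_le hT.le, ← integral_Icc_eq_integral_Ioc,
      ← integral_Icc_eq_integral_Ioc] at e2
    rw [e1, e2, neg_neg]
  have hiα : Integrable (fun t => c t * conj (α' k t)) (timeMeasure T) :=
    hconji.continuousOn_mul hcc.continuousOn isCompact_Icc
  rw [hibp]
  simp only [hφ.coeff_dX]
  rw [Complex.neg_re, neg_neg, ← Complex.re_ofReal_mul, ← Complex.sub_re, ← Complex.add_re]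
  congr 1
  have i2 : Integrable (fun t => 2 * Real.pi * Complex.I * k * c t
      * conj (coeff (fun x => f (u (t, x))) k)) (timeMeasure T) := by
    simpa only [mul_assoc] using (hint hfu).const_mul (2 * Real.pi * Complex.I * k)
  have i3 : Integrable (fun t => lam s k * c t
      * conj (coeff (fun x => u (t, x)) k)) (timeMeasure T) := by
    simpa only [mul_assoc] using (hint hu).const_mul (lam s k : ℂ)
  have i12 : Integrable (fun t => c t * conj (α' k t) - 2 * Real.pi * Complex.I * k * c t
      * conj (coeff (fun x => f (u (t, x))) k)) (timeMeasure T) := hiα.sub i2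
  rw [← integral_const_mul, ← integral_sub hiα i2, ← integral_add i12 (i3.const_mul _)]
  refine integral_congr_ae ?_
  filter_upwards [hαu, hmode] with t ht hm
  have h6 := congrArg conj (hm k)
  simp only [map_add, map_mul, Complex.conj_I, Complex.conj_ofReal, map_ofNat, map_intCast,
    map_div₀] at h6
  rw [ht k]
  push_cast
  linear_combination c t * h6

/-! ### The Riesz–Fischer theorem on space-time -/

theorem integral_fourier_mul_conj (j k : ℤ) :
    ∫ x : UnitAddCircle, fourier j x * conj (fourier k x) = if k = j then 1 else 0 := by
  rw [← fourierCoeff_fourier_apply j k, fourierCoeff, volume_circle]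
  refine integral_congr_ae (ae_of_all _ fun x => ?_)
  simp only [fourier_neg, smul_eq_mul]
  ring

section

variable {T : ℝ}

theorem memLp_mode {a : ℝ → ℂ} (ha : MemLp a 2 (timeMeasure T)) (k : ℤ) :
    MemLp (fun q : ℝ × UnitAddCircle => a q.1 * fourier k q.2) 2 (spaceTime T) := by
  have h1 : MemLp (fun q : ℝ × UnitAddCircle => a q.1) 2 (spaceTime T) := ha.comp_fst _
  refine (memLp_congr_norm ?_ h1.aestronglyMeasurable (ae_of_all _ fun q => ?_)).2 h1
  · exact h1.aestronglyMeasurable.mul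
      ((map_continuous (fourier k)).comp continuous_snd).aestronglyMeasurable
  · rw [norm_mul, norm_fourier_apply, mul_one]

theorem inner_mode {a b : ℝ → ℂ} (ha : MemLp a 2 (timeMeasure T)) (hb : MemLp b 2 (timeMeasure T))
    (j k : ℤ) : inner ℂ ((memLp_mode hb k).toLp _) ((memLp_mode ha j).toLp _)
      = if k = j then ∫ t in Icc 0 T, a t * conj (b t) else 0 := by
  rw [L2.inner_def]
  have h1 : ∫ q, inner ℂ ((⇑((memLp_mode hb k).toLp _)) q) ((⇑((memLp_mode ha j).toLp _)) q) ∂spaceTime T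
      = ∫ q : ℝ × UnitAddCircle, (a q.1 * conj (b q.1)) * (fourier j q.2 * conj (fourier k q.2))
        ∂spaceTime T := by
    refine integral_congr_ae ?_
    filter_upwards [(memLp_mode ha j).coeFn_toLp, (memLp_mode hb k).coeFn_toLp] with q h1 h2
    rw [h1, h2, RCLike.inner_apply, map_mul]
    ring
  refine h1.trans ?_
  unfold spaceTime
  rw [integral_prod_mul (fun t => a t * conj (b t))
    (fun x : UnitAddCircle => fourier j x * conj (fourier k x)), integral_fourier_mul_conj]
  split_ifs <;> simp

/-- A sequence of square integrable functions of time, with summable squares of the norms, is the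
sequence of Fourier coefficients of a function in `L₂` of space-time. -/
theorem exists_spaceTime_fourierCoeff {a : ℤ → ℝ → ℂ} (ha : ∀ k, MemLp (a k) 2 (timeMeasure T))
    (hs : Summable fun k => ∫ t in Icc 0 T, ‖a k t‖ ^ 2) :
    ∃ H : Lp ℂ 2 (spaceTime T), ∀ᵐ t ∂timeMeasure T, ∀ k,
      fourierCoeff (fun x => H (t, x)) k = a k t := by
  let v : ℤ → Lp ℂ 2 (spaceTime T) := fun k => (memLp_mode (ha k) k).toLp _
  have hinner : ∀ j k, inner ℂ (v k) (v j)
      = if k = j then ∫ t in Icc 0 T, a j t * conj (a k t) else 0 := fun j k =>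
    inner_mode (ha j) (ha k) j k
  have hnorm : ∀ k, ‖v k‖ ^ 2 = ∫ t in Icc 0 T, ‖a k t‖ ^ 2 := fun k => by
    have h1 : ((‖v k‖ ^ 2 : ℝ) : ℂ) = ((∫ t in Icc 0 T, ‖a k t‖ ^ 2 : ℝ) : ℂ) := by
      rw [← integral_complex_ofReal]
      have h2 := inner_self_eq_norm_sq_to_K (𝕜 := ℂ) (v k)
      rw [hinner, if_pos rfl] at h2
      push_cast
      refine h2.symm.trans ?_
      refine integral_congr_ae (ae_of_all _ fun t => ?_)
      simp only
      rw [Complex.mul_conj']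
    exact_mod_cast h1
  have horth : OrthogonalFamily ℂ (fun k => ↥(Submodule.span ℂ {v k}))
      fun k => (Submodule.span ℂ {v k}).subtypeₗᵢ := by
    intro i j hij x y
    obtain ⟨c, hc⟩ := Submodule.mem_span_singleton.1 x.2
    obtain ⟨d, hd⟩ := Submodule.mem_span_singleton.1 y.2
    change inner ℂ (x : Lp ℂ 2 (spaceTime T)) (y : Lp ℂ 2 (spaceTime T)) = 0
    rw [← hc, ← hd, inner_smul_left, inner_smul_right, hinner, if_neg hij, mul_zero, mul_zero]
  have hsum : Summable v := by
    have := (horth.summable_iff_norm_sq_summable fun k =>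
      ⟨v k, Submodule.mem_span_singleton_self _⟩).2 (by
        simp only [Submodule.coe_norm, hnorm]; exact hs)
    exact this
  refine ⟨∑' k, v k, ?_⟩
  set H := ∑' k, v k with hH
  have hHL : MemLp (H : ℝ × UnitAddCircle → ℂ) 2 (spaceTime T) := Lp.memLp H
  have hHi : Integrable (H : ℝ × UnitAddCircle → ℂ) (spaceTime T) := hHL.integrable (by norm_num)
  have hci : ∀ k, Integrable (fun t => fourierCoeff (fun x => H (t, x)) k) (timeMeasure T) := by
    intro k
    have h := (integrable_fourier_mul hHi measurable_snd (-k)).integral_prod_left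
    refine h.congr (ae_of_all _ fun t => ?_)
    simp only [fourierCoeff, ← volume_circle]
    rfl
  rw [ae_all_iff]
  intro k
  refine Integrable.ae_eq_of_forall_setIntegral_eq _ _ (hci k)
    ((ha k).integrable (by norm_num)) fun A hA _ => ?_
  have hb : MemLp (A.indicator fun _ => (1 : ℂ)) 2 (timeMeasure T) :=
    (memLp_const 1).indicator hA
  have h1 : HasSum (fun j => inner ℂ ((memLp_mode hb k).toLp _) (v j))
      (inner ℂ ((memLp_mode hb k).toLp _) H) :=
    (innerSL ℂ ((memLp_mode hb k).toLp _)).hasSum hsum.hasSum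
  have h2 : ∀ j, inner ℂ ((memLp_mode hb k).toLp _) (v j)
      = if j = k then ∫ t in A, a k t ∂timeMeasure T else 0 := fun j => by
    rw [inner_mode (ha j) hb j k]
    rcases eq_or_ne j k with rfl | hjk
    · rw [if_pos rfl, if_pos rfl, ← integral_indicator hA]
      refine integral_congr_ae (ae_of_all _ fun t => ?_)
      by_cases ht : t ∈ A <;> simp [ht]
    · rw [if_neg hjk, if_neg (Ne.symm hjk)]
  simp_rw [h2] at h1
  have h3 := h1.unique (hasSum_ite_eq k _)
  rw [← h3, L2.inner_def]
  have hfi : Integrable (fun q : ℝ × UnitAddCircle =>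
      A.indicator (fun _ => (1 : ℂ)) q.1 * (fourier (-k) q.2 * H q)) (spaceTime T) := by
    refine (integrable_fourier_mul hHi measurable_snd (-k)).bdd_mul (c := 1) ?_ ?_
    · exact hb.aestronglyMeasurable.comp_fst
    · refine ae_of_all _ fun q => ?_
      by_cases ht : q.1 ∈ A <;> simp [ht]
  have h4 : ∫ q, inner ℂ ((⇑((memLp_mode hb k).toLp _)) q) (H q) ∂spaceTime T
      = ∫ q : ℝ × UnitAddCircle, A.indicator (fun _ => (1 : ℂ)) q.1 * (fourier (-k) q.2 * H q)
        ∂spaceTime T := by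
    refine integral_congr_ae ?_
    filter_upwards [(memLp_mode hb k).coeFn_toLp] with q h2
    rw [h2, RCLike.inner_apply, map_mul, ← fourier_neg]
    by_cases ht : q.1 ∈ A <;> simp [ht, mul_comm]
  refine Eq.trans ?_ h4.symm
  unfold spaceTime at hfi ⊢
  rw [integral_prod _ hfi, ← integral_indicator hA]
  refine integral_congr_ae (ae_of_all _ fun t => ?_)
  simp only [integral_const_mul]
  by_cases ht : t ∈ A
  · simp only [indicator_of_mem ht, one_mul, fourierCoeff, ← volume_circle]
    rfl
  · simp [ht]

theorem exists_spaceTime_coeff {a : ℤ → ℝ → ℂ}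
    (ha : ∀ k, AEStronglyMeasurable (a k) (timeMeasure T))
    (hsymm : ∀ t ∈ Icc 0 T, ∀ k, a (-k) t = conj (a k t))
    (hfin : ∑' k, ∫⁻ t in Icc 0 T, ‖a k t‖ₑ ^ 2 < ⊤) :
    ∃ h : Lp ℝ 2 (spaceTime T), ∀ᵐ t ∂timeMeasure T, ∀ k, coeff (fun x => h (t, x)) k = a k t := by
  have hmem : ∀ k, MemLp (a k) 2 (timeMeasure T) := fun k => by
    refine ⟨ha k, ?_⟩
    rw [eLpNorm_lt_top_iff_lintegral_rpow_enorm_lt_top (by norm_num) (by norm_num)]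
    simpa using (ENNReal.le_tsum k).trans_lt hfin
  have hsum : Summable fun k => ∫ t in Icc 0 T, ‖a k t‖ ^ 2 := by
    refine (hasSum_toReal_of_tsum_ne_top (fun k => integral_nonneg fun t => by positivity) ?_).summable
    have : ∀ k, ENNReal.ofReal (∫ t in Icc 0 T, ‖a k t‖ ^ 2) = ∫⁻ t in Icc 0 T, ‖a k t‖ₑ ^ 2 :=
      fun k => by
        rw [ofReal_integral_eq_lintegral_ofReal ((memLp_two_iff_integrable_sq_norm (ha k)).1 (hmem k))
          (ae_of_all _ fun t => by positivity)]
        refine lintegral_congr fun t => ?_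
        rw [ENNReal.ofReal_pow (norm_nonneg _), ofReal_norm]
    simp_rw [this]
    exact hfin.ne
  obtain ⟨H, hH⟩ := exists_spaceTime_fourierCoeff hmem hsum
  have hHL : MemLp (H : ℝ × UnitAddCircle → ℂ) 2 (spaceTime T) := Lp.memLp H
  have hre : MemLp (fun q => (H q).re) 2 (spaceTime T) := hHL.re
  have hsl : ∀ᵐ t ∂timeMeasure T, Integrable fun x => H (t, x) :=
    (hHL.integrable (by norm_num)).prod_right_ae
  have hae := Measure.ae_ae_of_ae_prod hre.coeFn_toLp
  refine ⟨hre.toLp, ?_⟩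
  have hmem' : ∀ᵐ t ∂timeMeasure T, t ∈ Icc 0 T := ae_restrict_mem measurableSet_Icc
  filter_upwards [hH, hsl, hae, hmem'] with t h1 h2 h3 h4 k
  rw [coeff_congr_ae h3, coeff_re h2, h1, h1, hsymm t h4]
  simp

end

/-! ### The Galerkin system -/

/-- The frequencies `k` with `|k| ≤ N`. -/
def freqs (N : ℕ) : Finset ℤ := Finset.Icc (-(N : ℤ)) N

theorem mem_freqs {N : ℕ} {k : ℤ} : k ∈ freqs N ↔ |k| ≤ N := by
  rw [freqs, Finset.mem_Icc, abs_le]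

theorem neg_mem_freqs {N : ℕ} {k : ℤ} : -k ∈ freqs N ↔ k ∈ freqs N := by
  rw [mem_freqs, mem_freqs, abs_neg]

/-- The real part of the trigonometric polynomial with coefficients `a k`, `|k| ≤ N`. -/
def trigPoly (N : ℕ) (a : ℤ → ℂ) (x : UnitAddCircle) : ℝ :=
  (∑ k ∈ freqs N, a k * fourier k x).re

theorem continuous_trigPoly (N : ℕ) (a : ℤ → ℂ) : Continuous (trigPoly N a) := by
  unfold trigPoly
  exact Complex.continuous_re.comp (continuous_finsetSum _ fun k _ =>
    continuous_const.mul (map_continuous (fourier k)))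

theorem memLp_of_continuous {g : UnitAddCircle → ℝ} (hg : Continuous g) : MemLp g 2 :=
  hg.memLp_of_hasCompactSupport (HasCompactSupport.of_compactSpace _)

theorem memLp_trigPoly (N : ℕ) (a : ℤ → ℂ) : MemLp (trigPoly N a) 2 :=
  memLp_of_continuous (continuous_trigPoly N a)

/-- Only the part of the coefficients with the symmetry of a real function matters. -/
theorem trigPoly_symm (N : ℕ) (a : ℤ → ℂ) :
    trigPoly N (fun k => (a k + conj (a (-k))) / 2) = trigPoly N a := by
  funext x
  unfold trigPoly
  have h1 : ∑ k ∈ freqs N, conj (a (-k)) * fourier k x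
      = conj (∑ k ∈ freqs N, a k * fourier k x) := by
    rw [map_sum]
    refine Finset.sum_nbij' (fun k => -k) (fun k => -k) (fun k hk => neg_mem_freqs.2 hk)
      (fun k hk => neg_mem_freqs.2 hk) (fun k _ => neg_neg k) (fun k _ => neg_neg k) fun k _ => ?_
    rw [map_mul, ← fourier_neg, neg_neg]
  have h2 : ∑ k ∈ freqs N, (a k + conj (a (-k))) / 2 * fourier k x
      = ((∑ k ∈ freqs N, a k * fourier k x) + ∑ k ∈ freqs N, conj (a (-k)) * fourier k x) / 2 := by
    rw [← Finset.sum_add_distrib, Finset.sum_div]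
    exact Finset.sum_congr rfl fun k _ => by ring
  rw [h2, h1, Complex.add_conj]
  simp

theorem coeff_trigPoly (N : ℕ) {a : ℤ → ℂ} (ha : ∀ k, a (-k) = conj (a k)) (k : ℤ) :
    coeff (trigPoly N a) k = if k ∈ freqs N then a k else 0 := by
  have hcont : ∀ j : ℤ, Continuous fun x : UnitAddCircle => a j * fourier j x := fun j =>
    continuous_const.mul (map_continuous (fourier j))
  have hF : ∀ k, fourierCoeff (fun x : UnitAddCircle => ∑ j ∈ freqs N, a j * fourier j x) k
      = if k ∈ freqs N then a k else 0 := fun k => by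
    have h1 := congrFun (fourierCoeff.sum (freqs N) (fun j (x : UnitAddCircle) => a j * fourier j x)
      fun j _ => (hcont j).integrable_of_hasCompactSupport (HasCompactSupport.of_compactSpace _)) k
    have h2 : (∑ j ∈ freqs N, fun x : UnitAddCircle => a j * fourier j x)
        = fun x => ∑ j ∈ freqs N, a j * fourier j x := by
      funext x; rw [Finset.sum_apply]
    rw [h2] at h1
    rw [h1, Finset.sum_apply]
    simp only [fourierCoeff.const_mul, fourierCoeff_fourier_apply, mul_ite, mul_one, mul_zero]
    rw [Finset.sum_ite_eq]
  unfold trigPoly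
  rw [coeff_re ((continuous_finsetSum _ fun j _ => hcont j).integrable_of_hasCompactSupport
    (HasCompactSupport.of_compactSpace _)), hF, hF, ha]
  simp only [neg_mem_freqs]
  split_ifs <;> simp

theorem norm_coeff_comp_trigPoly_sub_le {f : ℝ → ℝ} {K : NNReal} (hf : LipschitzWith K f) (N : ℕ)
    (a b : ℤ → ℂ) (k : ℤ) :
    ‖coeff (fun x => f (trigPoly N a x)) k - coeff (fun x => f (trigPoly N b x)) k‖
      ≤ K * ∑ j ∈ freqs N, ‖a j - b j‖ := by
  have hi : ∀ a, Integrable fun x => f (trigPoly N a x) := fun a =>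
    (memLp_comp hf (memLp_trigPoly N a)).integrable (by norm_num)
  rw [← coeff_sub (hi a) (hi b)]
  refine (norm_coeff_le _ _).trans ?_
  refine (integral_mono_of_nonneg (ae_of_all _ fun _ => norm_nonneg _)
    (integrable_const (K * ∑ j ∈ freqs N, ‖a j - b j‖)) (ae_of_all _ fun x => ?_)).trans_eq
    (by simp)
  have h1 := hf.dist_le_mul (trigPoly N a x) (trigPoly N b x)
  rw [Real.dist_eq, Real.dist_eq] at h1
  refine h1.trans ?_
  refine mul_le_mul_of_nonneg_left ?_ K.2
  unfold trigPoly
  rw [← Complex.sub_re, ← Finset.sum_sub_distrib]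
  refine (Complex.abs_re_le_norm _).trans ((norm_sum_le _ _).trans (Finset.sum_le_sum fun j _ => ?_))
  rw [← sub_mul, norm_mul, norm_fourier_apply, mul_one]

/-- Extension by zero of a finite family of coefficients. -/
def extendCoeff (N : ℕ) (b : freqs N → ℂ) (k : ℤ) : ℂ := if h : k ∈ freqs N then b ⟨k, h⟩ else 0

theorem norm_coeff_comp_extendCoeff_sub_le {f : ℝ → ℝ} {K : NNReal} (hf : LipschitzWith K f) (N : ℕ)
    (a b : freqs N → ℂ) (k : ℤ) :
    ‖coeff (fun x => f (trigPoly N (extendCoeff N a) x)) k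
      - coeff (fun x => f (trigPoly N (extendCoeff N b) x)) k‖
      ≤ K * (freqs N).card * ‖a - b‖ := by
  refine (norm_coeff_comp_trigPoly_sub_le hf N _ _ k).trans ?_
  rw [mul_assoc]
  refine mul_le_mul_of_nonneg_left ?_ K.2
  rw [← nsmul_eq_mul]
  refine Finset.sum_le_card_nsmul _ _ _ fun j hj => ?_
  simp only [extendCoeff, dif_pos hj]
  exact norm_le_pi_norm (a - b) ⟨j, hj⟩

theorem norm_coeff_comp_le {f : ℝ → ℝ} {B : ℝ} (hB : ∀ v, |f v| ≤ B) (g : UnitAddCircle → ℝ)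
    (k : ℤ) : ‖coeff (fun x => f (g x)) k‖ ≤ B := by
  refine (norm_coeff_le _ _).trans ?_
  refine (integral_mono_of_nonneg (ae_of_all _ fun _ => norm_nonneg _) (integrable_const B)
    (ae_of_all _ fun x => hB (g x))).trans_eq (by simp)

/-- The Galerkin system in the variables `e^{μₖ t} cₖ`, in which the vector field is bounded. -/
theorem exists_galerkin_aux {f : ℝ → ℝ} {K : NNReal} (hf : LipschitzWith K f) {B : ℝ}
    (hB : ∀ v, |f v| ≤ B) (μ : ℤ → ℝ) (N : ℕ) {T : ℝ} (hT : 0 < T) (w : ℤ → ℂ) :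
    ∃ a : ℤ → ℝ → ℂ, (∀ k ∈ freqs N, a k 0 = w k) ∧ ∀ k ∈ freqs N, ∀ t ∈ Icc 0 T,
      HasDerivAt (a k) (2 * Real.pi * Complex.I * k
        * coeff (fun x => f (trigPoly N (fun j => a j t) x)) k - μ k * a k t) t := by
  have hB0 : 0 ≤ B := (abs_nonneg _).trans (hB 0)
  -- `D t` recovers the coefficients from the new variables
  let D : ℝ → (freqs N → ℂ) → freqs N → ℂ := fun t b j => (Real.exp (-(μ j * t)) : ℂ) * b j
  let F : ℤ → (freqs N → ℂ) → ℂ := fun k b =>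
    coeff (fun x => f (trigPoly N (extendCoeff N b) x)) k
  let Y : ℝ → (freqs N → ℂ) → freqs N → ℂ := fun t b k =>
    (Real.exp (μ k * t) : ℂ) * (2 * Real.pi * Complex.I * (k : ℤ)) * F k (D t b)
  let M : freqs N → ℝ := fun k => Real.exp (|μ k| * (T + 1))
  have hM0 : ∀ k, 0 < M k := fun k => Real.exp_pos _
  have hexp : ∀ t ∈ Icc (-1 : ℝ) (T + 1), ∀ k : freqs N,
      Real.exp (μ k * t) ≤ M k ∧ Real.exp (-(μ k * t)) ≤ M k := fun t ht k => by
    have ht' : |t| ≤ T + 1 := abs_le.2 ⟨by linarith [ht.1], ht.2⟩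
    have h1 : |μ k * t| ≤ |μ k| * (T + 1) := by
      rw [abs_mul]; gcongr
    exact ⟨Real.exp_le_exp.2 ((le_abs_self _).trans h1),
      Real.exp_le_exp.2 ((neg_le_abs _).trans h1)⟩
  have hYnorm : ∀ t (k : freqs N) (z : ℂ), ‖(Real.exp (μ k * t) : ℂ) *
      (2 * Real.pi * Complex.I * (k : ℤ)) * z‖
      = Real.exp (μ k * t) * (2 * Real.pi * |((k : ℤ) : ℝ)|) * ‖z‖ := fun t k z => by
    simp only [norm_mul, Complex.norm_I, Complex.norm_real,
        Complex.norm_intCast, RCLike.norm_ofNat, Real.norm_of_nonneg Real.pi_pos.le,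
        Real.norm_of_nonneg (Real.exp_pos _).le, mul_one]
  have hFL : ∀ k a b, ‖F k a - F k b‖ ≤ K * (freqs N).card * ‖a - b‖ := fun k a b =>
    norm_coeff_comp_extendCoeff_sub_le hf N a b k
  let C : freqs N → ℝ := fun k => M k * (2 * Real.pi * |((k : ℤ) : ℝ)|)
  have hC0 : ∀ k, 0 ≤ C k := fun k => by have := hM0 k; positivity
  let L : NNReal := ⟨∑ k, C k * B, Finset.sum_nonneg fun k _ => mul_nonneg (hC0 k) hB0⟩
  let R : ℝ := ∑ j, M j
  have hR0 : 0 ≤ R := Finset.sum_nonneg fun j _ => (hM0 j).le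
  let Q : ℝ := K * (freqs N).card * R
  have hQ0 : 0 ≤ Q := by positivity
  let κ : NNReal := ⟨∑ k, C k * Q, Finset.sum_nonneg fun k _ => mul_nonneg (hC0 k) hQ0⟩
  let t0 : Icc (-1 : ℝ) (T + 1) := ⟨0, by norm_num, by linarith⟩
  have hPL : IsPicardLindelof Y t0 (fun k => w k)
      (L * ⟨T + 1, by linarith⟩) 0 L κ := by
    refine ⟨fun t ht => ?_, fun b _ => ?_, fun t ht b _ => ?_, ?_⟩
    · refine (LipschitzWith.of_dist_le_mul fun a b => ?_).lipschitzOnWith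
      rw [dist_eq_norm, dist_eq_norm]
      refine (pi_norm_le_iff_of_nonneg (by positivity)).2 fun k => ?_
      have h1 : (Y t a - Y t b) k = (Real.exp (μ k * t) : ℂ) * (2 * Real.pi * Complex.I * (k : ℤ))
          * (F k (D t a) - F k (D t b)) := by
        simp only [Y, Pi.sub_apply]; ring
      rw [h1, hYnorm]
      have h2 : ‖D t a - D t b‖ ≤ R * ‖a - b‖ := by
        refine (pi_norm_le_iff_of_nonneg (by positivity)).2 fun j => ?_
        have h3 : (D t a - D t b) j = (Real.exp (-(μ j * t)) : ℂ) * (a j - b j) := by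
          simp only [D, Pi.sub_apply]; ring
        rw [h3, norm_mul, Complex.norm_real, Real.norm_of_nonneg (Real.exp_pos _).le]
        have h4 : M j ≤ R := Finset.single_le_sum (f := M) (fun j _ => (hM0 j).le) (Finset.mem_univ j)
        exact mul_le_mul ((hexp t ht j).2.trans h4) (norm_le_pi_norm (a - b) j) (norm_nonneg _) hR0
      have h5 : ‖F k (D t a) - F k (D t b)‖ ≤ Q * ‖a - b‖ := by
        refine (hFL k _ _).trans ?_
        simp only [Q]
        rw [mul_assoc _ R]
        gcongr
      have h6 : C k * Q ≤ κ := Finset.single_le_sum (f := fun k => C k * Q)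
        (fun k _ => mul_nonneg (hC0 k) hQ0) (Finset.mem_univ k)
      calc Real.exp (μ k * t) * (2 * Real.pi * |((k : ℤ) : ℝ)|) * ‖F k (D t a) - F k (D t b)‖
          ≤ C k * (Q * ‖a - b‖) := by
            refine mul_le_mul ?_ h5 (norm_nonneg _) (hC0 k)
            exact mul_le_mul_of_nonneg_right (hexp t ht k).1 (by positivity)
        _ = C k * Q * ‖a - b‖ := by ring
        _ ≤ κ * ‖a - b‖ := by gcongr
    · refine Continuous.continuousOn ?_
      have hD : Continuous fun t => D t b := by
        refine continuous_pi fun j => ?_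
        simp only [D]
        fun_prop
      have hFc : ∀ k, Continuous (F k) := fun k =>
        (LipschitzWith.of_dist_le_mul (K := K * (freqs N).card) fun a b => by
          rw [dist_eq_norm, dist_eq_norm]; exact_mod_cast hFL k a b).continuous
      refine continuous_pi fun k => ?_
      simp only [Y]
      exact (by fun_prop : Continuous fun t : ℝ => (Real.exp (μ k * t) : ℂ) *
        (2 * Real.pi * Complex.I * (k : ℤ))).mul ((hFc k).comp hD)
    · refine (pi_norm_le_iff_of_nonneg L.2).2 fun k => ?_
      simp only [Y]
      rw [hYnorm]
      have h6 : C k * B ≤ L := Finset.single_le_sum (f := fun k => C k * B)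
        (fun k _ => mul_nonneg (hC0 k) hB0) (Finset.mem_univ k)
      refine le_trans ?_ h6
      refine mul_le_mul ?_ (norm_coeff_comp_le hB _ _) (norm_nonneg _) (hC0 k)
      exact mul_le_mul_of_nonneg_right (hexp t ht k).1 (by positivity)
    · simp only [t0, sub_zero, NNReal.coe_zero]
      refine mul_le_mul_of_nonneg_left ?_ L.2
      exact max_le le_rfl (by linarith)
  obtain ⟨b, hb0, hb⟩ := hPL.exists_eq_forall_mem_Icc_hasDerivWithinAt₀
  refine ⟨fun k t => extendCoeff N (D t (b t)) k, fun k hk => ?_, fun k hk t ht => ?_⟩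
  · have h1 : b 0 = fun k : freqs N => w k := hb0
    simp only [extendCoeff, dif_pos hk, D, h1]
    simp
  · have h1 : HasDerivAt b (Y t (b t)) t := (hb t ⟨by linarith [ht.1], by linarith [ht.2]⟩).hasDerivAt
      (Icc_mem_nhds (by linarith [ht.1]) (by linarith [ht.2]))
    have h2 := hasDerivAt_pi.1 h1 ⟨k, hk⟩
    have h3 : HasDerivAt (fun t : ℝ => (Real.exp (-(μ k * t)) : ℂ))
        ((Real.exp (-(μ k * t)) * -(μ k) : ℝ) : ℂ) t := by
      refine HasDerivAt.ofReal_comp ?_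
      have h4 := (((hasDerivAt_id t).const_mul (μ k)).neg).exp
      simpa using h4
    have h5 := h3.mul h2
    have h6 : (Real.exp (-(μ k * t)) : ℂ) * (Real.exp (μ k * t) : ℂ) = 1 := by
      rw [← Complex.ofReal_mul, ← Real.exp_add]; simp
    have h7 : (fun t => extendCoeff N (D t (b t)) k)
        = fun t => (Real.exp (-(μ k * t)) : ℂ) * b t ⟨k, hk⟩ := by
      funext t
      simp only [extendCoeff, dif_pos hk, D]
    have h8 := congrFun h7 t
    change HasDerivAt (fun t => extendCoeff N (D t (b t)) k) (2 * Real.pi * Complex.I * k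
      * F k (D t (b t)) - μ k * extendCoeff N (D t (b t)) k) t
    rw [h8, h7]
    refine h5.congr_deriv ?_
    simp only [Y]
    rw [Complex.ofReal_mul, Complex.ofReal_neg]
    linear_combination (2 * Real.pi * Complex.I * k * F k (D t (b t))) * h6

/-- The solution of the Galerkin system: the frequencies `|k| ≤ N` follow the equation with the
nonlinearity evaluated on them, and the other frequencies follow the linear equation. -/
theorem exists_galerkin {f : ℝ → ℝ} {K : NNReal} (hf : LipschitzWith K f) {B : ℝ}
    (hB : ∀ v, |f v| ≤ B) {μ : ℤ → ℝ} (hμ : ∀ k, μ (-k) = μ k) (N : ℕ) {T : ℝ} (hT : 0 < T)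
    {w : ℤ → ℂ} (hw : ∀ k, w (-k) = conj (w k)) :
    ∃ c : ℤ → ℝ → ℂ, (∀ k, c k 0 = w k) ∧ (∀ k t, c (-k) t = conj (c k t)) ∧
      (∀ k ∉ freqs N, ∀ t, c k t = Real.exp (-(μ k * t)) * w k) ∧
      ∀ k, ∀ t ∈ Icc 0 T, HasDerivAt (c k) ((if k ∈ freqs N then 2 * Real.pi * Complex.I * k
        * coeff (fun x => f (trigPoly N (fun j => c j t) x)) k else 0) - μ k * c k t) t := by
  obtain ⟨a, ha0, ha⟩ := exists_galerkin_aux hf hB μ N hT w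
  let c : ℤ → ℝ → ℂ := fun k t => if k ∈ freqs N then (a k t + conj (a (-k) t)) / 2
    else Real.exp (-(μ k * t)) * w k
  have hin : ∀ k ∈ freqs N, ∀ t, c k t = (a k t + conj (a (-k) t)) / 2 := fun k hk t => if_pos hk
  have hout : ∀ k ∉ freqs N, ∀ t, c k t = Real.exp (-(μ k * t)) * w k := fun k hk t => if_neg hk
  have htrig : ∀ t, trigPoly N (fun j => c j t) = trigPoly N (fun j => a j t) := fun t => by
    rw [← trigPoly_symm N fun j => a j t]
    funext x
    unfold trigPoly
    congr 1
    exact Finset.sum_congr rfl fun k hk => by simp only [hin k hk]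
  refine ⟨c, fun k => ?_, fun k t => ?_, hout, fun k t ht => ?_⟩
  · by_cases hk : k ∈ freqs N
    · rw [hin k hk, ha0 k hk, ha0 (-k) (neg_mem_freqs.2 hk), hw]; simp
    · rw [hout k hk]; simp
  · by_cases hk : k ∈ freqs N
    · rw [hin k hk, hin (-k) (neg_mem_freqs.2 hk), map_div₀, map_add, Complex.conj_conj,
        map_ofNat, neg_neg, add_comm]
    · rw [hout k hk, hout (-k) fun h => hk (neg_mem_freqs.1 h), hμ, hw, map_mul, Complex.conj_ofReal]
  · simp only [htrig]
    by_cases hk : k ∈ freqs N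
    · have h1 := ha k hk t ht
      have h2 : HasDerivAt (fun t => conj (a (-k) t)) _ t :=
        Complex.conjCLE.toContinuousLinearMap.hasFDerivAt.comp_hasDerivAt t
          (ha (-k) (neg_mem_freqs.2 hk) t ht)
      have h3 := (h1.add h2).div_const 2
      have h4 : c k = fun t => (a k t + conj (a (-k) t)) / 2 := funext (hin k hk)
      rw [if_pos hk, h4]
      refine h3.congr_deriv ?_
      simp only [ContinuousLinearEquiv.coe_coe, Complex.conjCLE_apply, map_sub, map_mul,
        Complex.conj_I, Complex.conj_ofReal, map_ofNat, map_intCast, coeff_neg, Complex.conj_conj, hμ]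
      push_cast
      ring
    · have h4 : c k = fun t => Real.exp (-(μ k * t)) * w k := funext (hout k hk)
      rw [if_neg hk, h4]
      have h3 : HasDerivAt (fun t : ℝ => (Real.exp (-(μ k * t)) : ℂ))
          ((Real.exp (-(μ k * t)) * -(μ k) : ℝ) : ℂ) t := by
        refine HasDerivAt.ofReal_comp ?_
        have h4 := (((hasDerivAt_id t).const_mul (μ k)).neg).exp
        simpa using h4
      refine (h3.mul_const (w k)).congr_deriv ?_
      push_cast
      ring

/-! ### Energy of the Galerkin solution -/

/-- The curve of Fourier coefficients `c` solves, on `[0,T]` and with initial coefficients `w`, the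
Galerkin system with the modes `|k| ≤ N` of `∂_r c = ∂ₓ f(c) - (ε/2)(-∂ₓₓ)^s c`, the dissipative
equation that the path of least cost satisfies when run backwards. The modes `|k| > N` follow the
linear equation, so that the curve starts from `w` itself and not from a truncation of it. -/
structure IsGalerkin (f : ℝ → ℝ) (ε s : ℝ) (N : ℕ) (T : ℝ) (w : ℤ → ℂ) (c : ℤ → ℝ → ℂ) : Prop where
  init : ∀ k, c k 0 = w k
  symm : ∀ k t, c (-k) t = conj (c k t)
  high : ∀ k ∉ freqs N, ∀ t, c k t = Real.exp (-(ε / 2 * lam s k * t)) * w k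
  deriv : ∀ k, ∀ t ∈ Icc 0 T, HasDerivAt (c k) ((if k ∈ freqs N then 2 * Real.pi * Complex.I * k
    * coeff (fun x => f (trigPoly N (fun j => c j t) x)) k else 0) - ε / 2 * lam s k * c k t) t

theorem exists_isGalerkin {f : ℝ → ℝ} {K : NNReal} (hf : LipschitzWith K f) {B : ℝ}
    (hB : ∀ v, |f v| ≤ B) (ε s : ℝ) (N : ℕ) {T : ℝ} (hT : 0 < T) {w : ℤ → ℂ}
    (hw : ∀ k, w (-k) = conj (w k)) : ∃ c, IsGalerkin f ε s N T w c := by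
  obtain ⟨c, h1, h2, h3, h4⟩ := exists_galerkin hf hB (μ := fun k => ε / 2 * lam s k)
    (fun k => by rw [lam_neg]) N hT hw
  refine ⟨c, h1, h2, fun k hk t => ?_, fun k t ht => ?_⟩
  · rw [h3 k hk]
  · refine (h4 k t ht).congr_deriv ?_
    push_cast; rfl

namespace IsGalerkin

variable {f : ℝ → ℝ} {K : NNReal} {B ε s : ℝ} {N : ℕ} {T : ℝ} {w : ℤ → ℂ} {c : ℤ → ℝ → ℂ}

theorem coeff_trig (G : IsGalerkin f ε s N T w c) (t : ℝ) (k : ℤ) :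
    coeff (trigPoly N fun j => c j t) k = if k ∈ freqs N then c k t else 0 :=
  coeff_trigPoly N (fun k => G.symm k t) k

/-- The truncated nonlinearity does no work on the Galerkin solution: the latter is tested only
on the frequencies that enter the nonlinearity. -/
theorem sum_nonlinear_eq_zero (G : IsGalerkin f ε s N T w c) (hf : LipschitzWith K f)
    (hB : ∀ v, |f v| ≤ B) (t : ℝ) :
    ∑ k ∈ freqs N, (conj (c k t) * (2 * Real.pi * Complex.I * k
      * coeff (fun x => f (trigPoly N (fun j => c j t) x)) k)).re = 0 := by
  have hz : ∀ k ∉ freqs N, coeff (trigPoly N fun j => c j t) k = 0 := fun k hk => by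
    rw [G.coeff_trig, if_neg hk]
  have h := hasSum_comp_mul_deriv_eq_zero hf hB (memLp_trigPoly N fun j => c j t)
    (summable_of_ne_finset_zero (s := freqs N) fun k hk => by rw [hz k hk]; simp)
    (summable_of_ne_finset_zero (s := freqs N) fun k hk => by rw [hz k hk]; simp)
  have h2 := h.unique (hasSum_sum_of_ne_finset_zero (s := freqs N) fun k hk => by
    rw [hz k hk]; simp)
  rw [eq_comm, ← neg_eq_zero, ← Finset.sum_neg_distrib] at h2
  rw [← h2]
  refine Finset.sum_congr rfl fun k hk => ?_
  rw [G.coeff_trig, if_pos hk, ← Complex.conj_re (conj (coeff _ k) * _), ← Complex.neg_re]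
  congr 1
  simp only [map_mul, Complex.conj_conj, Complex.conj_I, Complex.conj_ofReal, map_ofNat,
    map_intCast]
  ring

theorem continuousOn (G : IsGalerkin f ε s N T w c) (k : ℤ) : ContinuousOn (c k) (Icc 0 T) :=
  fun t ht => (G.deriv k t ht).continuousAt.continuousWithinAt

theorem hasDerivAt_sum_sq (G : IsGalerkin f ε s N T w c) (hf : LipschitzWith K f)
    (hB : ∀ v, |f v| ≤ B) {S : Finset ℤ} (hS : freqs N ⊆ S) {t : ℝ} (ht : t ∈ Icc 0 T) :
    HasDerivAt (fun t => ∑ k ∈ S, ‖c k t‖ ^ 2) (-∑ k ∈ S, ε * lam s k * ‖c k t‖ ^ 2) t := by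
  have h1 : HasDerivAt (fun t => ∑ k ∈ S, ‖c k t‖ ^ 2) _ t :=
    HasDerivAt.fun_sum fun k _ => (G.deriv k t ht).norm_sq
  refine h1.congr_deriv ?_
  have h2 : ∀ k, 2 * inner ℝ (c k t) ((if k ∈ freqs N then 2 * Real.pi * Complex.I * k
      * coeff (fun x => f (trigPoly N (fun j => c j t) x)) k else 0) - ε / 2 * lam s k * c k t)
      = 2 * (if k ∈ freqs N then (conj (c k t) * (2 * Real.pi * Complex.I * k
        * coeff (fun x => f (trigPoly N (fun j => c j t) x)) k)).re else 0)
        - ε * lam s k * ‖c k t‖ ^ 2 := fun k => by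
    have h3 : conj (c k t) * (ε / 2 * lam s k * c k t)
        = ((ε / 2 * lam s k * ‖c k t‖ ^ 2 : ℝ) : ℂ) := by
      have h4 : ((‖c k t‖ ^ 2 : ℝ) : ℂ) = conj (c k t) * c k t := by
        rw [Complex.conj_mul']; push_cast; rfl
      rw [Complex.ofReal_mul, h4]; push_cast; ring
    rw [inner_sub_right, Complex.inner, Complex.inner, mul_comm _ (conj (c k t)),
      mul_comm _ (conj (c k t)), h3, Complex.ofReal_re]
    split_ifs
    · ring
    · simp; ring
  rw [Finset.sum_congr rfl fun k _ => h2 k, Finset.sum_sub_distrib, ← Finset.mul_sum,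
    Finset.sum_ite_mem, Finset.inter_eq_right.2 hS, G.sum_nonlinear_eq_zero hf hB]
  ring

theorem integral_sum_sq (G : IsGalerkin f ε s N T w c) (hf : LipschitzWith K f)
    (hB : ∀ v, |f v| ≤ B) {S : Finset ℤ} (hS : freqs N ⊆ S) {r : ℝ} (hr : r ∈ Icc 0 T) :
    ∫ t in (0 : ℝ)..r, ∑ k ∈ S, ε * lam s k * ‖c k t‖ ^ 2
      = ∑ k ∈ S, ‖w k‖ ^ 2 - ∑ k ∈ S, ‖c k r‖ ^ 2 := by
  have hsub : uIcc 0 r ⊆ Icc 0 T := by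
    rw [uIcc_of_le hr.1]; exact Icc_subset_Icc_right hr.2
  have hc : ContinuousOn (fun t => -∑ k ∈ S, ε * lam s k * ‖c k t‖ ^ 2) (uIcc 0 r) :=
    (continuousOn_finsetSum _ fun k _ => continuousOn_const.mul
      (((G.continuousOn k).mono hsub).norm.pow 2)).neg
  have h := intervalIntegral.integral_eq_sub_of_hasDerivAt
    (fun t ht => G.hasDerivAt_sum_sq hf hB hS (hsub ht)) hc.intervalIntegrable
  rw [intervalIntegral.integral_neg] at h
  simp only [G.init] at h
  linarith

theorem mean_const (G : IsGalerkin f ε s N T w c) (hs : 0 < s) {r : ℝ} (hr : r ∈ Icc 0 T) :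
    c 0 r = w 0 := by
  have hsub : uIcc 0 r ⊆ Icc 0 T := by
    rw [uIcc_of_le hr.1]; exact Icc_subset_Icc_right hr.2
  have h := intervalIntegral.integral_eq_sub_of_hasDerivAt (f := c 0) (f' := fun _ => 0)
    (fun t ht => (G.deriv 0 t (hsub ht)).congr_deriv (by simp [lam_zero hs])) (by simp)
  rw [intervalIntegral.integral_zero, G.init] at h
  exact (sub_eq_zero.1 h.symm)

/-- A bound on the Fourier coefficients, uniform in time. -/
def modeBound (N : ℕ) (w : ℤ → ℂ) (k : ℤ) : ℝ :=
  if k ∈ freqs N then ∑ j ∈ freqs N, ‖w j‖ ^ 2 else ‖w k‖ ^ 2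

theorem summable_modeBound (hw : Summable fun k => ‖w k‖ ^ 2) : Summable (modeBound N w) := by
  refine (hw.add (summable_of_ne_finset_zero (s := freqs N)
    (f := fun k => if k ∈ freqs N then ∑ j ∈ freqs N, ‖w j‖ ^ 2 else 0)
      fun k hk => if_neg hk)).of_nonneg_of_le (fun k => ?_) fun k => ?_
  · unfold modeBound; split_ifs <;> positivity
  · unfold modeBound
    split_ifs
    · have : 0 ≤ ‖w k‖ ^ 2 := by positivity
      linarith
    · simp

theorem sq_le_modeBound (G : IsGalerkin f ε s N T w c) (hf : LipschitzWith K f)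
    (hB : ∀ v, |f v| ≤ B) (hε : 0 < ε) (k : ℤ) {r : ℝ} (hr : r ∈ Icc 0 T) :
    ‖c k r‖ ^ 2 ≤ modeBound N w k := by
  unfold modeBound
  by_cases hk : k ∈ freqs N
  · rw [if_pos hk]
    have h1 := G.integral_sum_sq hf hB subset_rfl hr
    have h2 : 0 ≤ ∫ t in (0 : ℝ)..r, ∑ k ∈ freqs N, ε * lam s k * ‖c k t‖ ^ 2 :=
      intervalIntegral.integral_nonneg hr.1 fun t _ => Finset.sum_nonneg fun k _ => by
        have := lam_nonneg s k
        positivity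
    have h3 : ‖c k r‖ ^ 2 ≤ ∑ k ∈ freqs N, ‖c k r‖ ^ 2 :=
      Finset.single_le_sum (f := fun k => ‖c k r‖ ^ 2) (fun k _ => by positivity) hk
    linarith
  · rw [if_neg hk, G.high k hk, norm_mul, Complex.norm_real, Real.norm_of_nonneg (Real.exp_pos _).le]
    have h1 : Real.exp (-(ε / 2 * lam s k * r)) ≤ 1 := by
      rw [Real.exp_le_one_iff]
      have := lam_nonneg s k
      have := hr.1
      have : 0 ≤ ε / 2 * lam s k * r := by positivity
      linarith
    have h2 : Real.exp (-(ε / 2 * lam s k * r)) * ‖w k‖ ≤ 1 * ‖w k‖ := by gcongr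
    rw [one_mul] at h2
    gcongr

/-- The squared `Ḣ_s` norm of the Galerkin solution. -/
def sobolevSq (s : ℝ) (c : ℤ → ℝ → ℂ) (t : ℝ) : ℝ≥0∞ :=
  ∑' k, ENNReal.ofReal (lam s k * ‖c k t‖ ^ 2)

theorem aemeasurable_mode (G : IsGalerkin f ε s N T w c) (k : ℤ) :
    AEMeasurable (fun t => ENNReal.ofReal (lam s k * ‖c k t‖ ^ 2)) (timeMeasure T) :=
  ((continuousOn_const.mul ((G.continuousOn k).norm.pow 2)).aemeasurable
    measurableSet_Icc).ennreal_ofReal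

/-- The energy estimate. The constant `D` bounds the energy of `w` without its mean, which is all
that can be dissipated. -/
theorem lintegral_sobolevSq_le (G : IsGalerkin f ε s N T w c) (hf : LipschitzWith K f)
    (hB : ∀ v, |f v| ≤ B) (hε : 0 < ε) (hs : 0 < s) (hT : 0 < T) {D : ℝ}
    (hD : ∀ S : Finset ℤ, ∑ k ∈ S.erase 0, ‖w k‖ ^ 2 ≤ D) :
    ∫⁻ t in Icc 0 T, sobolevSq s c t ≤ ENNReal.ofReal (ε⁻¹ * D) := by
  unfold sobolevSq
  rw [lintegral_tsum fun k => G.aemeasurable_mode k]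
  have hi : ∀ k, Integrable (fun t => lam s k * ‖c k t‖ ^ 2) (timeMeasure T) := fun k =>
    (continuousOn_const.mul ((G.continuousOn k).norm.pow 2)).integrableOn_Icc
  have e1 : ∀ k, ∫⁻ t in Icc 0 T, ENNReal.ofReal (lam s k * ‖c k t‖ ^ 2)
      = ENNReal.ofReal (∫ t in Icc 0 T, lam s k * ‖c k t‖ ^ 2) := fun k =>
    (ofReal_integral_eq_lintegral_ofReal (hi k)
      (ae_of_all _ fun t => mul_nonneg (lam_nonneg s k) (by positivity))).symm
  simp_rw [e1]
  rw [ENNReal.tsum_eq_iSup_sum]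
  refine iSup_le fun S => ?_
  refine (Finset.sum_le_sum_of_subset (Finset.subset_union_left (s₂ := freqs N))).trans ?_
  rw [← ENNReal.ofReal_sum_of_nonneg fun k _ => integral_nonneg fun t =>
    mul_nonneg (lam_nonneg s k) (by positivity)]
  refine ENNReal.ofReal_le_ofReal ?_
  rw [← integral_finsetSum _ fun k _ => hi k]
  have h1 := G.integral_sum_sq hf hB (Finset.subset_union_right (s₁ := S)) (r := T) ⟨hT.le, le_rfl⟩
  rw [intervalIntegral.integral_of_le hT.le, ← integral_Icc_eq_integral_Ioc] at h1
  have h2 : ∫ t in Icc 0 T, ∑ k ∈ S ∪ freqs N, ε * lam s k * ‖c k t‖ ^ 2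
      = ε * ∫ t in Icc 0 T, ∑ k ∈ S ∪ freqs N, lam s k * ‖c k t‖ ^ 2 := by
    rw [← integral_const_mul]
    refine integral_congr_ae (ae_of_all _ fun t => ?_)
    simp only [Finset.mul_sum, mul_assoc]
  have h0 : (0 : ℤ) ∈ S ∪ freqs N := Finset.mem_union_right _ (by rw [mem_freqs]; simp)
  have h3 : ∑ k ∈ S ∪ freqs N, ‖w k‖ ^ 2 - ∑ k ∈ S ∪ freqs N, ‖c k T‖ ^ 2 ≤ D := by
    rw [← Finset.add_sum_erase _ _ h0, ← Finset.add_sum_erase _ (fun k => ‖c k T‖ ^ 2) h0,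
      G.mean_const hs ⟨hT.le, le_rfl⟩]
    have h4 : 0 ≤ ∑ k ∈ (S ∪ freqs N).erase 0, ‖c k T‖ ^ 2 :=
      Finset.sum_nonneg fun k _ => by positivity
    have := hD (S ∪ freqs N)
    linarith
  rw [← h1, h2] at h3
  rw [inv_mul_eq_div, le_div_iff₀' hε]
  exact h3

end IsGalerkin

/-! ### Continuous curves in `L₂` -/

theorem norm_coeff_le_norm (g : L2T) (k : ℤ) : ‖coeff g k‖ ≤ ‖g‖ :=
  le_of_sq_le_sq ((L2T_parseval g).summable.le_tsum k (fun _ _ => by positivity)|>.trans_eq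
    (L2T_parseval g).tsum_eq) (norm_nonneg _)

theorem continuous_L2T_coeff (k : ℤ) : Continuous fun g : L2T => coeff g k := by
  refine LipschitzWith.continuous (K := 1) (LipschitzWith.of_dist_le_mul fun g h => ?_)
  rw [dist_eq_norm, dist_eq_norm, ← L2T_coeff_sub, NNReal.coe_one, one_mul]
  exact norm_coeff_le_norm _ k

theorem tsum_enorm_coeff_L2T (g : L2T) : ∑' k, ‖coeff g k‖ₑ ^ 2 = ‖g‖ₑ ^ 2 := by
  have h := L2T_parseval g
  have h1 : ∀ k, ‖coeff g k‖ₑ ^ 2 = ENNReal.ofReal (‖coeff g k‖ ^ 2) := fun k => by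
    rw [ENNReal.ofReal_pow (norm_nonneg _), ofReal_norm]
  simp_rw [h1]
  rw [← ENNReal.ofReal_tsum_of_nonneg (fun k => by positivity) h.summable, h.tsum_eq,
    ENNReal.ofReal_pow (norm_nonneg _), ofReal_norm]

/-- The inclusion of `L₂` in `H^{-1}`. -/
def toHMinusOne (g : L2T) : HMinusOne where
  hat := coeff g
  hat_neg := coeff_neg g
  summable := (L2T_parseval g).summable.of_nonneg_of_le
    (fun k => div_nonneg (by positivity) (HMinusOne.weight_pos k).le) fun k =>
      div_le_self (by positivity) (le_add_of_nonneg_right (by positivity))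

theorem isFun_toHMinusOne (g : L2T) : (toHMinusOne g).IsFun g :=
  ⟨L2T_integrable g, fun _ => rfl⟩

theorem continuous_toHMinusOne : Continuous toHMinusOne := by
  refine LipschitzWith.continuous (K := 1) (LipschitzWith.of_dist_le_mul fun g h => ?_)
  rw [NNReal.coe_one, one_mul]
  change dist (HMinusOne.toEll2 _) (HMinusOne.toEll2 _) ≤ _
  rw [dist_eq_norm, dist_eq_norm]
  refine le_of_sq_le_sq ?_ (norm_nonneg _)
  have h1 := lp.hasSum_norm (p := 2) (by norm_num)
    (HMinusOne.toEll2 (toHMinusOne g) - HMinusOne.toEll2 (toHMinusOne h))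
  simp only [ENNReal.toReal_ofNat, Real.rpow_two] at h1
  refine hasSum_le (fun k => ?_) h1 (L2T_parseval (g - h))
  have h2 : (HMinusOne.toEll2 (toHMinusOne g) - HMinusOne.toEll2 (toHMinusOne h)) k
      = ((√(1 + (2 * Real.pi * (k : ℝ)) ^ 2))⁻¹ : ℝ) • coeff (g - h : L2T) k := by
    rw [L2T_coeff_sub, smul_sub]; rfl
  rw [h2, norm_smul]
  have h3 : 1 ≤ √(1 + (2 * Real.pi * (k : ℝ)) ^ 2) :=
    Real.one_le_sqrt.2 (le_add_of_nonneg_right (by positivity))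
  have h4 : ‖(√(1 + (2 * Real.pi * (k : ℝ)) ^ 2))⁻¹‖ ≤ 1 := by
    rw [norm_inv, Real.norm_of_nonneg (Real.sqrt_nonneg _)]
    exact inv_le_one_of_one_le₀ h3
  have := mul_le_mul_of_nonneg_right h4 (norm_nonneg (coeff (g - h : L2T) k))
  rw [one_mul] at this
  gcongr

/-- A curve in `L₂` is continuous if its Fourier coefficients are and are dominated. -/
theorem continuous_of_coeff {X : Type*} [TopologicalSpace X] {v : X → L2T}
    (hc : ∀ k, Continuous fun x => coeff (v x) k) {b : ℤ → ℝ} (hb : Summable b)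
    (hle : ∀ x k, ‖coeff (v x) k‖ ^ 2 ≤ b k) : Continuous v := by
  rw [continuous_iff_continuousAt]
  intro x₀
  rw [ContinuousAt, tendsto_iff_norm_sub_tendsto_zero]
  have h1 : Tendsto (fun x => ∑' k, ‖coeff (v x) k - coeff (v x₀) k‖ ^ 2) (𝓝 x₀)
      (𝓝 (∑' k : ℤ, (0 : ℝ))) := by
    refine tendsto_tsum_of_dominated_convergence (hb.mul_left 4) (fun k => ?_)
      (Eventually.of_forall fun x k => ?_)
    · have h2 : Tendsto (fun x => ‖coeff (v x) k - coeff (v x₀) k‖ ^ 2) (𝓝 x₀)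
          (𝓝 (‖coeff (v x₀) k - coeff (v x₀) k‖ ^ 2)) :=
        ((((hc k).tendsto x₀).sub_const _).norm.pow 2)
      simpa using h2
    · rw [Real.norm_of_nonneg (by positivity)]
      have h3 := norm_sub_le (coeff (v x) k) (coeff (v x₀) k)
      have h4 := hle x k
      have h5 := hle x₀ k
      have h6 : ‖coeff (v x) k - coeff (v x₀) k‖ ^ 2
          ≤ (‖coeff (v x) k‖ + ‖coeff (v x₀) k‖) ^ 2 := by gcongr
      nlinarith [sq_nonneg (‖coeff (v x) k‖ - ‖coeff (v x₀) k‖)]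
  have h2 : ∀ x, ‖v x - v x₀‖ = √(∑' k, ‖coeff (v x) k - coeff (v x₀) k‖ ^ 2) := fun x => by
    simp_rw [← L2T_coeff_sub]
    rw [(L2T_parseval (v x - v x₀)).tsum_eq, Real.sqrt_sq (norm_nonneg _)]
  simp_rw [h2]
  have h3 := (Real.continuous_sqrt.tendsto _).comp h1
  simpa [Function.comp_def] using h3

/-- A continuous curve in `L₂`, as an element of the path space. -/
theorem exists_pathX {p : ℝ≥0∞} (hp2 : p ≤ 2) {T : ℝ} (hT : 0 ≤ T) (v : C(Icc (0 : ℝ) T, L2T)) :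
    ∃ u : PathX p T, (∀ t, (u.curve t).IsFun (v t)) ∧ MemLp u.density 2 (spaceTime T) ∧
      ∀ᵐ t ∂timeMeasure T, ∀ k, coeff (fun x => u.density (t, x)) k
        = coeff (v (projIcc 0 T hT t)) k := by
  have hcont : ∀ k, Continuous fun t => coeff (v (projIcc 0 T hT t)) k := fun k =>
    (continuous_L2T_coeff k).comp (v.continuous.comp continuous_projIcc)
  obtain ⟨h, hh⟩ := exists_spaceTime_coeff (T := T)
    (a := fun k t => coeff (v (projIcc 0 T hT t)) k)
    (fun k => (hcont k).aestronglyMeasurable) (fun t _ k => coeff_neg _ k) (by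
      rw [← lintegral_tsum fun k => ((hcont k).enorm.measurable.pow_const 2).aemeasurable]
      simp_rw [tsum_enorm_coeff_L2T]
      refine (lintegral_mono (g := fun _ => ‖v‖ₑ ^ 2) fun t => ?_).trans_lt ?_
      · simp only
        gcongr
        rw [enorm_le_iff_norm_le]
        exact v.norm_coe_le_norm _
      · rw [lintegral_const]
        refine ENNReal.mul_lt_top (by simp) ?_
        simp)
  have hL2 : MemLp h 2 (spaceTime T) := Lp.memLp h
  have hLp : MemLp h p (spaceTime T) := hL2.mono_exponent hp2
  have hae := Measure.ae_ae_of_ae_prod hLp.coeFn_toLp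
  have hsl : ∀ᵐ t ∂timeMeasure T, Integrable fun x => h (t, x) :=
    (hL2.integrable (by norm_num)).prod_right_ae
  refine ⟨⟨⟨fun t => toHMinusOne (v t), continuous_toHMinusOne.comp v.continuous⟩, hLp.toLp, ?_⟩,
    fun t => isFun_toHMinusOne _, (memLp_congr_ae hLp.coeFn_toLp).2 hL2, ?_⟩
  · have h1 := ((hh.and hae).and hsl)
    rw [ae_restrict_iff' measurableSet_Icc] at h1
    filter_upwards [h1] with t h2 ht
    obtain ⟨⟨h3, h4⟩, h5⟩ := h2 ht
    refine ⟨h5.congr (EventuallyEq.symm h4), fun k => ?_⟩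
    rw [coeff_congr_ae h4, h3, projIcc_of_mem hT ht]
    rfl
  · filter_upwards [hh, hae] with t h3 h4 k
    rw [← h3, coeff_congr_ae h4]

/-! ### The reversed and damped Galerkin path -/

theorem lintegral_Icc_reflect (T : ℝ) (g : ℝ → ℝ≥0∞) :
    ∫⁻ t in Icc 0 T, g (T - t) = ∫⁻ t in Icc 0 T, g t := by
  rw [← lintegral_indicator measurableSet_Icc, ← lintegral_indicator measurableSet_Icc,
    ← lintegral_sub_left_eq_self ((Icc 0 T).indicator g) T]
  refine lintegral_congr fun t => ?_
  have : t ∈ Icc 0 T ↔ T - t ∈ Icc 0 T := by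
    rw [mem_Icc, mem_Icc]; constructor <;> rintro ⟨h1, h2⟩ <;> constructor <;> linarith
  by_cases ht : t ∈ Icc 0 T
  · rw [indicator_of_mem ht, indicator_of_mem (this.1 ht)]
  · rw [indicator_of_notMem ht, indicator_of_notMem fun h => ht (this.2 h)]

theorem tsum_coeff_comp_sub_le {f : ℝ → ℝ} {K : NNReal} (hf : LipschitzWith K f)
    {g h : UnitAddCircle → ℝ} (hg : MemLp g 2) (hh : MemLp h 2) :
    ∑' k, ‖coeff (fun x => f (g x)) k - coeff (fun x => f (h x)) k‖ₑ ^ 2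
      ≤ (K : ℝ≥0∞) ^ 2 * ∑' k, ‖coeff g k - coeff h k‖ₑ ^ 2 := by
  have hfg := memLp_comp hf hg
  have hfh := memLp_comp hf hh
  simp_rw [← coeff_sub (hfg.integrable (by norm_num)) (hfh.integrable (by norm_num)),
    ← coeff_sub (hg.integrable (by norm_num)) (hh.integrable (by norm_num))]
  have e1 := tsum_enorm_coeff (g := fun x => f (g x) - f (h x)) (hfg.sub hfh)
  have e2 := tsum_enorm_coeff (g := fun x => g x - h x) (hg.sub hh)
  rw [e1, e2, ← lintegral_const_mul' _ _ (by simp)]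
  refine lintegral_mono fun x => ?_
  rw [← mul_pow, ← edist_eq_enorm_sub, ← edist_eq_enorm_sub]
  gcongr
  exact hf.edist_le_mul _ _

theorem lipschitz_coeff_comp {f : ℝ → ℝ} {K : NNReal} (hf : LipschitzWith K f) (k : ℤ) :
    LipschitzWith K fun g : L2T => coeff (fun x => f (g x)) k := by
  intro g h
  rw [edist_eq_enorm_sub, edist_eq_enorm_sub, ← ENNReal.pow_le_pow_left_iff two_ne_zero, mul_pow,
    ← tsum_enorm_coeff_L2T]
  simp_rw [L2T_coeff_sub]
  exact (ENNReal.le_tsum (f := fun k => ‖coeff (fun x => f (g x)) k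
    - coeff (fun x => f (h x)) k‖ₑ ^ 2) k).trans
    (tsum_coeff_comp_sub_le hf (L2T_memLp g) (L2T_memLp h))

/-- The Fourier coefficient of index `k` of the control `h` that drives the path
`r ↦ θ(r) c(r)`, run backwards in time. Here `q` and `F` are the coefficients of the
nonlinearity along the path and along the Galerkin solution, and `θ'` is the derivative of
`θ`. The mode `k = 0`, which the norm of `Ḣ_s` does not see, is set to zero. -/
def control (ε s θ θ' : ℝ) (c q F : ℤ → ℂ) (k : ℤ) : ℂ :=
  if k = 0 then 0 else ε * θ * c k
    + (lam s k : ℂ)⁻¹ * (2 * Real.pi * Complex.I * k * (q k - θ * F k) - θ' * c k)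

theorem control_neg {ε s θ θ' : ℝ} {c q F : ℤ → ℂ} (hc : ∀ k, c (-k) = conj (c k))
    (hq : ∀ k, q (-k) = conj (q k)) (hF : ∀ k, F (-k) = conj (F k)) (k : ℤ) :
    control ε s θ θ' c q F (-k) = conj (control ε s θ θ' c q F k) := by
  unfold control
  rcases eq_or_ne k 0 with rfl | hk
  · simp
  · rw [if_neg hk, if_neg (neg_ne_zero.2 hk), hc, hq, hF, lam_neg]
    simp only [map_add, map_mul, map_sub, map_inv₀, Complex.conj_ofReal, Complex.conj_I, map_ofNat,
      map_intCast]
    push_cast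
    ring

namespace IsGalerkin

variable {f : ℝ → ℝ} {K : NNReal} {B ε s : ℝ} {N : ℕ} {M : ℝ} {w : ℤ → ℂ} {c : ℤ → ℝ → ℂ}

/-- The coefficients of the nonlinearity of the Galerkin system. -/
def drift (f : ℝ → ℝ) (N : ℕ) (c : ℤ → ℝ → ℂ) (r : ℝ) (k : ℤ) : ℂ :=
  if k ∈ freqs N then coeff (fun x => f (trigPoly N (fun j => c j r) x)) k else 0

theorem drift_neg (r : ℝ) (k : ℤ) : drift f N c r (-k) = conj (drift f N c r k) := by
  unfold drift
  simp only [neg_mem_freqs]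
  split_ifs
  · exact coeff_neg _ _
  · simp

theorem continuousOn_drift (G : IsGalerkin f ε s N M w c) (hf : LipschitzWith K f) (k : ℤ) :
    ContinuousOn (fun r => drift f N c r k) (Icc 0 M) := by
  unfold drift
  by_cases hk : k ∈ freqs N
  · simp only [if_pos hk]
    intro r₀ hr₀
    rw [ContinuousWithinAt, tendsto_iff_norm_sub_tendsto_zero]
    refine squeeze_zero (fun r => norm_nonneg _)
      (fun r => norm_coeff_comp_trigPoly_sub_le hf N _ _ k) ?_
    have h1 : Tendsto (fun r => (K : ℝ) * ∑ j ∈ freqs N, ‖c j r - c j r₀‖) (𝓝[Icc 0 M] r₀)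
        (𝓝 (K * ∑ j ∈ freqs N, ‖c j r₀ - c j r₀‖)) :=
      (tendsto_finsetSum _ fun j _ => ((G.continuousOn j r₀ hr₀).sub_const _).norm).const_mul _
    simpa using h1
  · simp only [if_neg hk]
    exact continuousOn_const

/-- The damped Galerkin solution `θ c`, with the mean kept, as a continuous curve in `L₂`. -/
theorem exists_profile (G : IsGalerkin f ε s N M w c) (hf : LipschitzWith K f)
    (hB : ∀ v, |f v| ≤ B) (hε : 0 < ε) (hM : 0 ≤ M) (hw : Summable fun k => ‖w k‖ ^ 2) {θ : ℝ → ℝ}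
    (hθc : Continuous θ) (hθ : ∀ r, |θ r| ≤ 1) :
    ∃ V : ℝ → L2T, (∀ r ∈ Icc 0 M, ∀ k, coeff (V r) k = if k = 0 then w 0 else θ r * c k r) ∧
      ContinuousOn V (Icc 0 M) := by
  have hle : ∀ r ∈ Icc 0 M, ∀ k,
      ‖(if k = 0 then w 0 else θ r * c k r : ℂ)‖ ^ 2 ≤ modeBound N w k := fun r hr k => by
    split_ifs with hk
    · rw [hk, ← G.init 0]
      exact G.sq_le_modeBound hf hB hε 0 ⟨le_rfl, hM⟩
    · refine le_trans ?_ (G.sq_le_modeBound hf hB hε k hr)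
      rw [norm_mul, Complex.norm_real, Real.norm_eq_abs]
      have := mul_le_mul_of_nonneg_right (hθ r) (norm_nonneg (c k r))
      rw [one_mul] at this
      gcongr
  have hex : ∀ r, ∃ g : L2T, r ∈ Icc 0 M →
      ∀ k, coeff g k = if k = 0 then w 0 else θ r * c k r := fun r => by
    by_cases hr : r ∈ Icc 0 M
    · obtain ⟨g, hg⟩ := exists_L2T_coeff (a := fun k => if k = 0 then w 0 else θ r * c k r)
        (fun k => by
          simp only [neg_eq_zero]
          split_ifs
          · rw [← G.init 0, ← G.symm 0 0, neg_zero]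
          · rw [G.symm, map_mul, Complex.conj_ofReal])
        ((summable_modeBound hw).of_nonneg_of_le (fun k => by positivity) (hle r hr))
      exact ⟨g, fun _ => hg⟩
    · exact ⟨0, fun h => absurd h hr⟩
  choose V hV using hex
  refine ⟨V, hV, ?_⟩
  rw [continuousOn_iff_continuous_domRestrict]
  refine continuous_of_coeff (fun k => ?_) (summable_modeBound (N := N) hw) fun r k => ?_
  · have h1 : ∀ r : Icc 0 M, coeff ((Icc 0 M).domRestrict V r) k
        = if k = 0 then w 0 else θ r * c k r := fun r => hV r r.2 k
    simp_rw [h1]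
    split_ifs
    · exact continuous_const
    · exact (Complex.continuous_ofReal.comp (hθc.comp continuous_subtype_val)).mul
        (continuousOn_iff_continuous_domRestrict.1 (G.continuousOn k))
  · rw [domRestrict_apply, hV r r.2 k]
    exact hle r r.2 k

end IsGalerkin

namespace IsGalerkin

variable {f : ℝ → ℝ} {K : NNReal} {B ε s : ℝ} {N : ℕ} {M : ℝ} {c : ℤ → ℝ → ℂ}

theorem hasDerivAt {w : ℤ → ℂ} (G : IsGalerkin f ε s N M w c) (k : ℤ) {r : ℝ} (hr : r ∈ Icc 0 M) :
    HasDerivAt (c k) (2 * Real.pi * Complex.I * k * drift f N c r k - ε / 2 * lam s k * c k r) r := by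
  refine (G.deriv k r hr).congr_deriv ?_
  unfold drift
  split_ifs <;> simp

/-- The squared norm in `Ḣ_s` of the control of the damped Galerkin path `V` at the reversed
time `r`. -/
def controlSq (f : ℝ → ℝ) (ε s : ℝ) (N : ℕ) (c : ℤ → ℝ → ℂ) (θ θ' : ℝ → ℝ) (V : ℝ → L2T)
    (r : ℝ) : ℝ≥0∞ :=
  ∑' k, ENNReal.ofReal (lam s k * ‖control ε s (θ r) (θ' r) (fun k => c k r)
    (coeff fun x => f (V r x)) (drift f N c r) k‖ ^ 2)

theorem enorm_control_sq_le (hs : 0 < s) (θ θ' : ℝ) (a q F : ℤ → ℂ) (k : ℤ) :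
    ‖control ε s θ θ' a q F k‖ₑ ^ 2
      ≤ ENNReal.ofReal (lam s k * ‖control ε s θ θ' a q F k‖ ^ 2) := by
  rw [← ofReal_norm, ← ENNReal.ofReal_pow (norm_nonneg _)]
  refine ENNReal.ofReal_le_ofReal ?_
  rcases eq_or_ne k 0 with rfl | hk
  · simp [control]
  · exact le_mul_of_one_le_left (by positivity) (one_le_lam hs hk)

/-- The damped Galerkin path, run backwards in time, joins the mean `m` of `w` to `w`, and its cost
is that of its control. -/
theorem quasipotential_le {p : ℝ≥0∞} (hp2 : p ≤ 2) (hs : 0 < s) (hf : LipschitzWith K f)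
    (hB : ∀ v, |f v| ≤ B) (hε : 0 < ε) {w : L2T} {m : ℝ} (hm : coeff w 0 = m)
    (G : IsGalerkin f ε s N M (coeff w) c) {T : ℝ} (hT : 0 < T) (hTM : T ≤ M) {θ θ' : ℝ → ℝ}
    (hθd : ∀ r, HasDerivAt θ (θ' r) r) (hθ'c : Continuous θ') (hθ : ∀ r, |θ r| ≤ 1)
    (hθ0 : θ 0 = 1) (hθT : θ T = 0) {V : ℝ → L2T}
    (hV : ∀ r ∈ Icc 0 M, ∀ k, coeff (V r) k = if k = 0 then coeff w 0 else θ r * c k r)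
    (hVc : ContinuousOn V (Icc 0 M))
    (hfin : ∫⁻ r in Icc 0 T, controlSq f ε s N c θ θ' V r < ⊤) :
    quasipotential p ε s f m w
      ≤ ENNReal.ofReal (ε⁻¹ / 2) * ∫⁻ r in Icc 0 T, controlSq f ε s N c θ θ' V r := by
  have hmaps : ∀ t ∈ Icc 0 T, T - t ∈ Icc 0 M := fun t ht =>
    ⟨by linarith [ht.2], by linarith [ht.1]⟩
  have hrefl : ContinuousOn (fun t : ℝ => T - t) (Icc 0 T) := by fun_prop
  have hθc : Continuous θ := continuous_iff_continuousAt.2 fun r => (hθd r).continuousAt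
  have hcc : ∀ k, ContinuousOn (fun t => c k (T - t)) (Icc 0 T) := fun k =>
    (G.continuousOn k).comp hrefl hmaps
  have hdc : ∀ k, ContinuousOn (fun t => drift f N c (T - t) k) (Icc 0 T) := fun k =>
    (G.continuousOn_drift hf k).comp hrefl hmaps
  have hqc : ∀ k, ContinuousOn (fun t => coeff (fun x => f (V (T - t) x)) k) (Icc 0 T) := fun k =>
    (lipschitz_coeff_comp hf k).continuous.comp_continuousOn (hVc.comp hrefl hmaps)
  have hθR : ContinuousOn (fun t => (θ (T - t) : ℂ)) (Icc 0 T) :=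
    Complex.continuous_ofReal.comp_continuousOn (hθc.comp_continuousOn hrefl)
  have hθ'R : ContinuousOn (fun t => (θ' (T - t) : ℂ)) (Icc 0 T) :=
    Complex.continuous_ofReal.comp_continuousOn (hθ'c.comp_continuousOn hrefl)
  obtain ⟨u, hu1, hu2, hu3⟩ := exists_pathX hp2 hT.le
    ⟨fun t : Icc 0 T => V (T - t), by
      have := continuousOn_iff_continuous_domRestrict.1 (hVc.comp hrefl hmaps)
      exact this⟩
  have hu4 : ∀ᵐ t ∂timeMeasure T, ∀ k, coeff (fun x => u.density (t, x)) k
      = if k = 0 then coeff w 0 else θ (T - t) * c k (T - t) := by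
    have hmem' : ∀ᵐ t ∂timeMeasure T, t ∈ Icc 0 T := ae_restrict_mem measurableSet_Icc
    filter_upwards [hu3, hmem'] with t h1 ht k
    rw [h1, ← hV _ (hmaps t ht), projIcc_of_mem hT.le ht]
    rfl
  have hctrl : ∀ k, ContinuousOn (fun t => control ε s (θ (T - t)) (θ' (T - t))
      (fun k => c k (T - t)) (coeff fun x => f (V (T - t) x)) (drift f N c (T - t)) k)
      (Icc 0 T) := fun k => by
    unfold control
    split_ifs
    · exact continuousOn_const
    · exact ((continuousOn_const.mul hθR).mul (hcc k)).add (continuousOn_const.mul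
        ((continuousOn_const.mul ((hqc k).sub (hθR.mul (hdc k)))).sub (hθ'R.mul (hcc k))))
  obtain ⟨h, hh⟩ := exists_spaceTime_coeff (T := T)
    (a := fun k t => control ε s (θ (T - t)) (θ' (T - t)) (fun k => c k (T - t))
      (coeff fun x => f (V (T - t) x)) (drift f N c (T - t)) k)
    (fun k => (hctrl k).aestronglyMeasurable measurableSet_Icc)
    (fun t _ k => control_neg (fun k => G.symm k _) (coeff_neg _) (drift_neg _) k) (by
      rw [← lintegral_tsum fun k => ?_]
      · refine (lintegral_mono fun t => ?_).trans_lt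
          ((lintegral_Icc_reflect T (controlSq f ε s N c θ θ' V)).trans_lt hfin)
        exact ENNReal.tsum_le_tsum fun k => enorm_control_sq_le hs _ _ _ _ _ k
      · exact ((hctrl k).aestronglyMeasurable measurableSet_Icc).enorm.pow_const 2)
  have hhSq : spaceHSq s T h = ∫⁻ r in Icc 0 T, controlSq f ε s N c θ θ' V r := by
    rw [← lintegral_Icc_reflect, spaceHSq]
    refine lintegral_congr_ae ?_
    filter_upwards [hh] with t ht
    rw [hDotSq_eq]
    simp_rw [ht]
    rfl
  have huL : Integrable u.density (spaceTime T) := hu2.integrable (by norm_num)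
  have hfuL : Integrable (fun q => f (u.density q)) (spaceTime T) :=
    (memLp_comp hf hu2).integrable (by norm_num)
  have huV : ∀ᵐ t ∂timeMeasure T, (fun x => u.density (t, x)) =ᵐ[volume] V (T - t) := by
    have hsl : ∀ᵐ t ∂timeMeasure T, Integrable fun x => u.density (t, x) := huL.prod_right_ae
    have hmem' : ∀ᵐ t ∂timeMeasure T, t ∈ Icc 0 T := ae_restrict_mem measurableSet_Icc
    filter_upwards [hu3, hsl, hmem'] with t h1 h2 ht
    refine (isFun_toHMinusOne (V (T - t))).ae_eq ⟨h2, fun k => ?_⟩ |>.symm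
    rw [h1, projIcc_of_mem hT.le ht]
    rfl
  have heq : ∀ φ, IsTest T φ → eqnDefect ε s f T u.density φ
      = ∫ q, h q * fracLap s (φ q.1) q.2 ∂spaceTime T := by
    intro φ hφ
    refine eqnDefect_eq_of_modes hT huL hfuL ((Lp.memLp h).integrable (by norm_num))
      (α := fun k t => if k = 0 then coeff w 0 else θ (T - t) * c k (T - t))
      (α' := fun k t => if k = 0 then 0 else -(θ' (T - t) * c k (T - t) + θ (T - t)
        * (2 * Real.pi * Complex.I * k * drift f N c (T - t) k
          - ε / 2 * lam s k * c k (T - t))))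
      (fun k t ht => ?_) (fun k => ?_) hu4 ?_ hφ
    · split_ifs
      · exact hasDerivAt_const _ _
      · have h1 : HasDerivAt (fun r => (θ r : ℂ) * c k r) _ (T - t) :=
          (hθd (T - t)).ofReal_comp.mul (G.hasDerivAt k (hmaps t ht))
        exact h1.comp_const_sub T t
    · refine ContinuousOn.integrableOn_Icc ?_
      split_ifs
      · exact continuousOn_const
      · exact ((hθ'R.mul (hcc k)).add (hθR.mul ((continuousOn_const.mul (hdc k)).sub
          (continuousOn_const.mul (hcc k))))).neg
    · filter_upwards [hh, huV] with t h1 h2 k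
      have h3 : coeff (fun x => f (u.density (t, x))) k = coeff (fun x => f (V (T - t) x)) k := by
        refine congrFun (coeff_congr_ae ?_) k
        filter_upwards [h2] with x hx
        rw [hx]
      rw [h1, h3]
      unfold control
      rcases eq_or_ne k 0 with rfl | hk
      -- for `k = 0` both sides vanish: `λ₀ = 0`, and the mean does not move
      · simp [lam_zero hs]
      · have h4 : (lam s k : ℂ) ≠ 0 :=
          Complex.ofReal_ne_zero.2 (zero_lt_one.trans_le (one_le_lam hs hk)).ne'
        simp only [if_neg hk]
        field_simp
        ring
  have h0 : u.AtTime 0 (constProfile m) := by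
    refine ⟨⟨le_rfl, hT.le⟩, L2T_integrable _, fun k => ?_⟩
    rw [(hu1 ⟨0, le_rfl, hT.le⟩).2]
    change coeff (V (T - 0)) k = _
    rw [sub_zero, hV T ⟨hT.le, hTM⟩, hθT]
    split_ifs with hk
    · rw [hk, hm, coeff_constProfile_zero]
    · rw [coeff_constProfile_ne m hk]; simp
  have h1 : u.AtTime T w := by
    refine ⟨⟨hT.le, le_rfl⟩, L2T_integrable _, fun k => ?_⟩
    rw [(hu1 ⟨T, hT.le, le_rfl⟩).2]
    change coeff (V (T - T)) k = _
    rw [sub_self, hV 0 ⟨le_rfl, hT.le.trans hTM⟩, hθ0, G.init]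
    split_ifs with hk
    · rw [hk]
    · simp
  have hsp : spaceHSq s T u.density < ⊤ := by
    have h2 : spaceHSq s T u.density ≤ ∫⁻ t in Icc 0 T, sobolevSq s c (T - t) := by
      refine lintegral_mono_ae ?_
      filter_upwards [hu4] with t ht
      rw [hDotSq_eq]
      refine ENNReal.tsum_le_tsum fun k => ENNReal.ofReal_le_ofReal ?_
      rw [ht]
      split_ifs with hk
      · rw [hk, lam_zero hs, zero_mul, zero_mul]
      · rw [norm_mul, Complex.norm_real, Real.norm_eq_abs]
        have h3 := mul_le_mul_of_nonneg_right (hθ (T - t)) (norm_nonneg (c k (T - t)))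
        rw [one_mul] at h3
        have := lam_nonneg s k
        gcongr
    refine h2.trans_lt ?_
    rw [lintegral_Icc_reflect T (sobolevSq s c)]
    refine (lintegral_mono_set (Icc_subset_Icc_right hTM)).trans_lt
      ((G.lintegral_sobolevSq_le hf hB hε hs (hT.trans_le hTM) (D := ‖w‖ ^ 2)
        fun S => ?_).trans_lt ENNReal.ofReal_lt_top)
    exact sum_le_hasSum _ (fun k _ => by positivity) (L2T_parseval w)
  refine iInf_le_of_le T (iInf_le_of_le hT (iInf_le_of_le u (iInf_le_of_le h0
    (iInf_le_of_le h1 ?_))))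
  unfold cost
  rw [if_pos ⟨hsp, ⟨_, hu1⟩, h0⟩, ← hhSq]
  gcongr
  exact iInf_le_of_le h (iInf_le_of_le (hhSq.trans_lt hfin) (iInf_le_of_le heq le_rfl))

end IsGalerkin

/-! ### Estimates for the control -/

theorem sq_le_lam_mul_lam {σ s : ℝ} (hσ : 1 / 2 ≤ σ) (hs : 1 / 2 ≤ s) (k : ℤ) :
    (2 * Real.pi * |(k : ℝ)|) ^ 2 ≤ lam s k * lam σ k := by
  have h0 : 0 ≤ 2 * Real.pi * |(k : ℝ)| := by positivity
  rw [sq]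
  exact mul_le_mul (two_pi_abs_le_lam hs k) (two_pi_abs_le_lam hσ k) h0 (lam_nonneg _ _)

theorem two_pi_mul_le_of_notMem_freqs {N : ℕ} {k : ℤ} (hk : k ∉ freqs N) :
    2 * Real.pi * N ≤ 2 * Real.pi * |(k : ℝ)| := by
  rw [mem_freqs, not_le] at hk
  have h1 : ((N : ℤ) : ℝ) ≤ ((|k| : ℤ) : ℝ) := by exact_mod_cast hk.le
  rw [Int.cast_abs] at h1
  push_cast at h1
  gcongr

theorem two_pi_mul_pos {N : ℕ} (hN : 1 ≤ N) : 0 < 2 * Real.pi * N := by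
  have : (0 : ℝ) < N := by exact_mod_cast hN
  positivity

/-- The squared weight of `∂ₓ` as a map from `Ḣ_σ` to `Ḣ_{-s}`, on high frequencies. The exponent `2 - 4σ`
is negative if `σ > 1/2`. -/
theorem sq_le_of_notMem_freqs {σ s : ℝ} (hσ : 1 / 2 ≤ σ) (hσs : σ ≤ s) {N : ℕ} (hN : 1 ≤ N) {k : ℤ}
    (hk : k ∉ freqs N) :
    (2 * Real.pi * |(k : ℝ)|) ^ 2 ≤ (2 * Real.pi * N) ^ (2 - 4 * σ) * (lam s k * lam σ k) := by
  have h1 := two_pi_mul_le_of_notMem_freqs hk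
  have h0 := two_pi_mul_pos hN
  have h2 := h0.trans_le h1
  have h3 : (2 * Real.pi * |(k : ℝ)|) ^ 2
      = (2 * Real.pi * |(k : ℝ)|) ^ (2 - 4 * σ) * (lam σ k * lam σ k) := by
    unfold lam
    rw [← Real.rpow_add h2, ← Real.rpow_add h2, ← Real.rpow_natCast]
    congr 1; push_cast; ring
  rw [h3]
  have h4 := lam_mono (by linarith) hσs k
  have h5 := lam_nonneg σ k
  refine mul_le_mul ?_ (by gcongr) (by positivity) (by positivity)
  exact Real.rpow_le_rpow_of_nonpos h0 h1 (by linarith)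

/-- The squared weight of `∂ₓ` as a map from `L₂` to `Ḣ_{-s}`, on low frequencies. -/
theorem sq_le_of_mem_freqs {σ s : ℝ} (hσ : 1 / 2 ≤ σ) (hσ1 : σ ≤ 1) (hσs : σ ≤ s) {N : ℕ} {k : ℤ}
    (hk : k ∈ freqs N) (hk0 : k ≠ 0) :
    (2 * Real.pi * |(k : ℝ)|) ^ 2 ≤ (2 * Real.pi * N) ^ (2 - 2 * σ) * lam s k := by
  have h1 : 2 * Real.pi * |(k : ℝ)| ≤ 2 * Real.pi * N := by
    rw [mem_freqs] at hk
    have h1 : ((|k| : ℤ) : ℝ) ≤ ((N : ℤ) : ℝ) := by exact_mod_cast hk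
    rw [Int.cast_abs] at h1
    push_cast at h1
    gcongr
  have h2 : 0 < 2 * Real.pi * |(k : ℝ)| := zero_lt_one.trans_le (one_le_two_pi_mul_abs hk0)
  have h3 : (2 * Real.pi * |(k : ℝ)|) ^ 2
      = (2 * Real.pi * |(k : ℝ)|) ^ (2 - 2 * σ) * lam σ k := by
    unfold lam
    rw [← Real.rpow_add h2, ← Real.rpow_natCast]
    congr 1; push_cast; ring
  rw [h3]
  exact mul_le_mul (Real.rpow_le_rpow h2.le h1 (by linarith)) (lam_mono (by linarith) hσs k)
    (lam_nonneg _ _) (by positivity)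

theorem one_le_of_notMem_freqs {σ s : ℝ} (hσ : 0 < σ) (hσs : σ ≤ s) {N : ℕ} (hN : 1 ≤ N) {k : ℤ}
    (hk : k ∉ freqs N) : 1 ≤ (2 * Real.pi * N) ^ (-2 * σ) * lam s k := by
  have h0 := two_pi_mul_pos hN
  have h1 : (2 * Real.pi * N) ^ (2 * σ) ≤ lam s k :=
    (Real.rpow_le_rpow h0.le (two_pi_mul_le_of_notMem_freqs hk) (by linarith)).trans (lam_mono hσ hσs k)
  refine le_trans (le_of_eq ?_) (mul_le_mul_of_nonneg_left h1 (by positivity))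
  rw [← Real.rpow_add h0]
  simp

theorem norm_add_sq_le_mul {E : Type*} [SeminormedAddCommGroup E] (a b : E) {η : ℝ} (hη : 0 < η) :
    ‖a + b‖ ^ 2 ≤ (1 + η) * ‖a‖ ^ 2 + (1 + η⁻¹) * ‖b‖ ^ 2 := by
  have h1 : ‖a + b‖ ^ 2 ≤ (‖a‖ + ‖b‖) ^ 2 := by gcongr; exact norm_add_le a b
  have h2 : 0 ≤ η⁻¹ * (η * ‖a‖ - ‖b‖) ^ 2 := by positivity
  have h3 : η⁻¹ * (η * ‖a‖ - ‖b‖) ^ 2 = η * ‖a‖ ^ 2 - 2 * ‖a‖ * ‖b‖ + η⁻¹ * ‖b‖ ^ 2 := by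
    field_simp
    ring
  nlinarith

theorem norm_two_pi_I_mul (k : ℤ) (z : ℂ) :
    ‖2 * Real.pi * Complex.I * k * z‖ = 2 * Real.pi * |(k : ℝ)| * ‖z‖ := by
  rw [norm_mul, norm_mul, norm_mul, norm_mul, Complex.norm_I, Complex.norm_intCast,
    Complex.norm_real, Real.norm_of_nonneg Real.pi_pos.le]
  simp

/-- The bound for the control as long as the Galerkin solution is not damped. -/
theorem lam_mul_control_sq_le {ε s η : ℝ} (hs : 0 < s) (hη : 0 < η) (a q F : ℤ → ℂ) {k : ℤ}
    (hk : k ≠ 0) :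
    lam s k * ‖control ε s 1 0 a q F k‖ ^ 2 ≤ (1 + η) * ε ^ 2 * (lam s k * ‖a k‖ ^ 2)
      + (1 + η⁻¹) * ((lam s k)⁻¹ * (2 * Real.pi * |(k : ℝ)|) ^ 2 * ‖q k - F k‖ ^ 2) := by
  have hL : 0 < lam s k := zero_lt_one.trans_le (one_le_lam hs hk)
  have h1 : control ε s 1 0 a q F k
      = ε * a k + (lam s k : ℂ)⁻¹ * (2 * Real.pi * Complex.I * k * (q k - F k)) := by
    simp [control, hk]
  have h2 : ‖(ε : ℂ) * a k‖ ^ 2 = ε ^ 2 * ‖a k‖ ^ 2 := by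
    rw [norm_mul, Complex.norm_real, mul_pow, Real.norm_eq_abs, sq_abs]
  have h3 : ‖(lam s k : ℂ)⁻¹ * (2 * Real.pi * Complex.I * k * (q k - F k))‖ ^ 2
      = (lam s k)⁻¹ ^ 2 * ((2 * Real.pi * |(k : ℝ)|) ^ 2 * ‖q k - F k‖ ^ 2) := by
    rw [norm_mul, norm_inv, norm_two_pi_I_mul, Complex.norm_real, Real.norm_of_nonneg hL.le, mul_pow,
      mul_pow]
  rw [h1]
  refine (mul_le_mul_of_nonneg_left (norm_add_sq_le_mul _ _ hη) hL.le).trans_eq ?_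
  rw [h2, h3]
  field_simp

/-- The bound for the control while the Galerkin solution is damped. -/
theorem lam_mul_control_sq_le_of_abs_le {ε s σ θ θ' C : ℝ} (hs : 1 / 2 ≤ s) (hσ : 1 / 2 ≤ σ)
    (hθ : |θ| ≤ 1) (hθ' : |θ'| ≤ C) (a q F : ℤ → ℂ) {k : ℤ} (hk : k ≠ 0) :
    lam s k * ‖control ε s θ θ' a q F k‖ ^ 2 ≤ 4 * (ε ^ 2 + C ^ 2) * (lam s k * ‖a k‖ ^ 2)
      + 4 * (lam σ k * ‖q k‖ ^ 2) + 4 * (lam σ k * ‖F k‖ ^ 2) := by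
  have hL1 := one_le_lam (show 0 < s by linarith) hk
  have hL : 0 < lam s k := zero_lt_one.trans_le hL1
  set X := 2 * Real.pi * |(k : ℝ)| with hX
  have hX0 : 0 ≤ X := by positivity
  have hX2 := sq_le_lam_mul_lam hσ hs k
  rw [← hX] at hX2
  have h1 : control ε s θ θ' a q F k = ε * θ * a k
      + (lam s k : ℂ)⁻¹ * (2 * Real.pi * Complex.I * k * q k)
      + (lam s k : ℂ)⁻¹ * (-θ * (2 * Real.pi * Complex.I * k * F k))
      + (lam s k : ℂ)⁻¹ * (-θ' * a k) := by
    simp only [control, if_neg hk]; ring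
  have hinv : ‖(lam s k : ℂ)⁻¹‖ = (lam s k)⁻¹ := by
    rw [norm_inv, Complex.norm_real, Real.norm_of_nonneg hL.le]
  have e1 : ‖(ε * θ * a k : ℂ)‖ ^ 2 ≤ ε ^ 2 * ‖a k‖ ^ 2 := by
    rw [norm_mul, norm_mul, Complex.norm_real, Complex.norm_real, mul_pow, mul_pow,
      Real.norm_eq_abs, sq_abs, Real.norm_eq_abs]
    have : |θ| ^ 2 ≤ 1 := pow_le_one₀ (abs_nonneg _) hθ
    nlinarith [mul_nonneg (sq_nonneg ε) (sq_nonneg ‖a k‖)]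
  have e2 : ‖(lam s k : ℂ)⁻¹ * (2 * Real.pi * Complex.I * k * q k)‖ ^ 2
      = (lam s k)⁻¹ ^ 2 * X ^ 2 * ‖q k‖ ^ 2 := by
    rw [norm_mul, hinv, norm_two_pi_I_mul, ← hX, mul_pow, mul_pow, mul_assoc]
  have e3 : ‖(lam s k : ℂ)⁻¹ * (-θ * (2 * Real.pi * Complex.I * k * F k))‖ ^ 2
      ≤ (lam s k)⁻¹ ^ 2 * X ^ 2 * ‖F k‖ ^ 2 := by
    rw [norm_mul, hinv, norm_mul, norm_two_pi_I_mul, norm_neg, Complex.norm_real,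
      Real.norm_eq_abs, ← hX, mul_pow, mul_assoc (_ ^ 2), ← mul_pow X]
    have := mul_le_mul_of_nonneg_right hθ (show 0 ≤ X * ‖F k‖ by positivity)
    rw [one_mul] at this
    gcongr
  have e4 : ‖(lam s k : ℂ)⁻¹ * (-θ' * a k)‖ ^ 2 ≤ (lam s k)⁻¹ ^ 2 * C ^ 2 * ‖a k‖ ^ 2 := by
    rw [norm_mul, hinv, norm_mul, norm_neg, Complex.norm_real, Real.norm_eq_abs, mul_assoc,
      ← mul_pow, ← mul_pow]
    gcongr
  have h2 : ∀ x y z t : ℂ,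
      ‖x + y + z + t‖ ^ 2 ≤ 4 * (‖x‖ ^ 2 + ‖y‖ ^ 2 + ‖z‖ ^ 2 + ‖t‖ ^ 2) := fun x y z t => by
    have i1 := norm_add_sq_le_mul (x + y + z) t (η := 1 / 3) (by norm_num)
    have i2 := norm_add_sq_le_mul (x + y) z (η := 1 / 2) (by norm_num)
    have i3 := norm_add_sq_le_mul x y (η := 1) (by norm_num)
    norm_num at i1 i2 i3
    linarith
  have h3 : lam s k * ((lam s k)⁻¹ ^ 2 * X ^ 2) ≤ lam σ k := by
    rw [sq (lam s k)⁻¹, mul_assoc, mul_inv_cancel_left₀ hL.ne', inv_mul_le_iff₀ hL]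
    exact hX2
  have h4 : lam s k * ((lam s k)⁻¹ ^ 2 * C ^ 2) ≤ C ^ 2 * lam s k := by
    rw [sq (lam s k)⁻¹, mul_assoc, mul_inv_cancel_left₀ hL.ne', mul_comm]
    exact mul_le_mul_of_nonneg_left ((inv_le_one_of_one_le₀ hL1).trans hL1) (sq_nonneg C)
  rw [h1]
  calc _ ≤ lam s k * (4 * (ε ^ 2 * ‖a k‖ ^ 2 + (lam s k)⁻¹ ^ 2 * X ^ 2 * ‖q k‖ ^ 2
        + (lam s k)⁻¹ ^ 2 * X ^ 2 * ‖F k‖ ^ 2 + (lam s k)⁻¹ ^ 2 * C ^ 2 * ‖a k‖ ^ 2)) := by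
        refine mul_le_mul_of_nonneg_left ((h2 _ _ _ _).trans ?_) hL.le
        linarith
    _ = 4 * (ε ^ 2 * (lam s k * ‖a k‖ ^ 2)
        + lam s k * ((lam s k)⁻¹ ^ 2 * X ^ 2) * ‖q k‖ ^ 2
        + lam s k * ((lam s k)⁻¹ ^ 2 * X ^ 2) * ‖F k‖ ^ 2
        + lam s k * ((lam s k)⁻¹ ^ 2 * C ^ 2) * ‖a k‖ ^ 2) := by ring
    _ ≤ 4 * (ε ^ 2 * (lam s k * ‖a k‖ ^ 2) + lam σ k * ‖q k‖ ^ 2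
        + lam σ k * ‖F k‖ ^ 2 + C ^ 2 * lam s k * ‖a k‖ ^ 2) := by gcongr
    _ = _ := by ring

theorem ofReal_add_mul_le {x y z a b : ℝ} (ha : 0 ≤ a) (hb : 0 ≤ b)
    (h : x ≤ a * y + b * z) :
    ENNReal.ofReal x ≤ ENNReal.ofReal a * ENNReal.ofReal y + ENNReal.ofReal b * ENNReal.ofReal z := by
  rw [← ENNReal.ofReal_mul ha, ← ENNReal.ofReal_mul hb]
  exact (ENNReal.ofReal_le_ofReal h).trans ENNReal.ofReal_add_le

namespace IsGalerkin

variable {f : ℝ → ℝ} {K : NNReal} {B ε s σ : ℝ} {N : ℕ} {M : ℝ} {w : ℤ → ℂ} {c : ℤ → ℝ → ℂ}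
  {θ θ' : ℝ → ℝ} {V : ℝ → L2T} {r : ℝ}

theorem hDotSq_comp_le_sobolevSq (hσ : 0 < σ) (hσ1 : σ < 1) (hσs : σ ≤ s) (hf : LipschitzWith K f)
    {g : UnitAddCircle → ℝ} (hg : MemLp g 2) (h : ∀ k ≠ 0, ‖coeff g k‖ ≤ ‖c k r‖) :
    hDotSq σ (fun x => f (g x)) ≤ (K : ℝ≥0∞) ^ 2 * sobolevSq s c r := by
  refine (hDotSq_comp_le hσ hσ1 hf hg).trans ?_
  gcongr
  refine (hDotSq_mono hσ hσs g).trans ?_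
  rw [hDotSq_eq]
  refine ENNReal.tsum_le_tsum fun k => ENNReal.ofReal_le_ofReal ?_
  rcases eq_or_ne k 0 with rfl | hk
  · rw [lam_zero (hσ.trans_le hσs), zero_mul, zero_mul]
  · have := lam_nonneg s k
    have := h k hk
    gcongr

theorem tsum_drift_le (G : IsGalerkin f ε s N M w c) (hσ : 0 < σ) (hσ1 : σ < 1) (hσs : σ ≤ s)
    (hf : LipschitzWith K f) :
    ∑' k, ENNReal.ofReal (lam σ k * ‖drift f N c r k‖ ^ 2) ≤ (K : ℝ≥0∞) ^ 2 * sobolevSq s c r := by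
  refine le_trans ?_ (hDotSq_comp_le_sobolevSq hσ hσ1 hσs hf (memLp_trigPoly N fun j => c j r)
    fun k _ => ?_)
  · rw [hDotSq_eq]
    refine ENNReal.tsum_le_tsum fun k => ENNReal.ofReal_le_ofReal ?_
    have := lam_nonneg σ k
    gcongr
    unfold drift
    split_ifs
    · exact le_rfl
    · simp
  · rw [G.coeff_trig]
    split_ifs
    · exact le_rfl
    · simp

/-- While the Galerkin solution is damped, the control is bounded by the norm of the solution. -/
theorem controlSq_le_of_abs_le (G : IsGalerkin f ε s N M w c) (hσ : 1 / 2 ≤ σ) (hσ1 : σ < 1)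
    (hσs : σ ≤ s) (hf : LipschitzWith K f) {C : ℝ} (hθ : |θ r| ≤ 1) (hθ' : |θ' r| ≤ C)
    (hV : ∀ k, coeff (V r) k = if k = 0 then w 0 else θ r * c k r) :
    controlSq f ε s N c θ θ' V r
      ≤ ENNReal.ofReal (4 * (ε ^ 2 + C ^ 2) + 8 * K ^ 2) * sobolevSq s c r := by
  have hσ0 : 0 < σ := by linarith
  have hq := hDotSq_comp_le_sobolevSq (c := c) (r := r) hσ0 hσ1 hσs hf (L2T_memLp (V r))
    fun k hk => by
      rw [hV, if_neg hk, norm_mul, Complex.norm_real, Real.norm_eq_abs]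
      exact mul_le_of_le_one_left (norm_nonneg _) hθ
  have hF := G.tsum_drift_le (r := r) hσ0 hσ1 hσs hf
  rw [hDotSq_eq] at hq
  calc controlSq f ε s N c θ θ' V r
      ≤ ∑' k, (ENNReal.ofReal (4 * (ε ^ 2 + C ^ 2)) * ENNReal.ofReal (lam s k * ‖c k r‖ ^ 2)
        + 4 * ENNReal.ofReal (lam σ k * ‖coeff (fun x => f (V r x)) k‖ ^ 2)
        + 4 * ENNReal.ofReal (lam σ k * ‖drift f N c r k‖ ^ 2)) := by
        refine ENNReal.tsum_le_tsum fun k => ?_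
        rcases eq_or_ne k 0 with rfl | hk
        · simp [control]
        · have h4 : (4 : ℝ≥0∞) = ENNReal.ofReal 4 := by norm_num
          rw [← ENNReal.ofReal_mul (by positivity), h4, ← ENNReal.ofReal_mul (by norm_num),
            ← ENNReal.ofReal_mul (by norm_num)]
          refine (ENNReal.ofReal_le_ofReal (lam_mul_control_sq_le_of_abs_le (hσ.trans hσs) hσ hθ hθ'
            _ _ _ hk)).trans (ENNReal.ofReal_add_le.trans ?_)
          gcongr
          exact ENNReal.ofReal_add_le
    _ = ENNReal.ofReal (4 * (ε ^ 2 + C ^ 2)) * sobolevSq s c r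
        + 4 * ∑' k, ENNReal.ofReal (lam σ k * ‖coeff (fun x => f (V r x)) k‖ ^ 2)
        + 4 * ∑' k, ENNReal.ofReal (lam σ k * ‖drift f N c r k‖ ^ 2) := by
        rw [ENNReal.tsum_add, ENNReal.tsum_add, ENNReal.tsum_mul_left, ENNReal.tsum_mul_left,
          ENNReal.tsum_mul_left, sobolevSq]
    _ ≤ ENNReal.ofReal (4 * (ε ^ 2 + C ^ 2)) * sobolevSq s c r
        + 4 * ((K : ℝ≥0∞) ^ 2 * sobolevSq s c r) + 4 * ((K : ℝ≥0∞) ^ 2 * sobolevSq s c r) := by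
        gcongr
    _ = _ := by
        rw [ENNReal.ofReal_add (by positivity) (by positivity), ENNReal.ofReal_mul (p := 8)
          (by norm_num), ENNReal.ofReal_pow K.coe_nonneg, ENNReal.ofReal_coe_nnreal]
        norm_num
        ring

/-- Before the damping sets in, the control is `ε c` up to a defect that is small for large `N`:
the high modes of the nonlinearity are bounded through its `Ḣ_σ` norm, the low modes through the `L₂` norm of the
high modes of the solution. -/
theorem controlSq_le (G : IsGalerkin f ε s N M w c) (hσ : 1 / 2 ≤ σ) (hσ1 : σ < 1) (hσs : σ ≤ s)
    (hf : LipschitzWith K f) (hN : 1 ≤ N) {η : ℝ} (hη : 0 < η) (hr : r ∈ Icc 0 M) (hθ : θ r = 1)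
    (hθ' : θ' r = 0) (hV : ∀ k, coeff (V r) k = if k = 0 then w 0 else θ r * c k r) :
    controlSq f ε s N c θ θ' V r ≤ ENNReal.ofReal ((1 + η) * ε ^ 2
      + (1 + η⁻¹) * (2 * K ^ 2 * (2 * Real.pi * N) ^ (2 - 4 * σ))) * sobolevSq s c r := by
  have hσ0 : 0 < σ := by linarith
  have hs0 : 0 < s := hσ0.trans_le hσs
  have hY := two_pi_mul_pos hN
  have hVc : ∀ k, coeff (V r) k = c k r := fun k => by
    rw [hV, hθ]
    split_ifs with hk
    · rw [hk, G.mean_const hs0 hr]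
    · simp
  set q : ℤ → ℂ := coeff fun x => f (V r x) with hq_def
  set F : ℤ → ℂ := coeff fun x => f (trigPoly N (fun j => c j r) x) with hF_def
  have hq := hDotSq_comp_le_sobolevSq (c := c) (r := r) hσ0 hσ1 hσs hf (L2T_memLp (V r))
    fun k _ => by rw [hVc]
  rw [hDotSq_eq] at hq
  have hqF : ∑' k, ‖q k - F k‖ₑ ^ 2
      ≤ (K : ℝ≥0∞) ^ 2 * (ENNReal.ofReal ((2 * Real.pi * N) ^ (-2 * σ)) * sobolevSq s c r) := by
    refine (tsum_coeff_comp_sub_le hf (L2T_memLp (V r)) (memLp_trigPoly N fun j => c j r)).trans ?_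
    gcongr
    rw [sobolevSq, ← ENNReal.tsum_mul_left]
    refine ENNReal.tsum_le_tsum fun k => ?_
    rw [hVc, G.coeff_trig]
    split_ifs with hk
    · simp
    · rw [sub_zero, ← ofReal_norm, ← ENNReal.ofReal_pow (norm_nonneg _),
        ← ENNReal.ofReal_mul (by positivity), ← mul_assoc]
      refine ENNReal.ofReal_le_ofReal (le_mul_of_one_le_left (by positivity) ?_)
      exact one_le_of_notMem_freqs hσ0 hσs hN hk
  calc controlSq f ε s N c θ θ' V r
      ≤ ∑' k, (ENNReal.ofReal ((1 + η) * ε ^ 2) * ENNReal.ofReal (lam s k * ‖c k r‖ ^ 2)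
        + ENNReal.ofReal (1 + η⁻¹) * (ENNReal.ofReal ((2 * Real.pi * N) ^ (2 - 4 * σ))
          * ENNReal.ofReal (lam σ k * ‖q k‖ ^ 2)
          + ENNReal.ofReal ((2 * Real.pi * N) ^ (2 - 2 * σ)) * ‖q k - F k‖ₑ ^ 2)) := by
        refine ENNReal.tsum_le_tsum fun k => ?_
        rcases eq_or_ne k 0 with rfl | hk
        · simp [control]
        rw [hθ, hθ']
        have hL : 0 < lam s k := zero_lt_one.trans_le (one_le_lam hs0 hk)
        refine (ofReal_add_mul_le (by positivity) (by positivity)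
          (lam_mul_control_sq_le hs0 hη (fun k => c k r) q (drift f N c r) hk)).trans ?_
        gcongr
        by_cases hkN : k ∈ freqs N
        · refine le_trans ?_ le_add_self
          rw [ofReal_mul_enorm_sq (by positivity), drift, if_pos hkN]
          refine ENNReal.ofReal_le_ofReal (mul_le_mul_of_nonneg_right ?_ (by positivity))
          rw [inv_mul_le_iff₀ hL, mul_comm (lam s k)]
          exact sq_le_of_mem_freqs hσ hσ1.le hσs hkN hk
        · refine le_trans ?_ le_self_add
          rw [← ENNReal.ofReal_mul (by positivity), drift, if_neg hkN, sub_zero, ← mul_assoc]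
          refine ENNReal.ofReal_le_ofReal (mul_le_mul_of_nonneg_right ?_ (by positivity))
          rw [inv_mul_le_iff₀ hL]
          refine (sq_le_of_notMem_freqs hσ hσs hN hkN).trans_eq ?_
          ring
    _ = ENNReal.ofReal ((1 + η) * ε ^ 2) * sobolevSq s c r
        + ENNReal.ofReal (1 + η⁻¹) * (ENNReal.ofReal ((2 * Real.pi * N) ^ (2 - 4 * σ))
          * ∑' k, ENNReal.ofReal (lam σ k * ‖q k‖ ^ 2)
          + ENNReal.ofReal ((2 * Real.pi * N) ^ (2 - 2 * σ)) * ∑' k, ‖q k - F k‖ₑ ^ 2) := by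
        rw [ENNReal.tsum_add, ENNReal.tsum_mul_left, ENNReal.tsum_mul_left, ENNReal.tsum_add,
          ENNReal.tsum_mul_left, ENNReal.tsum_mul_left, sobolevSq]
    _ ≤ ENNReal.ofReal ((1 + η) * ε ^ 2) * sobolevSq s c r
        + ENNReal.ofReal (1 + η⁻¹) * (ENNReal.ofReal ((2 * Real.pi * N) ^ (2 - 4 * σ))
          * ((K : ℝ≥0∞) ^ 2 * sobolevSq s c r)
          + ENNReal.ofReal ((2 * Real.pi * N) ^ (2 - 2 * σ)) * ((K : ℝ≥0∞) ^ 2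
            * (ENNReal.ofReal ((2 * Real.pi * N) ^ (-2 * σ)) * sobolevSq s c r))) := by gcongr
    _ = _ := by
        have h1 : ENNReal.ofReal ((2 * Real.pi * N) ^ (2 - 2 * σ))
            * ENNReal.ofReal ((2 * Real.pi * N) ^ (-2 * σ))
            = ENNReal.ofReal ((2 * Real.pi * N) ^ (2 - 4 * σ)) := by
          rw [← ENNReal.ofReal_mul (by positivity), ← Real.rpow_add hY]
          congr 2; ring
        rw [ENNReal.ofReal_add (p := (1 + η) * ε ^ 2) (by positivity) (by positivity),
          ENNReal.ofReal_mul (p := 1 + η⁻¹)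
          (by positivity), ENNReal.ofReal_mul (p := 2 * (K : ℝ) ^ 2) (by positivity),
          ENNReal.ofReal_mul (p := 2) (by norm_num), ENNReal.ofReal_pow K.coe_nonneg,
          ENNReal.ofReal_coe_nnreal, ← h1, ENNReal.ofReal_ofNat]
        ring

end IsGalerkin

/-! ### The upper bound for the quasipotential -/

/-- Smooth cutoffs from `1` at `a` to `0` at `a + 1`, with a bound for the derivative that does not
depend on `a`. -/
theorem exists_cutoff : ∃ C : ℝ, ∀ a : ℝ, ∃ θ θ' : ℝ → ℝ, (∀ r, HasDerivAt θ (θ' r) r) ∧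
    Continuous θ' ∧ (∀ r, |θ r| ≤ 1) ∧ (∀ r ≤ a, θ r = 1) ∧ (∀ r < a, θ' r = 0) ∧
    θ (a + 1) = 0 ∧ ∀ r ∈ Icc a (a + 1), |θ' r| ≤ C := by
  have hsm : ContDiff ℝ 1 Real.smoothTransition := Real.smoothTransition.contDiff
  have hd : Continuous (deriv Real.smoothTransition) := hsm.continuous_deriv le_rfl
  obtain ⟨C, hC⟩ := (isCompact_Icc (a := (0 : ℝ)) (b := 1)).exists_bound_of_continuousOn
    hd.continuousOn
  refine ⟨C, fun a => ⟨fun r => 1 - Real.smoothTransition (r - a),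
    fun r => -deriv Real.smoothTransition (r - a), fun r => ?_, ?_, fun r => ?_, fun r hr => ?_,
    fun r hr => ?_, ?_, fun r hr => ?_⟩⟩
  · have h1 := (hsm.differentiable one_ne_zero (r - a)).hasDerivAt
    exact (h1.comp_sub_const r a).const_sub 1
  · exact (hd.comp (continuous_id.sub continuous_const)).neg
  · have h1 := Real.smoothTransition.nonneg (r - a)
    have h2 := Real.smoothTransition.le_one (r - a)
    rw [abs_le]
    constructor <;> linarith
  · simp [Real.smoothTransition.zero_of_nonpos (sub_nonpos.2 hr)]
  · have h1 : Real.smoothTransition =ᶠ[𝓝 (r - a)] fun _ => 0 := by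
      filter_upwards [Iio_mem_nhds (sub_neg.2 hr)] with x hx
      exact Real.smoothTransition.zero_of_nonpos (le_of_lt hx)
    simp [h1.deriv_eq]
  · simp [Real.smoothTransition.one_of_one_le]
  · rw [abs_neg]
    exact hC _ ⟨by linarith [hr.1], by linarith [hr.2]⟩

theorem sum_lintegral_Icc_le (E : ℝ → ℝ≥0∞) (n : ℕ) :
    ∑ j ∈ Finset.range n, ∫⁻ r in Icc (j : ℝ) (j + 1), E r ≤ ∫⁻ r in Icc 0 (n : ℝ), E r := by
  have h : ∀ a b : ℝ, ∫⁻ r in Icc a b, E r = ∫⁻ r in Ioc a b, E r := fun a b =>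
    setLIntegral_congr Ioc_ae_eq_Icc.symm
  simp_rw [h]
  induction n with
  | zero => simp
  | succ n ih =>
    rw [Finset.sum_range_succ]
    push_cast
    rw [← Ioc_union_Ioc_eq_Ioc (Nat.cast_nonneg n) (by linarith : (n : ℝ) ≤ n + 1),
      lintegral_union measurableSet_Ioc (Ioc_disjoint_Ioc_of_le le_rfl)]
    gcongr

/-- Among `n` unit intervals, one carries at most the fraction `1 / n` of the integral. -/
theorem exists_lintegral_Icc_le (E : ℝ → ℝ≥0∞) {n : ℕ} (hn : 0 < n) :
    ∃ j < n, ∫⁻ r in Icc (j : ℝ) (j + 1), E r ≤ (∫⁻ r in Icc 0 (n : ℝ), E r) / n := by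
  by_contra! hcon
  have h1 := ENNReal.sum_lt_sum_of_nonempty (Finset.nonempty_range_iff.2 hn.ne')
    fun j hj => hcon j (Finset.mem_range.1 hj)
  rw [Finset.sum_const, Finset.card_range, nsmul_eq_mul,
    ENNReal.mul_div_cancel (by exact_mod_cast hn.ne') (ENNReal.natCast_ne_top n)] at h1
  exact absurd (sum_lintegral_Icc_le E n) (not_le.2 h1)

section

variable {p : ℝ≥0∞} {f : ℝ → ℝ} {K : NNReal} {B ε s : ℝ} {m : ℝ} {w : L2T}

theorem sum_erase_le (m : ℝ) (w : L2T) (S : Finset ℤ) :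
    ∑ k ∈ S.erase 0, ‖coeff w k‖ ^ 2 ≤ ‖w - constProfile m‖ ^ 2 := by
  refine le_trans (Finset.sum_le_sum fun k hk => le_of_eq ?_)
    (sum_le_hasSum (S.erase 0) (fun k _ => by positivity) (L2T_parseval (w - constProfile m)))
  rw [L2T_coeff_sub, coeff_constProfile_ne m (Finset.ne_of_mem_erase hk), sub_zero]

/-- The cost of the damped Galerkin path with the modes `|k| ≤ n`, stopped within the time interval `[0,n]`. -/
theorem exists_quasipotential_le (hp2 : p ≤ 2) (hs : 1 / 2 < s) (hf : LipschitzWith K f)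
    (hB : ∀ v, |f v| ≤ B) (hε : 0 < ε) (hm : coeff w 0 = m) :
    ∃ σ > (1 / 2 : ℝ), ∃ C' ≥ (0 : ℝ), ∀ η > 0, ∀ n : ℕ, 0 < n →
      quasipotential p ε s f m w ≤ ENNReal.ofReal (ε⁻¹ / 2 * (((1 + η) * ε ^ 2
        + (1 + η⁻¹) * (2 * K ^ 2 * (2 * Real.pi * n) ^ (2 - 4 * σ)))
          * (ε⁻¹ * ‖w - constProfile m‖ ^ 2)
        + C' * (ε⁻¹ * ‖w - constProfile m‖ ^ 2 / n))) := by
  obtain ⟨C, hC⟩ := exists_cutoff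
  refine ⟨min s (3 / 4), lt_min hs (by norm_num), 4 * (ε ^ 2 + C ^ 2) + 8 * K ^ 2, by positivity,
    fun η hη n hn => ?_⟩
  -- an exponent in `]1/2, 1[`, to which the Gagliardo form of the norm applies
  set σ := min s (3 / 4)
  have hσ : 1 / 2 ≤ σ := (lt_min hs (by norm_num)).le
  have hσ1 : σ < 1 := (min_le_right _ _).trans_lt (by norm_num)
  have hσs : σ ≤ s := min_le_left _ _
  have hs0 : 0 < s := by linarith
  have hn' : (0 : ℝ) < n := by exact_mod_cast hn
  set D := ‖w - constProfile m‖ ^ 2 with hD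
  have hD0 : 0 ≤ D := by positivity
  obtain ⟨c, G⟩ := exists_isGalerkin hf hB ε s n hn' (coeff_neg w)
  have henergy := G.lintegral_sobolevSq_le hf hB hε hs0 hn' (sum_erase_le m w)
  obtain ⟨j, hj, hj2⟩ := exists_lintegral_Icc_le (IsGalerkin.sobolevSq s c) hn
  obtain ⟨θ, θ', h1, h2, h3, h4, h5, h6, h7⟩ := hC j
  have hj0 : (0 : ℝ) ≤ j := Nat.cast_nonneg j
  have hjn : (j : ℝ) + 1 ≤ n := by exact_mod_cast hj
  obtain ⟨V, hV, hVc⟩ := G.exists_profile hf hB hε hn'.le (L2T_parseval w).summable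
    (continuous_iff_continuousAt.2 fun r => (h1 r).continuousAt) h3
  set κ₁ := (1 + η) * ε ^ 2 + (1 + η⁻¹) * (2 * K ^ 2 * (2 * Real.pi * n) ^ (2 - 4 * σ)) with hκ₁
  set κ₂ := 4 * (ε ^ 2 + C ^ 2) + 8 * (K : ℝ) ^ 2 with hκ₂
  have hκ₁0 : 0 ≤ κ₁ := by positivity
  have hκ₂0 : 0 ≤ κ₂ := by positivity
  have hbound : ∫⁻ r in Icc 0 ((j : ℝ) + 1), IsGalerkin.controlSq f ε s n c θ θ' V r
      ≤ ENNReal.ofReal (κ₁ * (ε⁻¹ * D) + κ₂ * (ε⁻¹ * D / n)) := by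
    have e1 : ∫⁻ r in Ico 0 (j : ℝ), IsGalerkin.controlSq f ε s n c θ θ' V r
        ≤ ENNReal.ofReal κ₁ * ENNReal.ofReal (ε⁻¹ * D) := by
      refine (setLIntegral_mono' measurableSet_Ico fun r hr => G.controlSq_le hσ hσ1 hσs hf hn hη
        (r := r) ⟨hr.1, by linarith [hr.2]⟩ (h4 r hr.2.le) (h5 r hr.2)
        (hV r ⟨hr.1, by linarith [hr.2]⟩)).trans ?_
      rw [lintegral_const_mul' _ _ ENNReal.ofReal_ne_top]
      gcongr
      refine (lintegral_mono_set ?_).trans henergy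
      exact fun r hr => ⟨hr.1, by linarith [hr.2]⟩
    have e2 : ∫⁻ r in Icc (j : ℝ) (j + 1), IsGalerkin.controlSq f ε s n c θ θ' V r
        ≤ ENNReal.ofReal κ₂ * ENNReal.ofReal (ε⁻¹ * D / n) := by
      refine (setLIntegral_mono' measurableSet_Icc fun r hr => G.controlSq_le_of_abs_le hσ hσ1 hσs
        hf (r := r) (h3 r) (h7 r hr) (hV r ⟨hj0.trans hr.1, hr.2.trans hjn⟩)).trans ?_
      rw [lintegral_const_mul' _ _ ENNReal.ofReal_ne_top]
      gcongr
      refine hj2.trans ?_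
      rw [ENNReal.ofReal_div_of_pos hn', ENNReal.ofReal_natCast]
      gcongr
    rw [← Ico_union_Icc_eq_Icc hj0 (by linarith : (j : ℝ) ≤ j + 1)]
    refine (lintegral_union_le _ _ _).trans ((add_le_add e1 e2).trans_eq ?_)
    rw [← ENNReal.ofReal_mul hκ₁0, ← ENNReal.ofReal_mul hκ₂0, ← ENNReal.ofReal_add]
    · positivity
    · positivity
  refine (G.quasipotential_le hp2 hs0 hf hB hε hm (by linarith : (0 : ℝ) < j + 1) hjn h1 h2 h3
    (h4 0 hj0) h6 hV hVc (hbound.trans_lt ENNReal.ofReal_lt_top)).trans ?_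
  rw [ENNReal.ofReal_mul (by positivity)]
  gcongr

theorem quasipotential_le_half_sq (hp2 : p ≤ 2) (hs : 1 / 2 < s) (hf : LipschitzWith K f)
    (hB : ∀ v, |f v| ≤ B) (hε : 0 < ε) (hm : coeff w 0 = m) :
    quasipotential p ε s f m w ≤ ENNReal.ofReal (1 / 2 * ‖w - constProfile m‖ ^ 2) := by
  obtain ⟨σ, hσ, C', hC', H⟩ := exists_quasipotential_le (p := p) hp2 hs hf hB hε hm
  set D := ‖w - constProfile m‖ ^ 2 with hD
  have hstep : ∀ η > 0, quasipotential p ε s f m w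
      ≤ ENNReal.ofReal (ε⁻¹ / 2 * ((1 + η) * ε ^ 2 * (ε⁻¹ * D))) := fun η hη => by
    have hlim : Tendsto (fun n : ℕ => ε⁻¹ / 2 * (((1 + η) * ε ^ 2
        + (1 + η⁻¹) * (2 * K ^ 2 * (2 * Real.pi * n) ^ (2 - 4 * σ))) * (ε⁻¹ * D)
        + C' * (ε⁻¹ * D / n))) atTop
        (𝓝 (ε⁻¹ / 2 * (((1 + η) * ε ^ 2 + (1 + η⁻¹) * (2 * K ^ 2 * 0)) * (ε⁻¹ * D) + C' * 0))) := by
      have h1 : Tendsto (fun n : ℕ => (2 * Real.pi * n) ^ (2 - 4 * σ)) atTop (𝓝 0) := by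
        have h2 := tendsto_rpow_neg_atTop (y := 4 * σ - 2) (by linarith)
        rw [neg_sub] at h2
        exact h2.comp (tendsto_natCast_atTop_atTop.const_mul_atTop (by positivity))
      have h3 : Tendsto (fun n : ℕ => ε⁻¹ * D / n) atTop (𝓝 0) :=
        tendsto_const_div_atTop_nhds_zero_nat _
      exact ((((h1.const_mul _).const_mul _).const_add _).mul_const _ |>.add
        (h3.const_mul _)).const_mul _
    rw [mul_zero, mul_zero, add_zero, mul_zero, add_zero] at hlim
    refine ge_of_tendsto (ENNReal.tendsto_ofReal hlim) ?_
    filter_upwards [eventually_gt_atTop 0] with n hn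
    exact H η hη n hn
  have hlim : Tendsto (fun η : ℝ => ε⁻¹ / 2 * ((1 + η) * ε ^ 2 * (ε⁻¹ * D))) (𝓝[>] 0)
      (𝓝 (1 / 2 * D)) := by
    have h1 : Continuous fun η : ℝ => ε⁻¹ / 2 * ((1 + η) * ε ^ 2 * (ε⁻¹ * D)) := by fun_prop
    have h2 := (h1.tendsto 0).mono_left (nhdsWithin_le_nhds (s := Ioi 0))
    convert h2 using 2
    field_simp
    ring
  refine ge_of_tendsto (ENNReal.tendsto_ofReal hlim) ?_
  filter_upwards [self_mem_nhdsWithin] with η hη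
  exact hstep η hη

/-! ### The lower bound for the quasipotential -/

/-- A path of finite cost conserves the mean and costs at least half the squared distance. -/
theorem le_cost (hp : 1 ≤ p) (hs : 1 / 2 < s) (hf : LipschitzWith K f) (hB : ∀ v, |f v| ≤ B)
    (hε : 0 < ε) {T : ℝ} (hT : 0 < T) {u : PathX p T} (h0 : u.AtTime 0 (constProfile m))
    (hw : u.AtTime T w) (hu : cost ε s f (constProfile m) u < ⊤) :
    coeff w 0 = m ∧
      ENNReal.ofReal (1 / 2 * ‖w - constProfile m‖ ^ 2) ≤ cost ε s f (constProfile m) u := by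
  by_cases hc : spaceHSq s T u.density < ⊤ ∧ u.IsContL2 ∧ u.AtTime 0 (constProfile m)
  · unfold cost at hu ⊢
    rw [if_pos hc] at hu ⊢
    have key : ∀ h : Lp ℝ 2 (spaceTime T), ∀ hh : spaceHSq s T h < ⊤,
        (∀ φ, IsTest T φ → eqnDefect ε s f T u.density φ
          = ∫ q, h q * fracLap s (φ q.1) q.2 ∂spaceTime T) →
        coeff w 0 = m ∧ ENNReal.ofReal (ε * ‖w - constProfile m‖ ^ 2) ≤ spaceHSq s T h := by
      intro h hh H
      obtain ⟨h1, h2⟩ := le_of_path hp hs hf hB hε hT u h0 hw hc.1 hc.2.1 h hh H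
      refine ⟨h1, ENNReal.ofReal_le_of_le_toReal ?_⟩
      rwa [inv_mul_eq_div, le_div_iff₀' hε] at h2
    refine ⟨?_, ?_⟩
    · have h1 : dualSq s T (eqnDefect ε s f T u.density) < ⊤ :=
        lt_of_not_ge fun h => hu.ne (by
          -- the factor `(2ε)⁻¹` is positive
          rw [top_le_iff.1 h, ENNReal.mul_top]
          simpa using hε)
      unfold dualSq at h1
      simp only [iInf_lt_iff] at h1
      obtain ⟨h, hh, H, -⟩ := h1
      exact (key h hh H).1
    · have h1 : ENNReal.ofReal (1 / 2 * ‖w - constProfile m‖ ^ 2)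
          = ENNReal.ofReal (ε⁻¹ / 2) * ENNReal.ofReal (ε * ‖w - constProfile m‖ ^ 2) := by
        rw [← ENNReal.ofReal_mul (by positivity)]
        congr 1
        field_simp
      rw [h1]
      gcongr
      exact le_iInf fun h => le_iInf fun hh => le_iInf fun H => (key h hh H).2
  · unfold cost at hu
    rw [if_neg hc] at hu
    exact absurd hu (lt_irrefl _)

end

end FracCost

end

open Classical in
theorem theorem2p6 (p : ENNReal) (hp : 1 ≤ p) (hp2 : p < 2)
    (s : ℝ) (hs : 1 / 2 < s)
    (f : ℝ → ℝ) (K : NNReal) (hfLip : LipschitzWith K f) (B : ℝ) (hfBdd : ∀ v, |f v| ≤ B)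
    (ε : ℝ) (hε : 0 < ε) (m : ℝ) (w : FracCost.L2T) :
    FracCost.quasipotential p ε s f m w =
      if ∫ x, w x = m then ENNReal.ofReal (1 / 2 * ‖w - FracCost.constProfile m‖ ^ 2)
      else ⊤ := by
  have hmean : FracCost.coeff w 0 = m ↔ ∫ x, w x = m := by
    rw [FracCost.coeff_zero, Complex.ofReal_inj]
  split_ifs with hm
  · refine le_antisymm
      (FracCost.quasipotential_le_half_sq hp2.le hs hfLip hfBdd hε (hmean.2 hm)) ?_
    refine le_iInf fun T => le_iInf fun hT => le_iInf fun u => le_iInf fun h0 => le_iInf fun hw => ?_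
    rcases lt_or_ge (FracCost.cost ε s f (FracCost.constProfile m) u) ⊤ with hu | hu
    · exact (FracCost.le_cost hp hs hfLip hfBdd hε hT h0 hw hu).2
    · exact le_top.trans hu
  · refine top_le_iff.1 ?_
    refine le_iInf fun T => le_iInf fun hT => le_iInf fun u => le_iInf fun h0 => le_iInf fun hw => ?_
    by_contra hu
    exact hm (hmean.1 (FracCost.le_cost hp hs hfLip hfBdd hε hT h0 hw (not_le.1 hu)).1)
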